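/- Let $\Sigma_1$ and $\Sigma_2$ be tropical fans in finite-dimensional real vector spaces $V_1$ and $V_2$. Then the tropical fan $\Sigma_1\times\Sigma_2$ in $V_1\times V_2$ is Lorentzian if and only if both $\Sigma_1$ and $\Sigma_2$ are Lorentzian. Here a simplicial $d$-fan is a nonempty finite set $\Sigma$ of simplicial cones (possibly irrational) that is closed under taking faces, in which any two cones meet in a common face, and all of whose maximal cones have dimension $d$; $\Sigma(k)$ is its set of $k$-dimensional cones, $\sigma(1)$ is the set of rays of a cone $\sigma$, and $V_\sigma$ is the linear span of $\sigma$. A marking $u$ chooses a nonzero vector $u_\rho\in\rho$ for every ray $\rho\in\Sigma(1)$. A Minkowski $d$-weight on $(\Sigma,u)$ is a function $\omega:\Sigma(d)\to\mathbb{R}$ such that, for every $\tau\in\Sigma(d-1)$, $\sum_{\sigma\in\Sigma(d),\,\sigma\succ\tau}\omega(\sigma)u_{\sigma\setminus\tau}\in V_\tau$, where $\sigma\setminus\tau$ is the ray of $\sigma$ that is not in $\tau$. A marked tropical $d$-fan is a triple $(\Sigma,u,\omega)$ with $\omega$ a positive Minkowski $d$-weight; a tropical $d$-fan is an equivalence class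 of such triples, where $(\Sigma,u,\omega)$ is equivalent to $(\Sigma,u',\omega')$ if there is $\lambda\in\mathbb{R}_{>0}^{\Sigma(1)}$ with $u'_\rho=\lambda_\rho u_\rho$ and $\omega'(\sigma)=\big(\prod_{\rho\in\sigma(1)}\lambda_\rho^{-1}\big)\omega(\sigma)$. The space of divisors $D(\Sigma)$ is the space of piecewise linear functions on the support $|\Sigma|$ modulo restrictions of linear functions. A divisor is strictly convex if, for every $\tau\in\Sigma$, it has a representative that vanishes on $\tau$ and is positive at all points outside $\tau$ of the cones in the neighborhood $N_\tau\Sigma=\{\pi\mid\pi\preceq\sigma,\ \tau\preceq\sigma\text{ for some }\sigma\in\Sigma\}$; $K(\Sigma)$ is the set of strictly convex divisors, and $\Sigma$ is quasiprojective if $K(\Sigma)\ne\emptyset$. The Chow ring $A(\Sigma,u)$ is the quotient of $\mathbb{R}[x_\rho\mid\rho\in\Sigma(1)]$ by the ideal generated by the monomials $x_{\rho_1}\cdots x_{\rho_k}$ for which no cone of $\Sigma$ contains all of $\rho_1,\dots,\rho_k$ and by the linear forms $\sum_\rho\phi(u_\rho)x_\rho$, $\phi\in V^\vee$. The mixed degree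 is $\deg_{\Sigma,u,\omega}(D_1\cdots D_d)=f(X_{D_1}\cdots X_{D_d})$, where $X_{[\phi]}=\sum_\rho\phi(u_\rho)x_\rho$ and $f$ is the linear functional on the degree-$d$ part of $A(\Sigma,u)$ with $f(\prod_{\rho\in\sigma(1)}x_\rho)=\omega(\sigma)$ for all $\sigma\in\Sigma(d)$. For $\tau\in\Sigma$, the star $(\Sigma^\tau,u^\tau,\omega^\tau)$ is the marked tropical fan of dimension $d^\tau=d-\dim\tau$ in $V/V_\tau$ whose cones are the images of the cones of $N_\tau\Sigma$, with the induced marking and weight: $u^\tau_\eta$ is the image of $u_{\hat\eta}$ and $\omega^\tau(\kappa)=\omega(\hat\kappa)$, where $\hat\eta$ and $\hat\kappa$ are the unique ray and the unique $d$-dimensional cone of $N_\tau\Sigma$ with images $\eta$ and $\kappa$. The marked tropical fan $(\Sigma,u,\omega)$ is Lorentzian if $\Sigma$ is quasiprojective and, for every $\tau\in\Sigma$ with $d^\tau\ge 2$ and all $D_3,\dots,D_{d^\tau}\in K(\Sigma^\tau)$, the quadratic form $(D_1,D_2)\mapsto\deg_{\Sigma^\tau,u^\tau,\omega^\tau}(D_1D_2D_3\cdots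 D_{d^\tau})$ on $D(\Sigma^\tau)$ has exactly one positive eigenvalue, that is, signature $(1,q,r)$ for some $q,r$. A tropical fan is Lorentzian if some marked representative of it is. The product of the tropical fans represented by $(\Sigma_1,u_1,\omega_1)$ and $(\Sigma_2,u_2,\omega_2)$, of dimensions $d_1$ and $d_2$, is the tropical $(d_1+d_2)$-fan with cones $\sigma_1\times\sigma_2$, $\sigma_i\in\Sigma_i$, marking $u_{\rho\times 0}=(u_{1,\rho},0)$ and $u_{0\times\rho}=(0,u_{2,\rho})$, and weight $(\omega_1\times\omega_2)(\sigma_1\times\sigma_2)=\omega_1(\sigma_1)\omega_2(\sigma_2)$ for $\sigma_i\in\Sigma_i(d_i)$. -/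

import Mathlib

noncomputable section

namespace LorentzianFans

open scoped Classical

section Cones

variable {V : Type*} [AddCommGroup V] [Module ℝ V]

/-- The linear span `V_σ` of a cone `σ`. -/
abbrev coneSpan (σ : PointedCone ℝ V) : Submodule ℝ V :=
  Submodule.span ℝ (σ : Set V)

/-- The dimension of a cone. -/
def coneDim (σ : PointedCone ℝ V) : ℕ :=
  Module.finrank ℝ (coneSpan σ)

/-- A finite set of cones is a simplicial fan if it is nonempty, every cone in it is simplicial
(generated by finitely many linearly independent vectors; such a cone is polyhedral and strongly
convex), it is closed under passing to faces, and any two of its cones meet in a face of each. -/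
structure IsSimplicialFan (S : Finset (PointedCone ℝ V)) : Prop where
  nonempty : S.Nonempty
  simplicial : ∀ σ ∈ S, σ.IsSimplicial
  face_mem : ∀ σ ∈ S, ∀ τ : PointedCone ℝ V, τ.IsFaceOf σ → τ ∈ S
  inter_isFaceOf : ∀ σ ∈ S, ∀ τ ∈ S, (σ ⊓ τ).IsFaceOf σ ∧ (σ ⊓ τ).IsFaceOf τ

/-- Every inclusion-maximal cone has dimension `d`. -/
def IsPure (S : Finset (PointedCone ℝ V)) (d : ℕ) : Prop :=
  ∀ σ, Maximal (· ∈ S) σ → coneDim σ = d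

end Cones

/-- The data `(Σ, u, ω)`: a finite set `Σ` of cones in `V`, a number `dim` (the intended dimension
of `Σ`), a vector `u_ρ ∈ ρ` on each ray `ρ` of `Σ`, and a real number `ω(σ)` on each cone `σ` of
dimension `dim`. The values of `mark` off the rays and of `weight` off the cones of dimension `dim`
are irrelevant. The axioms of a tropical fan are in `IsTropical`. -/
structure FanData (V : Type*) [AddCommGroup V] [Module ℝ V] where
  cones : Finset (PointedCone ℝ V)
  dim : ℕ
  mark : PointedCone ℝ V → V
  weight : PointedCone ℝ V → ℝ
  mark_mem : ∀ ρ ∈ cones, coneDim ρ = 1 → mark ρ ∈ ρ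

namespace FanData

section Basic

variable {V : Type*} [AddCommGroup V] [Module ℝ V]

/-- The set `Σ(k)` of `k`-dimensional cones. -/
def conesOfDim (F : FanData V) (k : ℕ) : Finset (PointedCone ℝ V) :=
  F.cones.filter fun σ => coneDim σ = k

/-- The set `σ(1)` of rays of a cone `σ`. -/
def raysOf (F : FanData V) (σ : PointedCone ℝ V) : Finset (PointedCone ℝ V) :=
  (F.conesOfDim 1).filter fun ρ => ρ.IsFaceOf σ

/-- `Σ(1)` as a type. -/
abbrev Ray (F : FanData V) : Type _ := {ρ : PointedCone ℝ V // ρ ∈ F.conesOfDim 1}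

/-- The balancing condition: for every `τ ∈ Σ(d-1)`, the sum of `ω(σ) u_{σ∖τ}` over the
`σ ∈ Σ(d)` having `τ` as a face lies in `V_τ`. The inner sum runs over the single ray
`σ∖τ` in `σ(1) ∖ τ(1)`. -/
def IsBalanced (F : FanData V) : Prop :=
  ∀ τ ∈ F.cones, coneDim τ + 1 = F.dim →
    ∑ σ ∈ (F.conesOfDim F.dim).filter (fun σ => τ.IsFaceOf σ),
      ∑ ρ ∈ F.raysOf σ \ F.raysOf τ, F.weight σ • F.mark ρ ∈ coneSpan τ

/-- `(Σ, u, ω)` is a marked tropical `d`-fan: `Σ` is a simplicial fan, pure of dimension `d`, `u` is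
a marking (`u_ρ` is a nonzero vector of the ray `ρ`, that is, it is in the relative interior),
and `ω` is a positive Minkowski `d`-weight on `(Σ, u)`. -/
structure IsTropical (F : FanData V) : Prop where
  isSimplicialFan : IsSimplicialFan F.cones
  isPure : IsPure F.cones F.dim
  mark_ne_zero : ∀ ρ ∈ F.conesOfDim 1, F.mark ρ ≠ 0
  isBalanced : F.IsBalanced
  weight_pos : ∀ σ ∈ F.conesOfDim F.dim, 0 < F.weight σ

/-- Equivalence of marked weighted fans on the same underlying fan: `u' = λ u` and
`ω' = λ⁻¹ · ω` for some positive function `λ` on the rays. A tropical fan `(Σ, ω)` is an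
equivalence class of marked tropical fans `(Σ, u, ω)`. -/
structure Equivalent (F G : FanData V) : Prop where
  cones_eq : G.cones = F.cones
  dim_eq : G.dim = F.dim
  exists_scaling : ∃ c : PointedCone ℝ V → ℝ,
    (∀ ρ ∈ F.conesOfDim 1, 0 < c ρ ∧ G.mark ρ = c ρ • F.mark ρ) ∧
    ∀ σ ∈ F.conesOfDim F.dim, G.weight σ = (∏ ρ ∈ F.raysOf σ, (c ρ)⁻¹) * F.weight σ

/-! ### Chow ring -/

/-- The ideal `I_Σ + J_{Σ,u}` in the polynomial ring on the rays. -/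
def chowIdeal (F : FanData V) : Ideal (MvPolynomial F.Ray ℝ) :=
  Ideal.span {p | ∃ s : Finset F.Ray, (¬ ∃ σ ∈ F.cones, ∀ ρ ∈ s, ρ.1 ≤ σ) ∧
    p = ∏ ρ ∈ s, MvPolynomial.X ρ} ⊔
  Ideal.span {p | ∃ φ : Module.Dual ℝ V,
    p = ∑ ρ : F.Ray, φ (F.mark ρ.1) • MvPolynomial.X ρ}

/-- The Chow ring `A(Σ, u)`. -/
abbrev Chow (F : FanData V) : Type _ := MvPolynomial F.Ray ℝ ⧸ F.chowIdeal

/-- The generator `X_ρ`. -/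
def chowX (F : FanData V) (ρ : F.Ray) : F.Chow :=
  Ideal.Quotient.mk F.chowIdeal (MvPolynomial.X ρ)

/-- The cone monomial `X_σ`, the product of the `X_ρ` over the rays `ρ` of `σ`. -/
def coneMonomial (F : FanData V) (σ : PointedCone ℝ V) : F.Chow :=
  ∏ ρ : F.Ray with ρ.1.IsFaceOf σ, F.chowX ρ

/-- The defining property of the functional `f_{Σ,u,ω}` on the degree `d` part of the Chow ring,
extended by zero to the other degrees: it sends `X_σ` to `ω(σ)` for `σ ∈ Σ(d)`, and
the cone monomials of the other degrees to zero. -/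
def IsDegreeMap (F : FanData V) (f : F.Chow →ₗ[ℝ] ℝ) : Prop :=
  ∀ σ ∈ F.cones, f (F.coneMonomial σ) = if coneDim σ = F.dim then F.weight σ else 0

/-- The functional `f_{Σ,u,ω}`. For a marked tropical fan it exists because `ω` is balanced, and it
is unique because the cone monomials span the Chow ring. -/
def degreeMap (F : FanData V) : F.Chow →ₗ[ℝ] ℝ :=
  if h : ∃ f, F.IsDegreeMap f then h.choose else 0

/-! ### Divisors -/

/-- The support `|Σ|`. -/
def support (F : FanData V) : Set V := {x | ∃ σ ∈ F.cones, x ∈ σ}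

/-- The space `PL(Σ)` of functions on `|Σ|` that are linear on every cone. They are automatically
continuous, since `Σ` is a finite set of closed cones. -/
def PL (F : FanData V) : Submodule ℝ (F.support → ℝ) where
  carrier := {φ | ∀ σ ∈ F.cones, ∃ l : Module.Dual ℝ V, ∀ x : F.support, x.1 ∈ σ → φ x = l x.1}
  zero_mem' := fun _ _ => ⟨0, fun _ _ => by simp⟩
  add_mem' := fun {a b} ha hb σ hσ => by
    obtain ⟨l, hl⟩ := ha σ hσ
    obtain ⟨m, hm⟩ := hb σ hσ
    exact ⟨l + m, fun x hx => by simp [hl x hx, hm x hx]⟩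
  smul_mem' := fun c a ha σ hσ => by
    obtain ⟨l, hl⟩ := ha σ hσ
    exact ⟨c • l, fun x hx => by simp [hl x hx]⟩

/-- The subspace `L(Σ)` of restrictions of linear functions. -/
def linearPL (F : FanData V) : Submodule ℝ F.PL where
  carrier := {φ | ∃ l : Module.Dual ℝ V, ∀ x : F.support, φ.1 x = l x.1}
  zero_mem' := ⟨0, fun _ => by simp⟩
  add_mem' := fun {a b} ha hb => by
    obtain ⟨l, hl⟩ := ha
    obtain ⟨m, hm⟩ := hb
    exact ⟨l + m, fun x => by simp [hl x, hm x]⟩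
  smul_mem' := fun c a ha => by
    obtain ⟨l, hl⟩ := ha
    exact ⟨c • l, fun x => by simp [hl x]⟩

/-- The space of divisors `D(Σ) = PL(Σ) / L(Σ)`. -/
abbrev Div (F : FanData V) : Type _ := F.PL ⧸ F.linearPL

/-- The mark of a ray as a point of the support. -/
def markPoint (F : FanData V) (ρ : F.Ray) : F.support :=
  ⟨F.mark ρ.1, ρ.1, (Finset.mem_filter.1 ρ.2).1,
    F.mark_mem ρ.1 (Finset.mem_filter.1 ρ.2).1 (Finset.mem_filter.1 ρ.2).2⟩

/-- The linear map `PL(Σ) → A(Σ, u)`, `φ ↦ ∑ φ(u_ρ) X_ρ`. -/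
def plToChow (F : FanData V) : F.PL →ₗ[ℝ] F.Chow where
  toFun φ := ∑ ρ : F.Ray, φ.1 (F.markPoint ρ) • F.chowX ρ
  map_add' φ ψ := by simp [add_smul, Finset.sum_add_distrib]
  map_smul' c φ := by simp [Finset.smul_sum, mul_smul]

theorem linearPL_le_ker (F : FanData V) : F.linearPL ≤ LinearMap.ker F.plToChow := by
  rintro φ ⟨l, hl⟩
  have h : F.plToChow φ = Ideal.Quotient.mkₐ ℝ F.chowIdeal
      (∑ ρ : F.Ray, l (F.mark ρ.1) • MvPolynomial.X ρ) := by
    rw [map_sum]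
    refine Finset.sum_congr rfl fun ρ _ => ?_
    rw [map_smul, hl (F.markPoint ρ)]
    rfl
  rw [LinearMap.mem_ker, h]
  exact Ideal.Quotient.eq_zero_iff_mem.2
    ((le_sup_right : _ ≤ F.chowIdeal) (Ideal.subset_span ⟨l, rfl⟩))

/-- The Chow class `X_D` of a divisor `D`: the class of `φ` goes to `∑ φ(u_ρ) X_ρ`. -/
def divToChow (F : FanData V) : F.Div →ₗ[ℝ] F.Chow :=
  F.linearPL.liftQ F.plToChow F.linearPL_le_ker

/-- The bilinear form `(D₁, D₂) ↦ deg(D₁ D₂ E₁ ⋯ E_k)` on `D(Σ)`. -/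
def mixedDegreeForm (F : FanData V) {k : ℕ} (E : Fin k → F.Div) : LinearMap.BilinForm ℝ F.Div :=
  LinearMap.mk₂ ℝ
    (fun D₁ D₂ => F.degreeMap (F.divToChow D₁ * F.divToChow D₂ * ∏ i, F.divToChow (E i)))
    (fun a b c => by simp only [map_add, add_mul])
    (fun c a b => by simp only [map_smul, smul_mul_assoc])
    (fun a b c => by simp only [map_add, mul_add, add_mul])
    (fun c a b => by simp only [map_smul, mul_smul_comm, smul_mul_assoc])

/-- The neighborhood `N_τ Σ`: the faces of the cones of `Σ` that have `τ` as a face. -/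
def nbhd (F : FanData V) (τ : PointedCone ℝ V) : Finset (PointedCone ℝ V) :=
  F.cones.filter fun π => ∃ σ ∈ F.cones, τ.IsFaceOf σ ∧ π.IsFaceOf σ

/-- `D` is strictly convex: for every `τ ∈ Σ`, it has a representative that vanishes on `τ` and is
strictly positive on the rest of the neighborhood of `τ`. -/
def IsStrictlyConvex (F : FanData V) (D : F.Div) : Prop :=
  ∀ τ ∈ F.cones, ∃ φ : F.PL, Submodule.Quotient.mk φ = D ∧
    (∀ x : F.support, x.1 ∈ τ → φ.1 x = 0) ∧
    ∀ x : F.support, (∃ π ∈ F.nbhd τ, x.1 ∈ π) → x.1 ∉ τ → 0 < φ.1 x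

/-- `Σ` is quasiprojective: the set `K(Σ)` of strictly convex divisors is nonempty. -/
def IsQuasiprojective (F : FanData V) : Prop := ∃ D : F.Div, F.IsStrictlyConvex D

/-- The star `(Σ^τ, u^τ, ω^τ)` at `τ`, in `V / V_τ`. Its cones are the images of the cones in
the neighborhood of `τ`; the mark of a ray `η` is the image of the mark of the (unique) ray in
`N_τ Σ` that is mapped onto `η`, and the weight of a maximal cone `κ` is the weight of the (unique)
`d`-dimensional cone in `N_τ Σ` that is mapped onto `κ`. -/
def starFan (F : FanData V) (τ : PointedCone ℝ V) : FanData (V ⧸ coneSpan τ) where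
  cones := (F.nbhd τ).image fun π => π.map (coneSpan τ).mkQ
  dim := F.dim - coneDim τ
  mark η :=
    if h : ∃ ρ ∈ F.nbhd τ, coneDim ρ = 1 ∧ ρ.map (coneSpan τ).mkQ = η then
      (coneSpan τ).mkQ (F.mark h.choose)
    else 0
  weight κ :=
    if h : ∃ σ ∈ F.nbhd τ, coneDim σ = F.dim ∧ σ.map (coneSpan τ).mkQ = κ then
      F.weight h.choose
    else 0
  mark_mem := by
    intro η _ _
    split_ifs with h
    · obtain ⟨h1, h2, h3⟩ := h.choose_spec
      have hm := F.mark_mem _ (Finset.mem_filter.1 h1).1 h2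
      have := (PointedCone.mem_map (f := (coneSpan τ).mkQ)).2 ⟨_, hm, rfl⟩
      rwa [h3] at this
    · exact η.zero_mem

/-- The marked fan `(Σ, u, ω)` is Lorentzian: it is a marked tropical `d`-fan, `Σ` is
quasiprojective, and for every `τ ∈ Σ` whose star has dimension `d^τ ≥ 2` and all
strictly convex divisors `E₁, …, E_{d^τ - 2}` on the star, the quadratic form of
`(D₁, D₂) ↦ deg(D₁ D₂ E₁ ⋯ E_{d^τ - 2})` on the divisors of the star has exactly one
positive eigenvalue, that is, its signature is `(1, q, r)` for some `q` and `r`. -/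
structure IsMarkedLorentzian (F : FanData V) : Prop where
  isTropical : F.IsTropical
  isQuasiprojective : F.IsQuasiprojective
  sigPos_eq_one : ∀ τ ∈ F.cones, 2 ≤ (F.starFan τ).dim →
    ∀ E : Fin ((F.starFan τ).dim - 2) → (F.starFan τ).Div, (∀ i, (F.starFan τ).IsStrictlyConvex (E i)) →
      sigPos ((F.starFan τ).mixedDegreeForm E).toQuadraticMap = 1

/-- The tropical fan represented by `(Σ, u, ω)` is Lorentzian: some marked representative
of it is. -/
def IsLorentzian (F : FanData V) : Prop :=
  ∃ G : FanData V, F.Equivalent G ∧ G.IsMarkedLorentzian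

end Basic

/-- The product `(Σ₁ × Σ₂, u₁ × u₂, ω₁ × ω₂)`. Its cones are the products `σ₁ × σ₂`, of which
`σ₁` and `σ₂` are the images under the projections; its rays are the `ρ × 0`, marked by
`(u_ρ, 0)`, and the `0 × ρ`, marked by `(0, u_ρ)`; and the weight of
`σ₁ × σ₂` is `ω₁(σ₁) ω₂(σ₂)`. -/
def prod {V W : Type*} [AddCommGroup V] [Module ℝ V] [AddCommGroup W] [Module ℝ W]
    (F : FanData V) (G : FanData W) : FanData (V × W) where
  cones := (F.cones ×ˢ G.cones).image fun p => Submodule.prod p.1 p.2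
  dim := F.dim + G.dim
  mark κ :=
    (if coneDim (κ.map (LinearMap.fst ℝ V W)) = 1
      then F.mark (κ.map (LinearMap.fst ℝ V W)) else 0,
     if coneDim (κ.map (LinearMap.snd ℝ V W)) = 1
      then G.mark (κ.map (LinearMap.snd ℝ V W)) else 0)
  weight κ :=
    F.weight (κ.map (LinearMap.fst ℝ V W)) * G.weight (κ.map (LinearMap.snd ℝ V W))
  mark_mem := by
    intro κ hκ _
    obtain ⟨⟨σ, τ⟩, h, rfl⟩ := Finset.mem_image.1 hκ
    obtain ⟨hσ, hτ⟩ := Finset.mem_product.1 h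
    have h1 : PointedCone.map (LinearMap.fst ℝ V W) (Submodule.prod σ τ) = σ := by
      ext x
      simp only [PointedCone.mem_map, Submodule.mem_prod]
      exact ⟨by rintro ⟨y, hy, rfl⟩; exact hy.1, fun hx => ⟨(x, 0), ⟨hx, τ.zero_mem⟩, rfl⟩⟩
    have h2 : PointedCone.map (LinearMap.snd ℝ V W) (Submodule.prod σ τ) = τ := by
      ext x
      simp only [PointedCone.mem_map, Submodule.mem_prod]
      exact ⟨by rintro ⟨y, hy, rfl⟩; exact hy.2, fun hx => ⟨(0, x), ⟨σ.zero_mem, hx⟩, rfl⟩⟩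
    simp only [h1, h2]
    refine Submodule.mem_prod.2 ⟨?_, ?_⟩
    · dsimp only
      split_ifs with hd
      · exact F.mark_mem _ hσ hd
      · exact σ.zero_mem
    · dsimp only
      split_ifs with hd
      · exact G.mark_mem _ hτ hd
      · exact τ.zero_mem

end FanData

end LorentzianFans

end

set_option linter.unusedSectionVars false

noncomputable section

namespace LorentzianFans

/-! Each fan is replaced by combinatorial data: the sets of rays lying in a common cone, the values
of linear functions on the marks, and the weights. A degree map becomes a functional `L` on the
polynomial ring in the rays, and passing to the star at a cone `t` becomes multiplication by the
monomial `x_t`. What matters for the product are the forms `(v, w) ↦ L(x_{t₁} x_{t₂} e₁ ⋯ e_k v w)`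
for faces `t₁`, `t₂` of the factors and strictly convex `e_i`.

From the factors to the product: the degree functional is the tensor product of those of the factors
(`exists_tensor`, `IsDegree.prod`). If `t₂` is a facet, divisors of the second factor are trivial
near it, and the form is one of the first factor (`IsDegree.hasOnePos_facet_iff`); likewise with the
factors exchanged. If `k = 0` and both `t_i` have codimension one, the form is a hyperbolic plane
modulo its radical (`hasOnePos_prod_of_ridge`). All other cases follow by induction on `k` from the
Bochner method (`IsDegree.hasOnePos_cons`). Normalise `e₁` to a function `c` that vanishes on `t`
and is positive on its link. Then the form is `B = ∑ c_r Q_r`, where `Q_r` is the form at `t ∪ {r}`,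
and `B(δ_r, ·) = Q_r(c, ·)`. By induction `Q_r` satisfies the reversed Cauchy–Schwarz inequality
`Q_r(x,x) Q_r(c,c) ≤ Q_r(c,x)²`. Summed over `r`, this says that `B`, relative to a positive
diagonal form for which `c` has eigenvalue `1`, has no eigenvalue strictly between `0` and `1`. As
the off-diagonal entries of `B` are nonnegative, Perron–Frobenius shows that no eigenvalue exceeds
`1`, and that `1` is simple if the link is connected. In a product the link is a join of two
nonempty links, hence connected.

From the product to a factor: the star of `Σ₁ × Σ₂` at `0 × σ`, with `σ` a maximal cone of `Σ₂`, is
`Σ₁` up to a scaling of the weight, and divisors on it lift by zero because every divisor is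
strictly convex around a facet.

The rest translates between fans and complexes (`IsModel.isMarkedLorentzian_iff`). A change of
marked representative is a rescaling of the variables. The Lorentzian property provides no degree
functional in dimension at most one, so there it is built from the balancing condition; conversely,
the degree functional of the product shows that the product is balanced. -/

/-! ### Symmetric bilinear forms with exactly one positive eigenvalue -/

section HasOnePos

variable {M N : Type*} [AddCommGroup M] [Module ℝ M] [AddCommGroup N] [Module ℝ N]

/-- A bilinear form that is positive somewhere, and nonpositive on the orthogonal complement of
any vector on which it is positive. -/
structure HasOnePos (B : LinearMap.BilinForm ℝ M) : Prop where
  exists_pos : ∃ v, 0 < B v v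
  nonpos : ∀ v x, 0 < B v v → B v x = 0 → B x x ≤ 0

/-- One positive vector with nonpositive orthogonal complement is enough: if `v'` and `x` were
orthogonal and both positive, they would span a positive definite plane, and such a plane meets the
complement of `v`. -/
theorem HasOnePos.of_exists {B : LinearMap.BilinForm ℝ M} (hB : ∀ x y, B x y = B y x) {v : M}
    (hv : 0 < B v v) (h : ∀ x, B v x = 0 → B x x ≤ 0) : HasOnePos B := by
  refine ⟨⟨v, hv⟩, fun v' x hv' hx => ?_⟩
  by_contra! hpos
  have h1 := h (B v x • v' - B v v' • x) (by simp; ring)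
  have h2 : B (B v x • v' - B v v' • x) (B v x • v' - B v v' • x)
      = (B v x) ^ 2 * B v' v' + (B v v') ^ 2 * B x x := by
    have := hB x v'
    simp [hx, this]; ring
  rw [h2] at h1
  have h3 : B v v' ≠ 0 := fun h0 => absurd (h v' h0) (not_le.2 hv')
  have h4 : 0 < (B v v') ^ 2 := by positivity
  nlinarith [mul_pos h4 hpos, mul_nonneg (sq_nonneg (B v x)) hv'.le]

/-- The reversed Cauchy–Schwarz inequality. -/
theorem HasOnePos.mul_le_sq {B : LinearMap.BilinForm ℝ M} (h : HasOnePos B)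
    (hB : ∀ x y, B x y = B y x) {v : M} (hv : 0 < B v v) (x : M) :
    B x x * B v v ≤ B v x ^ 2 := by
  have h1 := h.nonpos v (B v v • x - B v x • v) hv (by simp; ring)
  have h2 : B (B v v • x - B v x • v) (B v v • x - B v x • v)
      = B v v * (B x x * B v v - B v x ^ 2) := by
    have := hB x v
    simp [this]; ring
  rw [h2] at h1
  by_contra! h3
  nlinarith [mul_pos hv (sub_pos.2 h3)]

/-- Invariance under a linear map that is surjective modulo the radical, and under positive
scaling. -/
theorem hasOnePos_comp_iff {B : LinearMap.BilinForm ℝ M} {B' : LinearMap.BilinForm ℝ N}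
    (f : N →ₗ[ℝ] M) {a : ℝ} (ha : 0 < a) (hf : ∀ x y, B' x y = a * B (f x) (f y))
    (hs : ∀ v, ∃ w, (∀ x, B v x = B (f w) x) ∧ ∀ x, B x v = B x (f w)) :
    HasOnePos B' ↔ HasOnePos B := by
  have hpos : ∀ x, 0 < B' x x ↔ 0 < B (f x) (f x) := fun x => by
    rw [hf, mul_pos_iff_of_pos_left ha]
  have hzero : ∀ x y, B' x y = 0 ↔ B (f x) (f y) = 0 := fun x y => by
    rw [hf, mul_eq_zero, or_iff_right ha.ne']
  constructor
  · rintro ⟨⟨v, hv⟩, h⟩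
    refine ⟨⟨f v, (hpos v).1 hv⟩, fun v x hv hx => ?_⟩
    obtain ⟨v', h1, h2⟩ := hs v
    obtain ⟨x', h3, h4⟩ := hs x
    have := h v' x' (by rwa [hpos, ← h1, ← h2]) (by rwa [hzero, ← h1, ← h4])
    rw [← not_lt, hpos, ← h3, ← h4] at this
    exact not_lt.1 this
  · rintro ⟨⟨v, hv⟩, h⟩
    obtain ⟨v', h1, h2⟩ := hs v
    refine ⟨⟨v', by rwa [hpos, ← h1, ← h2]⟩, fun v x hv hx => ?_⟩
    rw [hpos] at hv
    rw [hzero] at hx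
    rw [← not_lt, hpos, not_lt]
    exact h _ _ hv hx

/-- Two orthogonal positive vectors would span a positive definite plane. Conversely, the kernel of
`B v` has codimension at most one, and a form that is nonpositive there has at most one positive
eigenvalue. -/
theorem sigPos_eq_one_iff [FiniteDimensional ℝ M] {B : LinearMap.BilinForm ℝ M}
    (hB : ∀ x y, B x y = B y x) : sigPos B.toQuadraticMap = 1 ↔ HasOnePos B := by
  constructor
  · intro h
    obtain ⟨V, hV, hp⟩ := exists_finrank_eq_sigPos_and_posDef B.toQuadraticMap
    rw [h] at hV
    obtain ⟨v, hv, -⟩ := finrank_eq_one_iff'.1 hV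
    have hvv : 0 < B v.1 v.1 := by simpa using hp v hv
    refine ⟨⟨v, hvv⟩, fun v x hv hx => ?_⟩
    by_contra! hxx
    have hxv : B x v = 0 := by rw [hB, hx]
    have hq : ∀ a b : ℝ, B (a • v + b • x) (a • v + b • x) = a ^ 2 * B v v + b ^ 2 * B x x := by
      intro a b
      simp [hx, hxv]; ring
    have hli : LinearIndependent ℝ ![v, x] := by
      rw [LinearIndependent.pair_iff]
      intro a b hab
      have h1 := hq a b
      rw [hab] at h1
      simp only [map_zero] at h1
      have h2 := mul_nonneg (sq_nonneg a) hv.le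
      have h3 := mul_nonneg (sq_nonneg b) hxx.le
      have ha : a ^ 2 * B v v = 0 := by linarith
      have hb : b ^ 2 * B x x = 0 := by linarith
      simp [hv.ne', hxx.ne'] at ha hb
      exact ⟨ha, hb⟩
    have hfr := finrank_span_eq_card hli
    have hle := le_sigPos_of_posDef B.toQuadraticMap
      (V := Submodule.span ℝ (Set.range ![v, x])) (by
        rintro ⟨y, hy⟩ hy0
        simp only [Matrix.range_cons, Matrix.range_empty, Set.union_empty,
          Set.singleton_union] at hy
        obtain ⟨a, b, rfl⟩ := Submodule.mem_span_pair.1 hy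
        have h2 : 0 < a ^ 2 * B v v + b ^ 2 * B x x := by
          have h2 := mul_nonneg (sq_nonneg a) hv.le
          have h3 := mul_nonneg (sq_nonneg b) hxx.le
          rcases eq_or_ne a 0 with rfl | ha
          · rcases eq_or_ne b 0 with rfl | hb
            · simp at hy0
            · have := mul_pos (by positivity : 0 < b ^ 2) hxx
              linarith
          · have := mul_pos (by positivity : 0 < a ^ 2) hv
            linarith
        rw [← hq] at h2
        exact h2)
    rw [hfr, h] at hle
    simp at hle
  · rintro ⟨⟨v, hv⟩, h⟩
    have hv0 : v ≠ 0 := by rintro rfl; simp at hv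
    apply le_antisymm
    · have h1 := QuadraticForm.sigPos_add_finrank_le_of_nonpos (Q := B.toQuadraticMap)
        (V := LinearMap.ker (B v)) (fun x hx => h v x hv hx)
      have h2 := LinearMap.finrank_range_add_finrank_ker (B v)
      have h3 : Module.finrank ℝ (LinearMap.range (B v)) ≤ 1 := by
        simpa using (LinearMap.range (B v)).finrank_le
      omega
    · have h1 := le_sigPos_of_posDef B.toQuadraticMap (V := Submodule.span ℝ {v}) (by
        rintro ⟨y, hy⟩ hy0
        obtain ⟨a, rfl⟩ := Submodule.mem_span_singleton.1 hy
        have ha : a ≠ 0 := by rintro rfl; simp at hy0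
        have : 0 < a * (a * B v v) := by
          rw [← mul_assoc]
          exact mul_pos (mul_self_pos.2 ha) hv
        simpa using this)
      rwa [finrank_span_singleton hv0] at h1

end HasOnePos

/-! ### The Bochner method -/

section Bochner

variable {ι : Type*} [Fintype ι] [DecidableEq ι]

theorem bilin_eq_sum (B : LinearMap.BilinForm ℝ (ι → ℝ)) (x y : ι → ℝ) :
    B x y = ∑ i, x i * B (Pi.single i 1) y := by
  conv_lhs => rw [pi_eq_sum_univ' x]
  rw [map_sum, LinearMap.sum_apply]
  refine Finset.sum_congr rfl fun i _ => ?_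
  rw [map_smul]; rfl

theorem bilin_eq_sum' (B : LinearMap.BilinForm ℝ (ι → ℝ)) (x y : ι → ℝ) :
    B x y = ∑ j, y j * B x (Pi.single j 1) := by
  conv_lhs => rw [pi_eq_sum_univ' y]
  rw [map_sum]
  refine Finset.sum_congr rfl fun i _ => ?_
  rw [map_smul]; rfl

/-- The Perron–Frobenius identity for a form having `c` as a generalized eigenvector. -/
theorem two_mul_sub_bilin_eq_sum {B : LinearMap.BilinForm ℝ (ι → ℝ)} (hB : ∀ x y, B x y = B y x)
    {c : ι → ℝ} (hc : ∀ i, 0 < c i) (x : ι → ℝ) :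
    2 * (∑ i, B (Pi.single i 1) c / c i * x i ^ 2 - B x x) =
      ∑ i, ∑ j, B (Pi.single i 1) (Pi.single j 1) * (c i * c j) * (x i / c i - x j / c j) ^ 2 := by
  have e1 : ∀ i, B (Pi.single i 1) c / c i * x i ^ 2
      = ∑ j, B (Pi.single i 1) (Pi.single j 1) * (c i * c j) * (x i / c i) ^ 2 := by
    intro i
    rw [bilin_eq_sum' B _ c, Finset.sum_div, Finset.sum_mul]
    refine Finset.sum_congr rfl fun j _ => ?_
    have := (hc i).ne'
    field_simp
  have e2 : ∑ i, B (Pi.single i 1) c / c i * x i ^ 2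
      = ∑ i, ∑ j, B (Pi.single i 1) (Pi.single j 1) * (c i * c j) * (x j / c j) ^ 2 := by
    rw [Finset.sum_congr rfl fun i _ => e1 i, Finset.sum_comm]
    refine Finset.sum_congr rfl fun i _ => Finset.sum_congr rfl fun j _ => ?_
    rw [hB, mul_comm (c i)]
  have e3 : B x x = ∑ i, ∑ j, B (Pi.single i 1) (Pi.single j 1) * (c i * c j) *
      ((x i / c i) * (x j / c j)) := by
    rw [bilin_eq_sum B x x]
    refine Finset.sum_congr rfl fun i _ => ?_
    rw [bilin_eq_sum' B _ x, Finset.mul_sum]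
    refine Finset.sum_congr rfl fun j _ => ?_
    have := (hc i).ne'
    have := (hc j).ne'
    field_simp
  have e4 : 2 * (∑ i, B (Pi.single i 1) c / c i * x i ^ 2 - B x x)
      = ∑ i, B (Pi.single i 1) c / c i * x i ^ 2 + ∑ i, B (Pi.single i 1) c / c i * x i ^ 2
        - 2 * B x x := by ring
  rw [e4]
  nth_rw 1 [Finset.sum_congr rfl fun i _ => e1 i]
  rw [e2, e3, ← Finset.sum_add_distrib, Finset.mul_sum, ← Finset.sum_sub_distrib]
  refine Finset.sum_congr rfl fun i _ => ?_
  rw [← Finset.sum_add_distrib, Finset.mul_sum, ← Finset.sum_sub_distrib]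
  refine Finset.sum_congr rfl fun j _ => ?_
  ring

/-- An eigenvector with positive eigenvalue is proportional to `c`. -/
theorem eigenvector_proportional {B : LinearMap.BilinForm ℝ (ι → ℝ)} (hB : ∀ x y, B x y = B y x)
    {c : ι → ℝ} (hc : ∀ i, 0 < c i) (hoff : ∀ i j, i ≠ j → 0 ≤ B (Pi.single i 1) (Pi.single j 1))
    (hpos : ∀ i, 0 < B (Pi.single i 1) c)
    (hbochner : ∀ x, B x x ≤ ∑ i, (B (Pi.single i 1) x) ^ 2 * c i / B (Pi.single i 1) c)
    (hconn : ∀ y : ι → ℝ, (∀ i j, i ≠ j → 0 < B (Pi.single i 1) (Pi.single j 1) → y i = y j) →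
      ∀ i j, y i = y j)
    {x : ι → ℝ} {m : ℝ} (hm : 0 < m)
    (hx : ∀ i, B (Pi.single i 1) x = m * (B (Pi.single i 1) c / c i * x i)) :
    ∀ i j, x i / c i = x j / c j := by
  by_cases hx0 : x = 0
  · simp [hx0]
  -- Relative to the diagonal form with entries `p`, the vector `c` has eigenvalue `1` and `x` has
  -- eigenvalue `m`.
  set p : ι → ℝ := fun i => B (Pi.single i 1) c / c i with hp
  have hp0 : ∀ i, 0 < p i := fun i => div_pos (hpos i) (hc i)
  have hD : 0 < ∑ i, p i * x i ^ 2 := by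
    obtain ⟨i, hi⟩ := Function.ne_iff.1 hx0
    refine Finset.sum_pos' (fun i _ => mul_nonneg (hp0 i).le (sq_nonneg _))
      ⟨i, Finset.mem_univ i, mul_pos (hp0 i) ?_⟩
    have : x i ≠ 0 := hi
    positivity
  have h1 : B x x = m * ∑ i, p i * x i ^ 2 := by
    rw [bilin_eq_sum B x x, Finset.mul_sum]
    refine Finset.sum_congr rfl fun i _ => ?_
    rw [hx]; simp only [hp]; ring
  have h2 : B x x ≤ m ^ 2 * ∑ i, p i * x i ^ 2 := by
    refine (hbochner x).trans_eq ?_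
    rw [Finset.mul_sum]
    refine Finset.sum_congr rfl fun i _ => ?_
    rw [hx]; simp only [hp]
    have := (hc i).ne'
    have := (hpos i).ne'
    field_simp
  -- For an eigenvector the Bochner inequality reads `m ≤ m ^ 2`, after cancelling `∑ p x²`.
  have h3 : 1 ≤ m := by
    rw [h1] at h2
    have h4 : m ≤ m ^ 2 := le_of_mul_le_mul_right h2 hD
    nlinarith
  -- The left side equals `2 (1 - m) ∑ p x² ≤ 0`, while the right side is a sum of nonnegative
  -- terms. So every term vanishes, and `x / c` is constant along the positive entries.
  have h4 := two_mul_sub_bilin_eq_sum hB hc x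
  have hnn : ∀ i j, 0 ≤ B (Pi.single i 1) (Pi.single j 1) * (c i * c j) *
      (x i / c i - x j / c j) ^ 2 := by
    intro i j
    rcases eq_or_ne i j with rfl | hij
    · simp
    · have := hoff i j hij
      have := hc i
      have := hc j
      positivity
  have h5 : ∑ i, ∑ j, B (Pi.single i 1) (Pi.single j 1) * (c i * c j) *
      (x i / c i - x j / c j) ^ 2 = 0 := by
    apply le_antisymm
    · rw [← h4, h1]
      nlinarith [mul_nonneg (sub_nonneg.2 h3) hD.le]
    · exact Finset.sum_nonneg fun i _ => Finset.sum_nonneg fun j _ => hnn i j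
  apply hconn
  intro i j hij hpos'
  rw [Finset.sum_eq_zero_iff_of_nonneg
    fun i _ => Finset.sum_nonneg fun j _ => hnn i j] at h5
  have h6 := h5 i (Finset.mem_univ i)
  rw [Finset.sum_eq_zero_iff_of_nonneg fun j _ => hnn i j] at h6
  have h7 := h6 j (Finset.mem_univ j)
  have := (hc i).ne'
  have := (hc j).ne'
  simpa [hpos'.ne', (hc i).ne', (hc j).ne', sub_eq_zero] using h7

/-- A form with nonnegative connected off-diagonal entries satisfying the Bochner inequality
has exactly one positive eigenvalue. -/
theorem hasOnePos_of_bochner [Nonempty ι] {B : LinearMap.BilinForm ℝ (ι → ℝ)}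
    (hB : ∀ x y, B x y = B y x)
    {c : ι → ℝ} (hc : ∀ i, 0 < c i) (hoff : ∀ i j, i ≠ j → 0 ≤ B (Pi.single i 1) (Pi.single j 1))
    (hpos : ∀ i, 0 < B (Pi.single i 1) c)
    (hbochner : ∀ x, B x x ≤ ∑ i, (B (Pi.single i 1) x) ^ 2 * c i / B (Pi.single i 1) c)
    (hconn : ∀ y : ι → ℝ, (∀ i j, i ≠ j → 0 < B (Pi.single i 1) (Pi.single j 1) → y i = y j) →
      ∀ i j, y i = y j) : HasOnePos B := by
  have hcc : 0 < B c c := by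
    rw [bilin_eq_sum]
    exact Finset.sum_pos (fun i _ => mul_pos (hc i) (hpos i)) Finset.univ_nonempty
  refine HasOnePos.of_exists hB hcc fun x hx => ?_
  set p : ι → ℝ := fun i => B (Pi.single i 1) c / c i with hp
  have hp0 : ∀ i, 0 < p i := fun i => div_pos (hpos i) (hc i)
  -- Conjugation by `√p` turns the eigenvalue problem relative to `p` into that of the symmetric
  -- matrix `A`, to which the spectral theorem applies.
  set q : ι → ℝ := fun i => √(p i) with hq
  have hq0 : ∀ i, 0 < q i := fun i => Real.sqrt_pos.2 (hp0 i)
  have hqq : ∀ i, q i * q i = p i := fun i => Real.mul_self_sqrt (hp0 i).le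
  let A : Matrix ι ι ℝ := fun i j => B (Pi.single i 1) (Pi.single j 1) / (q i * q j)
  have hA : A.IsHermitian := by
    ext i j
    change B (Pi.single j 1) (Pi.single i 1) / (q j * q i) = _ / (q i * q j)
    rw [hB, mul_comm]
  have hAv : ∀ (z : ι → ℝ) i, q i * (A.mulVec z) i = B (Pi.single i 1) (fun j => z j / q j) := by
    intro z i
    rw [bilin_eq_sum', Matrix.mulVec, dotProduct, Finset.mul_sum]
    refine Finset.sum_congr rfl fun j _ => ?_
    have := (hq0 i).ne'
    have := (hq0 j).ne'
    simp only [A]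
    field_simp
  let b := hA.eigenvectorBasis
  have hb : ∀ k i, B (Pi.single i 1) (fun j => b k j / q j)
      = hA.eigenvalues k * (p i * (b k i / q i)) := by
    intro k i
    have h1 := congrFun (hA.mulVec_eigenvectorBasis k) i
    have h2 := hAv (b k) i
    rw [← h2, h1, ← hqq]
    have := (hq0 i).ne'
    simp only [Pi.smul_apply, smul_eq_mul, b]
    field_simp
  let z : EuclideanSpace ℝ ι := WithLp.toLp 2 fun i => q i * x i
  have hxz : (fun j => z j / q j) = x := by
    ext j
    have := (hq0 j).ne'
    simp [z, this]
  have hBz : ∀ k, B x (fun j => b k j / q j) = hA.eigenvalues k * inner ℝ (b k) z := by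
    intro k
    rw [bilin_eq_sum, PiLp.inner_apply, Finset.mul_sum]
    refine Finset.sum_congr rfl fun i _ => ?_
    rw [hb]
    have := (hq0 i).ne'
    simp only [z, RCLike.inner_apply, conj_trivial]
    rw [← hqq]
    field_simp
  have hexp : x = ∑ k, inner ℝ (b k) z • (fun j => b k j / q j) := by
    have h1 := b.sum_repr' z
    ext j
    have h2 := congrArg (fun v : EuclideanSpace ℝ ι => v j / q j) h1
    simp only [WithLp.ofLp_sum, Finset.sum_apply, PiLp.smul_apply, smul_eq_mul] at h2
    rw [congrFun hxz j] at h2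
    rw [← h2, Finset.sum_div, Finset.sum_apply]
    refine Finset.sum_congr rfl fun k _ => ?_
    simp [mul_div_assoc]
  have hBx : B x x = ∑ k, hA.eigenvalues k * inner ℝ (b k) z ^ 2 := by
    refine (congrArg (B x) hexp).trans ?_
    rw [map_sum]
    refine Finset.sum_congr rfl fun k _ => ?_
    rw [map_smul, hBz, smul_eq_mul]
    ring
  rw [hBx]
  refine Finset.sum_nonpos fun k _ => ?_
  rcases le_or_gt (hA.eigenvalues k) 0 with hk | hk
  · exact mul_nonpos_of_nonpos_of_nonneg hk (sq_nonneg _)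
  -- An eigenvector with positive eigenvalue is a multiple of `c`, hence orthogonal to `x`, and does
  -- not contribute to the expansion of `x`.
  · have hprop := eigenvector_proportional hB hc hoff hpos hbochner hconn hk (hb k)
    obtain ⟨i₀⟩ := ‹Nonempty ι›
    have h1 : (fun j => b k j / q j) = (b k i₀ / q i₀ / c i₀) • c := by
      ext j
      have := hprop i₀ j
      simp only [Pi.smul_apply, smul_eq_mul]
      rw [this]
      have := (hc j).ne'
      field_simp
    have h2 := hBz k
    rw [h1, map_smul, hB, hx, smul_zero] at h2
    have h3 : inner ℝ (b k) z = 0 := by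
      rcases mul_eq_zero.1 h2.symm with h | h
      · exact absurd h hk.ne'
      · exact h
    simp [h3]

end Bochner

end LorentzianFans

end

noncomputable section

namespace LorentzianFans

open MvPolynomial

/-! ### Weighted complexes and their degree functionals -/

/-- The combinatorial data of a weighted marked fan: a family of subsets of a set of rays, the
space of functions on the rays induced by linear functions, a dimension and a weight on the sets
of that size. Elements that lie in no face are permitted. -/
structure WeightedComplex (R : Type*) where
  face : Finset R → Prop
  lin : Submodule ℝ (R → ℝ)
  dim : ℕ
  weight : Finset R → ℝ

namespace WeightedComplex

variable {R : Type*}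

/-- The faces form a pure simplicial complex, the linear functions separate the elements of every
face, and the weight is positive on the facets. -/
structure IsGood (C : WeightedComplex R) : Prop where
  empty_face : C.face ∅
  mono : ∀ {s t : Finset R}, C.face t → s ⊆ t → C.face s
  pure : ∀ {s : Finset R}, C.face s → ∃ t, s ⊆ t ∧ C.face t ∧ t.card = C.dim
  exists_dual : ∀ {s : Finset R}, C.face s → ∀ r ∈ s,
    ∃ φ ∈ C.lin, φ r = 1 ∧ ∀ r' ∈ s, r' ≠ r → φ r' = 0
  weight_pos : ∀ {s : Finset R}, C.face s → s.card = C.dim → 0 < C.weight s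

theorem IsGood.card_le {C : WeightedComplex R} (hC : C.IsGood) {s : Finset R} (hs : C.face s) :
    s.card ≤ C.dim := by
  obtain ⟨t, hst, -, ht⟩ := hC.pure hs
  exact ht ▸ Finset.card_le_card hst

theorem IsGood.exists_lin_eqOn [DecidableEq R] {C : WeightedComplex R} (hC : C.IsGood)
    {s : Finset R} (hs : C.face s) (e : R → ℝ) : ∃ φ ∈ C.lin, ∀ r ∈ s, e r = φ r := by
  choose! f hf using fun r => hC.exists_dual hs r
  refine ⟨∑ r ∈ s, e r • f r, C.lin.sum_mem fun r hr => C.lin.smul_mem _ (hf r hr).1,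
    fun r hr => ?_⟩
  rw [Finset.sum_apply, Finset.sum_eq_single r]
  · simp [(hf r hr).2.1]
  · intro b hb hbr
    simp [(hf b hb).2.2 r hr hbr.symm]
  · exact fun h => absurd hr h

/-- The functions that are strictly convex around every face containing `t`. -/
def conv [DecidableEq R] (C : WeightedComplex R) (t : Finset R) : Set (R → ℝ) :=
  {e | ∀ s, t ⊆ s → C.face s → ∃ φ ∈ C.lin, (∀ r ∈ s, e r = φ r) ∧
    ∀ r ∉ s, C.face (insert r s) → φ r < e r}

theorem conv_mono [DecidableEq R] {C : WeightedComplex R} {t t' : Finset R} (h : t ⊆ t') :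
    C.conv t ⊆ C.conv t' :=
  fun _ he s hs hf => he s (h.trans hs) hf

theorem sub_mem_conv [DecidableEq R] {C : WeightedComplex R} {t : Finset R} {e φ : R → ℝ}
    (he : e ∈ C.conv t) (hφ : φ ∈ C.lin) : e - φ ∈ C.conv t := by
  intro s hs hf
  obtain ⟨ψ, hψ, h1, h2⟩ := he s hs hf
  refine ⟨ψ - φ, C.lin.sub_mem hψ hφ, fun r hr => by simp [h1 r hr], fun r hr hrs => ?_⟩
  simpa using h2 r hr hrs

/-- The elements `r ∉ t` such that `t ∪ {r}` is a face. -/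
def link [Fintype R] [DecidableEq R] (C : WeightedComplex R) (t : Finset R) : Finset R :=
  open scoped Classical in Finset.univ.filter fun r => r ∉ t ∧ C.face (insert r t)

theorem mem_link [Fintype R] [DecidableEq R] {C : WeightedComplex R} {t : Finset R} {r : R} :
    r ∈ C.link t ↔ r ∉ t ∧ C.face (insert r t) := by
  simp [link]

theorem IsGood.link_nonempty [Fintype R] [DecidableEq R] {C : WeightedComplex R} (hC : C.IsGood)
    {t : Finset R} (ht : C.face t) (htc : t.card ≠ C.dim) : (C.link t).Nonempty := by
  obtain ⟨s, hts, hs, hsc⟩ := hC.pure ht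
  obtain ⟨r, hrs, hrt⟩ : ∃ r ∈ s, r ∉ t := by
    by_contra! h
    exact htc (by rw [hts.antisymm h, hsc])
  exact ⟨r, mem_link.2 ⟨hrt, hC.mono hs (Finset.insert_subset hrs hts)⟩⟩

end WeightedComplex

/-- The squarefree monomial of a finite set of variables. -/
def setMonomial {R : Type*} (s : Finset R) : MvPolynomial R ℝ := ∏ r ∈ s, X r

theorem setMonomial_insert {R : Type*} [DecidableEq R] {s : Finset R} {r : R} (h : r ∉ s) :
    setMonomial (insert r s) = X r * setMonomial s :=
  Finset.prod_insert h

theorem setMonomial_union {R : Type*} [DecidableEq R] {s t : Finset R} (h : Disjoint s t) :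
    setMonomial (s ∪ t) = setMonomial s * setMonomial t :=
  Finset.prod_union h

@[simp]
theorem setMonomial_empty {R : Type*} : setMonomial (∅ : Finset R) = 1 :=
  Finset.prod_empty

/-- The linear form with given coefficients. -/
def linForm {R : Type*} [Fintype R] : (R → ℝ) →ₗ[ℝ] MvPolynomial R ℝ :=
  Fintype.linearCombination ℝ X

theorem linForm_apply {R : Type*} [Fintype R] (w : R → ℝ) :
    linForm w = ∑ r, w r • (X r : MvPolynomial R ℝ) :=
  Fintype.linearCombination_apply ..

@[simp]
theorem linForm_single {R : Type*} [Fintype R] [DecidableEq R] (r : R) :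
    linForm (Pi.single r 1) = (X r : MvPolynomial R ℝ) := by
  simp [linForm]

/-- The bilinear form `(v, w) ↦ L (p v w)` on linear forms. -/
def degForm {R : Type*} [Fintype R] (L : MvPolynomial R ℝ →ₗ[ℝ] ℝ) (p : MvPolynomial R ℝ) :
    LinearMap.BilinForm ℝ (R → ℝ) :=
  LinearMap.mk₂ ℝ (fun v w => L (p * (linForm v * linForm w)))
    (fun a b c => by simp only [map_add, add_mul, mul_add])
    (fun c a b => by simp only [map_smul, smul_mul_assoc, mul_smul_comm])
    (fun a b c => by simp only [map_add, mul_add])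
    (fun c a b => by simp only [map_smul, mul_smul_comm])

theorem degForm_apply {R : Type*} [Fintype R] (L : MvPolynomial R ℝ →ₗ[ℝ] ℝ)
    (p : MvPolynomial R ℝ) (v w : R → ℝ) :
    degForm L p v w = L (p * (linForm v * linForm w)) := rfl

theorem degForm_symm {R : Type*} [Fintype R] (L : MvPolynomial R ℝ →ₗ[ℝ] ℝ)
    (p : MvPolynomial R ℝ) (v w : R → ℝ) : degForm L p v w = degForm L p w v := by
  rw [degForm_apply, degForm_apply, mul_comm (linForm v)]

namespace WeightedComplex

variable {R : Type*} [Fintype R] [DecidableEq R]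

/-- `L` factors through the degree-`dim` part of the Chow ring and takes the weight of a facet on
its monomial. -/
structure IsDegree (C : WeightedComplex R) (L : MvPolynomial R ℝ →ₗ[ℝ] ℝ) : Prop where
  nonface : ∀ s, ¬ C.face s → ∀ p, L (setMonomial s * p) = 0
  lin : ∀ φ ∈ C.lin, ∀ p, L (linForm φ * p) = 0
  face : ∀ s, C.face s → L (setMonomial s) = if s.card = C.dim then C.weight s else 0

variable {C : WeightedComplex R} {L : MvPolynomial R ℝ →ₗ[ℝ] ℝ}

namespace IsDegree

theorem linForm_congr (hL : C.IsDegree L) {a b : R → ℝ} (h : a - b ∈ C.lin)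
    (p : MvPolynomial R ℝ) : L (linForm a * p) = L (linForm b * p) := by
  have := hL.lin _ h p
  rwa [map_sub, sub_mul, map_sub, sub_eq_zero] at this

/-- Once a divisor is represented by a function vanishing on `t`, only the variables of the link
survive in its product with `x_t`: the others have coefficient zero or complete `x_t` to a nonface.
-/
theorem setMonomial_mul_linForm (hL : C.IsDegree L) {t : Finset R} {e : R → ℝ}
    (he : ∀ r ∈ t, e r = 0) (p : MvPolynomial R ℝ) :
    L (setMonomial t * (linForm e * p)) =
      ∑ r ∈ C.link t, e r * L (setMonomial (insert r t) * p) := by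
  have h1 : setMonomial t * (linForm e * p) = ∑ r, e r • (setMonomial t * (X r * p)) := by
    rw [linForm_apply, Finset.sum_mul, Finset.mul_sum]
    simp only [smul_mul_assoc, mul_smul_comm]
  rw [h1, map_sum, ← Finset.sum_subset (Finset.subset_univ (C.link t))]
  · refine Finset.sum_congr rfl fun r hr => ?_
    rw [map_smul, setMonomial_insert (mem_link.1 hr).1, smul_eq_mul, ← mul_assoc,
      mul_comm (setMonomial t)]
  · intro r _ hr
    by_cases hrt : r ∈ t
    · simp [he r hrt]
    · have h2 := hL.nonface (insert r t) (fun h => hr (mem_link.2 ⟨hrt, h⟩)) p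
      rw [setMonomial_insert hrt, mul_comm (X r), mul_assoc] at h2
      rw [map_smul, h2, smul_zero]

/-- Face monomials span modulo the relations. A repeated variable `x_r` in `x_s x_r` is exchanged,
by the dual linear form of `r` on `s`, for variables of the link of `s`. The hypotheses make `L` a
degree functional for the zero weight, so `setMonomial_mul_linForm` is available for this exchange.
-/
theorem eq_zero_of_setMonomial (hC : C.IsGood)
    (h1 : ∀ s, ¬ C.face s → ∀ p, L (setMonomial s * p) = 0)
    (h2 : ∀ φ ∈ C.lin, ∀ p, L (linForm φ * p) = 0)
    (h3 : ∀ s, C.face s → L (setMonomial s) = 0) : L = 0 := by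
  have hL : IsDegree ⟨C.face, C.lin, C.dim, 0⟩ L := ⟨h1, h2, fun s hs => by simp [h3 s hs]⟩
  have key : ∀ p s, L (setMonomial s * p) = 0 := by
    intro p
    induction p using MvPolynomial.induction_on with
    | C a =>
      intro s
      by_cases hs : C.face s
      · rw [mul_comm, ← smul_eq_C_mul, map_smul, h3 s hs, smul_zero]
      · exact h1 s hs _
    | add p q hp hq =>
      intro s
      rw [mul_add, map_add, hp, hq, add_zero]
    | mul_X p r hp =>
      intro s
      by_cases hs : C.face s
      · by_cases hr : r ∈ s
        · obtain ⟨φ, hφ, hr1, hr0⟩ := hC.exists_dual hs r hr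
          have h4 := hL.setMonomial_mul_linForm (t := s) (e := Pi.single r 1 - φ) (by
            intro r' hr'
            rcases eq_or_ne r' r with rfl | h
            · simp [hr1]
            · simp [hr0 r' hr' h, h]) p
          have h5 := hL.lin φ hφ (setMonomial s * p)
          rw [map_sub, sub_mul, mul_sub, map_sub, linForm_single,
            mul_left_comm (setMonomial s) (linForm φ), h5, sub_zero] at h4
          rw [mul_comm p, h4]
          exact Finset.sum_eq_zero fun r' _ => by rw [hp, mul_zero]
        · have := hp (insert r s)
          rwa [setMonomial_insert hr, mul_comm (X r), mul_assoc, mul_comm (X r)] at this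
      · exact h1 s hs _
  refine LinearMap.ext fun p => ?_
  have := key p ∅
  rwa [setMonomial_empty, one_mul] at this

theorem unique (hC : C.IsGood) {L' : MvPolynomial R ℝ →ₗ[ℝ] ℝ} (hL : C.IsDegree L)
    (hL' : C.IsDegree L') : L = L' := by
  rw [← sub_eq_zero]
  refine eq_zero_of_setMonomial hC ?_ ?_ ?_
  · intro s hs p
    simp [hL.nonface s hs, hL'.nonface s hs]
  · intro φ hφ p
    simp [hL.lin φ hφ, hL'.lin φ hφ]
  · intro s hs
    simp [hL.face s hs, hL'.face s hs]

theorem degForm_lin (hL : C.IsDegree L) {φ : R → ℝ} (hφ : φ ∈ C.lin) (p : MvPolynomial R ℝ)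
    (w : R → ℝ) : degForm L p φ w = 0 := by
  rw [degForm_apply, mul_left_comm]
  exact hL.lin φ hφ _

/-- Together with `degForm_lin` this produces the radical: modulo linear functions, a form at `t`
sees only the values on the link of `t`. -/
theorem degForm_eq_zero_of_vanish (hL : C.IsDegree L) {t : Finset R} {u : R → ℝ}
    (h1 : ∀ r ∈ t, u r = 0) (h2 : ∀ r ∈ C.link t, u r = 0) (p : MvPolynomial R ℝ)
    (w : R → ℝ) : degForm L (setMonomial t * p) u w = 0 := by
  rw [degForm_apply, mul_assoc, mul_left_comm p, hL.setMonomial_mul_linForm h1]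
  exact Finset.sum_eq_zero fun r hr => by rw [h2 r hr, zero_mul]

/-- A strictly convex function, normalised to vanish on `t`, is positive on the link. Multiplying
`x_t` by it gives a positive combination of the monomials of larger faces, and in the end a positive
combination of weights of facets. -/
theorem pos (hC : C.IsGood) (hL : C.IsDegree L) {E : List (R → ℝ)} {t : Finset R} (ht : C.face t)
    (hcard : E.length + t.card = C.dim) (hE : ∀ e ∈ E, e ∈ C.conv t) :
    0 < L (setMonomial t * (E.map linForm).prod) := by
  induction E generalizing t with
  | nil =>
    have h : t.card = C.dim := by simpa using hcard
    simpa [hL.face t ht, h] using hC.weight_pos ht h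
  | cons e E ih =>
    obtain ⟨φ, hφ, h1, h2⟩ := hE e (by simp) t subset_rfl ht
    rw [List.map_cons, List.prod_cons, mul_left_comm,
      hL.linForm_congr (b := e - φ) (by simpa using hφ), mul_left_comm,
      hL.setMonomial_mul_linForm (by intro r hr; simp [h1 r hr])]
    refine Finset.sum_pos (fun r hr => ?_) ?_
    · obtain ⟨hr1, hr2⟩ := mem_link.1 hr
      refine mul_pos (by simpa using h2 r hr1 hr2) (ih hr2 ?_ fun e' he' => ?_)
      · rw [Finset.card_insert_of_notMem hr1, ← hcard, List.length_cons]; omega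
      · exact conv_mono (Finset.subset_insert r t) (hE e' (by simp [he']))
    · refine hC.link_nonempty ht ?_
      rw [← hcard, List.length_cons]
      omega

/-- The induction step: a mixed degree form is Lorentzian if its restrictions to all the
rays of the link are and the link is connected. -/
theorem hasOnePos_cons (hC : C.IsGood) (hL : C.IsDegree L) {t : Finset R} (ht : C.face t)
    {e : R → ℝ} {E : List (R → ℝ)} (hcard : E.length + 3 + t.card = C.dim) (he : e ∈ C.conv t)
    (hE : ∀ e ∈ E, e ∈ C.conv t)
    (hlink : ∀ r ∈ C.link t,
      HasOnePos (degForm L (setMonomial (insert r t) * (E.map linForm).prod)))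
    (hconn : ∀ y : R → ℝ, (∀ r ∈ C.link t, ∀ r' ∈ C.link t, r ≠ r' →
      C.face (insert r' (insert r t)) → y r = y r') → ∀ r ∈ C.link t, ∀ r' ∈ C.link t, y r = y r') :
    HasOnePos (degForm L (setMonomial t * ((e :: E).map linForm).prod)) := by
  obtain ⟨φ, hφ, h1, h2⟩ := he t subset_rfl ht
  -- The linear function `φ` agrees with `e` on `t`, so `c` is the representative that vanishes on
  -- `t` and is positive on the link; it is the Perron–Frobenius vector below.
  obtain ⟨c, rfl⟩ : ∃ c, e = c + φ := ⟨e - φ, by simp⟩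
  have hc : c ∈ C.conv t := by simpa using sub_mem_conv he hφ
  have hc0 : ∀ r ∈ t, c r = 0 := fun r hr => by simpa using h1 r hr
  have hcpos : ∀ r ∈ C.link t, 0 < c r := fun r hr => by
    simpa using h2 r (mem_link.1 hr).1 (mem_link.1 hr).2
  set P := (E.map linForm).prod with hP
  set Q : R → LinearMap.BilinForm ℝ (R → ℝ) := fun r => degForm L (setMonomial (insert r t) * P)
    with hQ
  set B := degForm L (setMonomial t * (((c + φ) :: E).map linForm).prod) with hBdef
  have hB0 : ∀ v w, B v w = L (setMonomial t * (linForm c * (P * (linForm v * linForm w)))) := by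
    intro v w
    rw [hBdef, degForm_apply, List.map_cons, List.prod_cons, ← hP,
      show setMonomial t * (linForm (c + φ) * P) * (linForm v * linForm w)
        = linForm (c + φ) * (setMonomial t * (P * (linForm v * linForm w))) by ring,
      hL.linForm_congr (b := c) (by simpa using hφ)]
    ring_nf
  -- The same product is expanded in two ways: expanding the divisor of `c` gives `B = ∑ c_r Q_r`,
  -- whereas `hBr` below absorbs `x_r` into the face monomial and keeps `c` as an argument of `Q_r`.
  have hB1 : ∀ v w, B v w = ∑ r ∈ C.link t, c r * Q r v w := by
    intro v w
    rw [hB0, hL.setMonomial_mul_linForm hc0]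
    refine Finset.sum_congr rfl fun r _ => ?_
    rw [hQ, degForm_apply, mul_assoc]
  have hBr : ∀ r ∈ C.link t, ∀ w, B (Pi.single r 1) w = Q r c w := by
    intro r hr w
    rw [hB0, hQ, degForm_apply, linForm_single, setMonomial_insert (mem_link.1 hr).1]
    ring_nf
  have hBsymm : ∀ v w, B v w = B w v := degForm_symm _ _
  have hinsc : ∀ r ∈ C.link t, (insert r t).card = t.card + 1 := fun r hr =>
    Finset.card_insert_of_notMem (mem_link.1 hr).1
  have hQpos : ∀ r ∈ C.link t, 0 < Q r c c := by
    intro r hr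
    have := hL.pos hC (E := c :: c :: E) (mem_link.1 hr).2
      (by rw [hinsc r hr, ← hcard]; simp only [List.length_cons]; omega) (by
        intro e' he'
        apply conv_mono (Finset.subset_insert r t)
        simp only [List.mem_cons] at he'
        rcases he' with rfl | rfl | h
        exacts [hc, hc, hE _ h])
    rw [hQ, degForm_apply]
    convert this using 2
    simp only [List.map_cons, List.prod_cons]
    ring
  have hBoff : ∀ r ∈ C.link t, ∀ r' ∈ C.link t, r ≠ r' →
      0 ≤ B (Pi.single r 1) (Pi.single r' 1) ∧ (C.face (insert r' (insert r t)) →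
        0 < B (Pi.single r 1) (Pi.single r' 1)) := by
    intro r hr r' hr' hne
    have hr'1 : r' ∉ insert r t := by
      simp [hne.symm, (mem_link.1 hr').1]
    have h3 : B (Pi.single r 1) (Pi.single r' 1)
        = L (setMonomial (insert r' (insert r t)) * ((c :: E).map linForm).prod) := by
      rw [hBr r hr, hQ, degForm_apply, linForm_single, setMonomial_insert hr'1,
        List.map_cons, List.prod_cons, ← hP]
      ring_nf
    by_cases hf : C.face (insert r' (insert r t))
    · have := hL.pos hC (E := c :: E) hf
        (by rw [Finset.card_insert_of_notMem hr'1, hinsc r hr, ← hcard, List.length_cons]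
            omega) (by
          intro e' he'
          apply conv_mono ((Finset.subset_insert r t).trans (Finset.subset_insert _ _))
          simp only [List.mem_cons] at he'
          rcases he' with rfl | h
          exacts [hc, hE _ h])
      rw [h3]
      exact ⟨this.le, fun _ => this⟩
    · rw [h3, hL.nonface _ hf]
      exact ⟨le_rfl, fun h => absurd h hf⟩
  -- The form is restricted to functions supported on the link, embedded by `f` through extension by
  -- zero. Nothing is lost, since the remaining directions are linear functions or lie in the
  -- radical.
  let ι := {r // r ∈ C.link t}
  let f : (ι → ℝ) →ₗ[ℝ] (R → ℝ) :=
    LinearMap.pi fun r => if h : r ∈ C.link t then LinearMap.proj ⟨r, h⟩ else 0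
  have hf1 : ∀ x (r : R) (h : r ∈ C.link t), f x r = x ⟨r, h⟩ := fun x r h => by
    simp [f, h]
  have hf2 : ∀ x (r : R) (_ : r ∉ C.link t), f x r = 0 := fun x r h => by
    simp [f, h]
  have hfs : ∀ i : ι, f (Pi.single i 1) = Pi.single i.1 1 := by
    intro i
    ext r
    by_cases hr : r ∈ C.link t
    · rw [hf1 _ _ hr, Pi.single_apply, Pi.single_apply]
      exact if_congr Subtype.ext_iff rfl rfl
    · rw [hf2 _ _ hr, Pi.single_eq_of_ne]
      rintro rfl
      exact hr i.2
  rw [← hasOnePos_comp_iff (B' := B.comp f f) f one_pos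
    (fun _ _ => (one_mul _).symm)]
  swap
  · have : ∀ v, ∃ w, ∀ x, B v x = B (f w) x := by
      intro v
      obtain ⟨ψ, hψ, h4⟩ := hC.exists_lin_eqOn ht v
      refine ⟨fun r => v r.1 - ψ r.1, fun x => ?_⟩
      set w : ι → ℝ := fun r => v r.1 - ψ r.1
      have h5 : B (v - ψ - f w) x = 0 := by
        apply hL.degForm_eq_zero_of_vanish
        · intro r hr
          have : r ∉ C.link t := fun h => (mem_link.1 h).1 hr
          simp [h4 r hr, hf2 _ _ this]
        · intro r hr
          simp [hf1 _ _ hr, w]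
      have h6 : B ψ x = 0 := hL.degForm_lin hψ _ _
      rw [map_sub, map_sub, LinearMap.sub_apply, LinearMap.sub_apply, h6] at h5
      linarith
    intro v
    obtain ⟨w, hw⟩ := this v
    exact ⟨w, hw, fun x => by rw [hBsymm, hw, hBsymm]⟩
  have hne : Nonempty ι := by
    obtain ⟨r, hr⟩ := hC.link_nonempty ht (by omega)
    exact ⟨⟨r, hr⟩⟩
  have hcf : ∀ i : ι, ∀ x, B (Pi.single i.1 1) x = Q i.1 c x := fun i => hBr i.1 i.2
  have hcr : ∀ x, B x c = B x (f fun i => c i.1) := by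
    intro x
    have : B (c - f fun i => c i.1) x = 0 := by
      apply hL.degForm_eq_zero_of_vanish
      · intro r hr
        have : r ∉ C.link t := fun h => (mem_link.1 h).1 hr
        simp [hc0 r hr, hf2 _ _ this]
      · intro r hr
        simp [hf1 _ _ hr]
    rw [map_sub, LinearMap.sub_apply, sub_eq_zero] at this
    rw [hBsymm, this, hBsymm]
  have hsing : ∀ i : ι, B.comp f f (Pi.single i 1) (fun i => c i.1) = Q i.1 c c := by
    intro i
    rw [LinearMap.BilinForm.comp_apply, hfs, ← hcr, hcf]
  refine hasOnePos_of_bochner (c := fun i : ι => c i.1) (fun x y => hBsymm _ _)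
    (fun i => hcpos i.1 i.2) ?_ ?_ ?_ ?_
  · intro i j hij
    rw [LinearMap.BilinForm.comp_apply, hfs, hfs]
    exact (hBoff i.1 i.2 j.1 j.2 fun h => hij (Subtype.ext h)).1
  · intro i
    rw [hsing]
    exact hQpos i.1 i.2
  -- The Bochner inequality is the sum over the link, with weights `c_r`, of the reversed
  -- Cauchy–Schwarz inequalities for `Q_r` at `c` and `x`.
  · intro x
    rw [LinearMap.BilinForm.comp_apply, hB1, ← Finset.sum_coe_sort]
    refine Finset.sum_le_sum fun i _ => ?_
    rw [hsing, LinearMap.BilinForm.comp_apply, hfs, hcf, le_div_iff₀ (hQpos i.1 i.2)]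
    have := (hlink i.1 i.2).mul_le_sq (degForm_symm _ _) (hQpos i.1 i.2) (f x)
    have h7 := mul_le_mul_of_nonneg_left this (hcpos i.1 i.2).le
    calc _ = c i.1 * (Q i.1 (f x) (f x) * Q i.1 c c) := by ring
      _ ≤ _ := h7
      _ = _ := by ring
  · intro y hy i j
    have := hconn (f y) (fun r hr r' hr' hne hface => by
      rw [hf1 _ _ hr, hf1 _ _ hr']
      refine hy _ _ (fun h => hne (congrArg Subtype.val h)) ?_
      rw [LinearMap.BilinForm.comp_apply, hfs, hfs]
      exact (hBoff r hr r' hr' hne).2 hface) i.1 i.2 j.1 j.2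
    rwa [hf1 _ _ i.2, hf1 _ _ j.2] at this

end IsDegree

/-- All the mixed degree forms of `L` at the face `t` have exactly one positive eigenvalue. -/
def HodgeAt (C : WeightedComplex R) (L : MvPolynomial R ℝ →ₗ[ℝ] ℝ) (t : Finset R) : Prop :=
  ∀ E : List (R → ℝ), E.length + 2 + t.card = C.dim → (∀ e ∈ E, e ∈ C.conv t) →
    HasOnePos (degForm L (setMonomial t * (E.map linForm).prod))

/-- The combinatorial Lorentzian property. -/
structure IsLorentzian (C : WeightedComplex R) : Prop where
  nonempty_conv : (C.conv ∅).Nonempty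
  exists_hodgeAt : 2 ≤ C.dim →
    ∃ L, C.IsDegree L ∧ ∀ t, C.face t → t.card + 2 ≤ C.dim → C.HodgeAt L t

end WeightedComplex

end LorentzianFans

end

noncomputable section

namespace LorentzianFans

open MvPolynomial

/-! ### Isomorphisms of weighted complexes -/

namespace WeightedComplex

section Iso

variable {R R' : Type*} [Fintype R] [Fintype R'] [DecidableEq R] [DecidableEq R']

/-- Multiply a function on the elements by `c` and transport it along `e`. -/
def rescale (e : R ≃ R') (c : R → ℝ) : (R → ℝ) →ₗ[ℝ] (R' → ℝ) :=
  LinearMap.pi fun r => c (e.symm r) • LinearMap.proj (e.symm r)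

@[simp]
theorem rescale_apply (e : R ≃ R') (c : R → ℝ) (w : R → ℝ) (r : R) :
    rescale e c w (e r) = c r * w r := by
  simp [rescale]

/-- `C'` is obtained from `C` by renaming the elements along `e` and rescaling the marking
by `c`. -/
structure IsRescaling (C : WeightedComplex R) (C' : WeightedComplex R') (e : R ≃ R')
    (c : R → ℝ) : Prop where
  pos : ∀ r, 0 < c r
  face : ∀ s, C'.face (s.map e.toEmbedding) ↔ C.face s
  lin : ∀ φ, rescale e c φ ∈ C'.lin ↔ φ ∈ C.lin
  dim : C'.dim = C.dim
  weight : ∀ s, C.face s → s.card = C.dim →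
    C'.weight (s.map e.toEmbedding) = (∏ r ∈ s, (c r)⁻¹) * C.weight s

variable {C : WeightedComplex R} {C' : WeightedComplex R'} {e : R ≃ R'} {c : R → ℝ}
  {L : MvPolynomial R' ℝ →ₗ[ℝ] ℝ}

/-- The substitution `x_r ↦ c_r x_{e r}`. -/
def rescaleHom (e : R ≃ R') (c : R → ℝ) : MvPolynomial R ℝ →ₐ[ℝ] MvPolynomial R' ℝ :=
  aeval fun r => c r • X (e r)

@[simp]
theorem rescaleHom_X (r : R) : rescaleHom e c (X r) = c r • X (e r) := aeval_X ..

theorem rescaleHom_linForm (w : R → ℝ) :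
    rescaleHom e c (linForm w) = linForm (rescale e c w) := by
  rw [linForm_apply, linForm_apply, map_sum, ← e.sum_comp]
  refine Finset.sum_congr rfl fun r _ => ?_
  rw [map_smul, rescaleHom_X, rescale_apply, smul_smul, mul_comm]

theorem rescaleHom_setMonomial (s : Finset R) :
    rescaleHom e c (setMonomial s) = (∏ r ∈ s, c r) • setMonomial (s.map e.toEmbedding) := by
  simp only [setMonomial, map_prod, rescaleHom_X, Finset.prod_map, Equiv.coe_toEmbedding,
    Finset.prod_smul]

namespace IsRescaling

/-- The factor `∏ c_r` picked up by a facet monomial cancels the factor `∏ c_r⁻¹` in the rescaled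
weight. -/
theorem isDegree (h : C.IsRescaling C' e c) (hL : C'.IsDegree L) :
    C.IsDegree (L ∘ₗ (rescaleHom e c).toLinearMap) where
  nonface s hs p := by
    have := hL.nonface (s.map e.toEmbedding) (by rwa [h.face]) (rescaleHom e c p)
    simp [rescaleHom_setMonomial, this]
  lin φ hφ p := by
    have := hL.lin (rescale e c φ) ((h.lin φ).2 hφ) (rescaleHom e c p)
    simpa [rescaleHom_linForm] using this
  face s hs := by
    have := hL.face (s.map e.toEmbedding) ((h.face s).2 hs)
    simp only [LinearMap.comp_apply, AlgHom.toLinearMap_apply, rescaleHom_setMonomial, map_smul,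
      this, Finset.card_map, h.dim]
    split_ifs with hc
    · rw [h.weight s hs hc, smul_eq_mul, ← mul_assoc, ← Finset.prod_mul_distrib,
        Finset.prod_eq_one fun r _ => mul_inv_cancel₀ (h.pos r).ne', one_mul]
    · simp

theorem rescale_mem_conv (h : C.IsRescaling C' e c) {t : Finset R} {w : R → ℝ}
    (hw : w ∈ C.conv t) : rescale e c w ∈ C'.conv (t.map e.toEmbedding) := by
  intro s' hts hs
  obtain ⟨s, rfl⟩ : ∃ s : Finset R, s' = s.map e.toEmbedding :=
    ⟨s'.map e.symm.toEmbedding, by simp [Finset.map_map]⟩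
  obtain ⟨φ, hφ, h1, h2⟩ := hw s (Finset.map_subset_map.1 hts) ((h.face s).1 hs)
  refine ⟨rescale e c φ, (h.lin φ).2 hφ, fun r' hr => ?_, fun r' hr hrs => ?_⟩
  · obtain ⟨r, hr', rfl⟩ := Finset.mem_map.1 hr
    simp [h1 r hr']
  · obtain ⟨r, rfl⟩ := e.surjective r'
    have hr' : r ∉ s := fun h => hr (Finset.mem_map_of_mem _ h)
    have h3 := h2 r hr' (by
      rw [← h.face, Finset.map_insert]
      exact hrs)
    simpa using mul_lt_mul_of_pos_left h3 (h.pos r)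

theorem hodgeAt (h : C.IsRescaling C' e c) {t : Finset R}
    (ht : C'.HodgeAt L (t.map e.toEmbedding)) :
    C.HodgeAt (L ∘ₗ (rescaleHom e c).toLinearMap) t := by
  intro E hcard hE
  have := ht (E.map (rescale e c)) (by simpa [h.dim] using hcard) (by
    intro e' he'
    obtain ⟨w, hw, rfl⟩ := List.mem_map.1 he'
    exact h.rescale_mem_conv (hE w hw))
  have hprod : rescaleHom e c (E.map linForm).prod
      = ((E.map (rescale e c)).map linForm).prod := by
    rw [map_list_prod, List.map_map, List.map_map]
    congr 1
    exact List.map_congr_left fun w _ => rescaleHom_linForm w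
  refine (hasOnePos_comp_iff (rescale e c) (Finset.prod_pos fun r _ => h.pos r :
    0 < ∏ r ∈ t, c r) (fun x y => ?_) fun v => ?_).2 this
  · simp only [degForm_apply, LinearMap.comp_apply, AlgHom.toLinearMap_apply, map_mul,
      rescaleHom_setMonomial, rescaleHom_linForm, hprod, smul_mul_assoc, map_smul, smul_eq_mul]
  · refine ⟨fun r => (c r)⁻¹ * v (e r), ?_⟩
    have : rescale e c (fun r => (c r)⁻¹ * v (e r)) = v := by
      ext r'
      obtain ⟨r, rfl⟩ := e.surjective r'
      rw [rescale_apply, mul_inv_cancel_left₀ (h.pos r).ne']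
    simp [this]

theorem isLorentzian (h : C.IsRescaling C' e c) (hC : C'.IsLorentzian) : C.IsLorentzian where
  nonempty_conv := by
    obtain ⟨w', hw'⟩ := hC.nonempty_conv
    refine ⟨fun r => (c r)⁻¹ * w' (e r), fun s _ hs => ?_⟩
    obtain ⟨φ', hφ', h1, h2⟩ := hw' (s.map e.toEmbedding) (Finset.empty_subset _)
      ((h.face s).2 hs)
    have hφ : rescale e c (fun r => (c r)⁻¹ * φ' (e r)) = φ' := by
      ext r'
      obtain ⟨r, rfl⟩ := e.surjective r'
      rw [rescale_apply, mul_inv_cancel_left₀ (h.pos r).ne']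
    refine ⟨fun r => (c r)⁻¹ * φ' (e r), by rwa [← h.lin, hφ], fun r hr => ?_,
      fun r hr hrs => ?_⟩
    · exact congrArg ((c r)⁻¹ * ·) (h1 _ (Finset.mem_map_of_mem e.toEmbedding hr))
    · refine mul_lt_mul_of_pos_left (h2 (e r) (by simpa using hr) ?_) (inv_pos.2 (h.pos r))
      have := (h.face _).2 hrs
      rwa [Finset.map_insert] at this
  exists_hodgeAt hd := by
    obtain ⟨L, hL, hH⟩ := hC.exists_hodgeAt (h.dim ▸ hd)
    exact ⟨_, h.isDegree hL, fun t ht htc =>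
      h.hodgeAt (hH _ ((h.face t).2 ht) (by simpa [h.dim] using htc))⟩

end IsRescaling

end Iso

end WeightedComplex

end LorentzianFans

end

noncomputable section

namespace LorentzianFans

open MvPolynomial

/-! ### Products of weighted complexes -/

/-! ### Functionals on polynomials in two groups of variables. -/

section SumVariables

variable {R₁ R₂ : Type*}

/-- A functional on polynomials in two sets of variables is determined by its values on products. -/
theorem linearMap_ext_sum {L L' : MvPolynomial (R₁ ⊕ R₂) ℝ →ₗ[ℝ] ℝ}
    (h : ∀ p q, L (rename Sum.inl p * rename Sum.inr q) =
      L' (rename Sum.inl p * rename Sum.inr q)) : L = L' := by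
  refine (basisMonomials (R₁ ⊕ R₂) ℝ).ext fun m => ?_
  rw [coe_basisMonomials]
  obtain ⟨⟨a, b⟩, rfl⟩ := Finsupp.sumFinsuppEquivProdFinsupp.symm.surjective m
  have := h (monomial a 1) (monomial b 1)
  rwa [rename_monomial, rename_monomial, monomial_mul, ← Finsupp.sumElim_eq_add, one_mul] at this

/-- The tensor product of two functionals. -/
theorem exists_tensor (L₁ : MvPolynomial R₁ ℝ →ₗ[ℝ] ℝ) (L₂ : MvPolynomial R₂ ℝ →ₗ[ℝ] ℝ) :
    ∃ L : MvPolynomial (R₁ ⊕ R₂) ℝ →ₗ[ℝ] ℝ,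
      ∀ p q, L (rename Sum.inl p * rename Sum.inr q) = L₁ p * L₂ q := by
  refine ⟨(basisMonomials (R₁ ⊕ R₂) ℝ).constr ℝ fun m =>
    L₁ (monomial (m.comapDomain Sum.inl Sum.inl_injective.injOn) 1) *
    L₂ (monomial (m.comapDomain Sum.inr Sum.inr_injective.injOn) 1), fun p q => ?_⟩
  induction p using MvPolynomial.induction_on' with
  | add p p' hp hp' => simp only [map_add, add_mul, hp, hp']
  | monomial u a =>
    induction q using MvPolynomial.induction_on' with
    | add q q' hq hq' => simp only [map_add, mul_add, hq, hq']
    | monomial v b =>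
      rw [show monomial u a = a • monomial u 1 by rw [smul_monomial, smul_eq_mul, mul_one],
        show monomial v b = b • monomial v 1 by rw [smul_monomial, smul_eq_mul, mul_one]]
      simp only [map_smul, smul_mul_assoc, mul_smul_comm, smul_eq_mul]
      have := (basisMonomials (R₁ ⊕ R₂) ℝ).constr_basis ℝ (fun m =>
        L₁ (monomial (m.comapDomain Sum.inl Sum.inl_injective.injOn) 1) *
        L₂ (monomial (m.comapDomain Sum.inr Sum.inr_injective.injOn) 1)) (u.sumElim v)
      rw [coe_basisMonomials] at this
      rw [rename_monomial, rename_monomial, monomial_mul, ← Finsupp.sumElim_eq_add, one_mul, this,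
        Finsupp.comapDomain_inl_sumElim, Finsupp.comapDomain_inr_sumElim]
      ring

theorem setMonomial_disjSum (s : Finset R₁) (t : Finset R₂) :
    setMonomial (s.disjSum t) =
      rename Sum.inl (setMonomial s) * rename Sum.inr (setMonomial t) := by
  simp only [setMonomial, Finset.prod_disjSum, map_prod, rename_X]

theorem linForm_sum [Fintype R₁] [Fintype R₂] (w : R₁ ⊕ R₂ → ℝ) :
    linForm w = rename Sum.inl (linForm (w ∘ Sum.inl)) +
      rename Sum.inr (linForm (w ∘ Sum.inr)) := by
  simp [linForm_apply]

end SumVariables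

namespace WeightedComplex

variable {R₁ R₂ : Type*}

/-- The product of weighted complexes. -/
protected def prod (C₁ : WeightedComplex R₁) (C₂ : WeightedComplex R₂) :
    WeightedComplex (R₁ ⊕ R₂) where
  face s := C₁.face s.toLeft ∧ C₂.face s.toRight
  lin := C₁.lin.comap (LinearMap.funLeft ℝ ℝ Sum.inl) ⊓
    C₂.lin.comap (LinearMap.funLeft ℝ ℝ Sum.inr)
  dim := C₁.dim + C₂.dim
  weight s := C₁.weight s.toLeft * C₂.weight s.toRight

variable {C₁ : WeightedComplex R₁} {C₂ : WeightedComplex R₂}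

theorem prod_face_disjSum {s : Finset R₁} {t : Finset R₂} :
    (C₁.prod C₂).face (s.disjSum t) ↔ C₁.face s ∧ C₂.face t := by
  simp [WeightedComplex.prod]

theorem mem_prod_lin {φ : R₁ ⊕ R₂ → ℝ} :
    φ ∈ (C₁.prod C₂).lin ↔ φ ∘ Sum.inl ∈ C₁.lin ∧ φ ∘ Sum.inr ∈ C₂.lin := Iff.rfl

theorem elim_mem_prod_lin {φ : R₁ → ℝ} {ψ : R₂ → ℝ} :
    Sum.elim φ ψ ∈ (C₁.prod C₂).lin ↔ φ ∈ C₁.lin ∧ ψ ∈ C₂.lin := Iff.rfl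

theorem prod_dim : (C₁.prod C₂).dim = C₁.dim + C₂.dim := rfl

theorem prod_weight_disjSum {s : Finset R₁} {t : Finset R₂} :
    (C₁.prod C₂).weight (s.disjSum t) = C₁.weight s * C₂.weight t := by
  simp [WeightedComplex.prod]

theorem IsGood.prod (h₁ : C₁.IsGood) (h₂ : C₂.IsGood) : (C₁.prod C₂).IsGood where
  empty_face := ⟨h₁.empty_face, h₂.empty_face⟩
  mono h hst := ⟨h₁.mono h.1 (Finset.toLeft_subset_toLeft hst),
    h₂.mono h.2 (Finset.toRight_subset_toRight hst)⟩
  pure {s} hs := by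
    obtain ⟨t₁, hs₁, ht₁, hc₁⟩ := h₁.pure hs.1
    obtain ⟨t₂, hs₂, ht₂, hc₂⟩ := h₂.pure hs.2
    refine ⟨t₁.disjSum t₂, Finset.subset_disjSum.2 ⟨hs₁, hs₂⟩, prod_face_disjSum.2 ⟨ht₁, ht₂⟩, ?_⟩
    rw [Finset.card_disjSum, hc₁, hc₂, prod_dim]
  exists_dual {s} hs := by
    rintro (r | r) hr
    · obtain ⟨φ, hφ, h1, h0⟩ := h₁.exists_dual hs.1 r (Finset.mem_toLeft.2 hr)
      refine ⟨Sum.elim φ 0, elim_mem_prod_lin.2 ⟨hφ, C₂.lin.zero_mem⟩, h1, ?_⟩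
      rintro (r' | r') hr' hne
      · exact h0 r' (Finset.mem_toLeft.2 hr') fun h => hne (congrArg _ h)
      · rfl
    · obtain ⟨φ, hφ, h1, h0⟩ := h₂.exists_dual hs.2 r (Finset.mem_toRight.2 hr)
      refine ⟨Sum.elim 0 φ, elim_mem_prod_lin.2 ⟨C₁.lin.zero_mem, hφ⟩, h1, ?_⟩
      rintro (r' | r') hr' hne
      · rfl
      · exact h0 r' (Finset.mem_toRight.2 hr') fun h => hne (congrArg _ h)
  weight_pos {s} hs hc := by
    have h3 := h₁.card_le hs.1
    have h4 := h₂.card_le hs.2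
    have h5 : s.toLeft.card + s.toRight.card = _ := Finset.card_toLeft_add_card_toRight
    rw [hc, prod_dim] at h5
    exact mul_pos (h₁.weight_pos hs.1 (by omega)) (h₂.weight_pos hs.2 (by omega))

variable [DecidableEq R₁] [DecidableEq R₂]

/-- It suffices to test convexity on the faces `s ⊔ t₂` with `t₁ ⊆ s`: the insertions from the first
factor leave `t₂` unchanged. -/
theorem comp_inl_mem_conv {t₁ : Finset R₁} {t₂ : Finset R₂} (ht₂ : C₂.face t₂)
    {e : R₁ ⊕ R₂ → ℝ} (he : e ∈ (C₁.prod C₂).conv (t₁.disjSum t₂)) :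
    e ∘ Sum.inl ∈ C₁.conv t₁ := by
  intro s hts hs
  obtain ⟨φ, hφ, h1, h2⟩ := he (s.disjSum t₂) (Finset.disjSum_mono hts subset_rfl)
    (prod_face_disjSum.2 ⟨hs, ht₂⟩)
  refine ⟨φ ∘ Sum.inl, (mem_prod_lin.1 hφ).1, fun r hr => h1 _ (by simpa using hr),
    fun r hr hrs => h2 _ (by simpa using hr) ?_⟩
  refine ⟨?_, ?_⟩
  · rwa [Finset.toLeft_insert_inl, Finset.toLeft_disjSum]
  · rwa [Finset.toRight_insert_inl, Finset.toRight_disjSum]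

theorem elim_mem_conv {t₁ : Finset R₁} {t₂ : Finset R₂} {e₁ : R₁ → ℝ} {e₂ : R₂ → ℝ}
    (h₁ : e₁ ∈ C₁.conv t₁) (h₂ : e₂ ∈ C₂.conv t₂) :
    Sum.elim e₁ e₂ ∈ (C₁.prod C₂).conv (t₁.disjSum t₂) := by
  intro s hts hs
  obtain ⟨hts₁, hts₂⟩ := Finset.disjSum_subset.1 hts
  obtain ⟨φ₁, hφ₁, h11, h12⟩ := h₁ _ hts₁ hs.1
  obtain ⟨φ₂, hφ₂, h21, h22⟩ := h₂ _ hts₂ hs.2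
  refine ⟨Sum.elim φ₁ φ₂, elim_mem_prod_lin.2 ⟨hφ₁, hφ₂⟩, ?_, ?_⟩
  · rintro (r | r) hr
    · exact h11 r (Finset.mem_toLeft.2 hr)
    · exact h21 r (Finset.mem_toRight.2 hr)
  · rintro (r | r) hr hrs
    · refine h12 r (fun h => hr (Finset.mem_toLeft.1 h)) ?_
      have := hrs.1
      rwa [Finset.toLeft_insert_inl] at this
    · refine h22 r (fun h => hr (Finset.mem_toRight.1 h)) ?_
      have := hrs.2
      rwa [Finset.toRight_insert_inr] at this

/-- Over a facet every function is strictly convex. -/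
theorem IsGood.mem_conv_of_card_eq {R : Type*} [DecidableEq R] {C : WeightedComplex R}
    (hC : C.IsGood) {t : Finset R} (htc : t.card = C.dim) (e : R → ℝ) : e ∈ C.conv t := by
  intro s hts hs
  obtain ⟨φ, hφ, h⟩ := hC.exists_lin_eqOn hs e
  refine ⟨φ, hφ, h, fun r hr hrs => ?_⟩
  have h1 := hC.card_le hrs
  have h2 := Finset.card_le_card hts
  rw [Finset.card_insert_of_notMem hr] at h1
  omega

variable [Fintype R₁] [Fintype R₂]

/-- Each relation of the product has to be tested only against products of polynomials from the two
factors. There a nonface fails in one factor, and a linear form splits into a sum of linear forms of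
the factors. -/
theorem IsDegree.prod {L₁ : MvPolynomial R₁ ℝ →ₗ[ℝ] ℝ} {L₂ : MvPolynomial R₂ ℝ →ₗ[ℝ] ℝ}
    {L : MvPolynomial (R₁ ⊕ R₂) ℝ →ₗ[ℝ] ℝ} (h₁ : C₁.IsGood) (h₂ : C₂.IsGood)
    (hL₁ : C₁.IsDegree L₁) (hL₂ : C₂.IsDegree L₂)
    (hL : ∀ p q, L (rename Sum.inl p * rename Sum.inr q) = L₁ p * L₂ q) :
    (C₁.prod C₂).IsDegree L := by
  have key : ∀ a : MvPolynomial (R₁ ⊕ R₂) ℝ,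
      (∀ p q, L (a * (rename Sum.inl p * rename Sum.inr q)) = 0) → ∀ p, L (a * p) = 0 := by
    intro a ha p
    have : L ∘ₗ LinearMap.mulLeft ℝ a = 0 := linearMap_ext_sum fun p q => by simpa using ha p q
    simpa using LinearMap.congr_fun this p
  refine ⟨fun s hs => key _ fun p q => ?_, fun φ hφ => key _ fun p q => ?_, fun s hs => ?_⟩
  · rw [← s.toLeft_disjSum_toRight, setMonomial_disjSum, mul_mul_mul_comm, ← map_mul, ← map_mul,
      hL]
    by_cases h : C₁.face s.toLeft
    · rw [hL₂.nonface _ (fun h' => hs ⟨h, h'⟩), mul_zero]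
    · rw [hL₁.nonface _ h, zero_mul]
  · rw [linForm_sum, add_mul, ← mul_assoc, ← map_mul, mul_left_comm, ← map_mul, map_add, hL, hL,
      hL₁.lin _ (mem_prod_lin.1 hφ).1, hL₂.lin _ (mem_prod_lin.1 hφ).2, zero_mul, mul_zero,
      add_zero]
  · obtain ⟨s₁, s₂, rfl⟩ : ∃ (s₁ : Finset R₁) (s₂ : Finset R₂), s = s₁.disjSum s₂ :=
      ⟨_, _, s.toLeft_disjSum_toRight.symm⟩
    obtain ⟨hs₁, hs₂⟩ := prod_face_disjSum.1 hs
    rw [setMonomial_disjSum, hL, hL₁.face _ hs₁, hL₂.face _ hs₂, prod_weight_disjSum, prod_dim,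
      Finset.card_disjSum]
    have := h₁.card_le hs₁
    have := h₂.card_le hs₂
    -- As neither face exceeds the dimension of its factor, the total size is maximal only if both
    -- are facets.
    split_ifs <;> first | omega | simp

/-! ### Stars of the product at facets of the second factor. -/

section Facet

variable {L : MvPolynomial (R₁ ⊕ R₂) ℝ →ₗ[ℝ] ℝ}

/-- The functional induced by `L` on the star of a facet of the second factor. -/
def restrictFacet (L : MvPolynomial (R₁ ⊕ R₂) ℝ →ₗ[ℝ] ℝ) (a : ℝ) (t : Finset R₂) :
    MvPolynomial R₁ ℝ →ₗ[ℝ] ℝ :=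
  a⁻¹ • (L ∘ₗ LinearMap.mulRight ℝ (rename Sum.inr (setMonomial t)) ∘ₗ
    (rename Sum.inl).toLinearMap)

theorem restrictFacet_apply (a : ℝ) (t : Finset R₂) (p : MvPolynomial R₁ ℝ) :
    restrictFacet L a t p = a⁻¹ * L (rename Sum.inl p * rename Sum.inr (setMonomial t)) := rfl

/-- The product weight of `s ⊔ t` is the weight of `s` times that of `t`; dividing by the latter
leaves exactly the weight of the first factor. -/
theorem IsDegree.restrictFacet (h₂ : C₂.IsGood)
    (hL : (C₁.prod C₂).IsDegree L) {t : Finset R₂} (ht : C₂.face t) (htc : t.card = C₂.dim) :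
    C₁.IsDegree (restrictFacet L (C₂.weight t) t) := by
  refine ⟨fun s hs p => ?_, fun φ hφ p => ?_, fun s hs => ?_⟩
  · have := hL.nonface (s.disjSum t) (fun h => hs (prod_face_disjSum.1 h).1) (rename Sum.inl p)
    rw [setMonomial_disjSum, mul_right_comm, ← map_mul] at this
    rw [restrictFacet_apply, this, mul_zero]
  · have := hL.lin (Sum.elim φ 0) (elim_mem_prod_lin.2 ⟨hφ, C₂.lin.zero_mem⟩)
      (rename Sum.inl p * rename Sum.inr (setMonomial t))
    rw [linForm_sum, Sum.elim_comp_inl, Sum.elim_comp_inr, map_zero, map_zero, add_zero,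
      ← mul_assoc, ← map_mul] at this
    rw [restrictFacet_apply, this, mul_zero]
  · have := hL.face (s.disjSum t) (prod_face_disjSum.2 ⟨hs, ht⟩)
    rw [restrictFacet_apply, ← setMonomial_disjSum, this, Finset.card_disjSum, htc, prod_dim,
      prod_weight_disjSum]
    have := (h₂.weight_pos ht htc).ne'
    simp only [add_left_inj]
    split_ifs
    · field_simp
    · simp

/-- Over the facet `t₂` the second component of a divisor can be made to vanish on `t₂` by a linear
function, and what is left is supported off the link because no face of the second factor is larger
than `t₂`. -/
theorem IsDegree.setMonomial_facet_mul_linForm (h₂ : C₂.IsGood) (hL : (C₁.prod C₂).IsDegree L)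
    {t₁ : Finset R₁} {t₂ : Finset R₂} (ht : C₂.face t₂) (htc : t₂.card = C₂.dim)
    (w : R₁ ⊕ R₂ → ℝ) (p : MvPolynomial (R₁ ⊕ R₂) ℝ) :
    L (setMonomial (t₁.disjSum t₂) * (linForm w * p)) =
      L (setMonomial (t₁.disjSum t₂) * (rename Sum.inl (linForm (w ∘ Sum.inl)) * p)) := by
  obtain ⟨φ, hφ, h⟩ := h₂.exists_lin_eqOn ht (w ∘ Sum.inr)
  have h0 : linForm w = linForm (Sum.elim 0 φ) + linForm (Sum.elim 0 (w ∘ Sum.inr - φ)) +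
      rename Sum.inl (linForm (w ∘ Sum.inl)) := by
    simp only [linForm_sum, Sum.elim_comp_inl, Sum.elim_comp_inr, map_zero, zero_add, map_sub]
    ring
  have h1 := hL.lin (Sum.elim 0 φ) (elim_mem_prod_lin.2 ⟨C₁.lin.zero_mem, hφ⟩)
    (setMonomial (t₁.disjSum t₂) * p)
  have h2 := hL.setMonomial_mul_linForm (t := t₁.disjSum t₂)
    (e := Sum.elim 0 (w ∘ Sum.inr - φ)) (by
      rintro (r | r) hr
      · rfl
      · simpa [sub_eq_zero] using h r (by simpa using hr)) p
  rw [Finset.sum_eq_zero] at h2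
  · rw [h0, add_mul, add_mul, mul_add, mul_add, map_add, map_add, h2, mul_left_comm, h1, zero_add,
      zero_add]
  · rintro (r | r) hr
    · exact zero_mul _
    · obtain ⟨hr1, hr2⟩ := mem_link.1 hr
      have h3 := hr2.2
      rw [Finset.toRight_insert_inr, Finset.toRight_disjSum] at h3
      have h4 := h₂.card_le h3
      rw [Finset.card_insert_of_notMem (by simpa using hr1)] at h4
      omega

theorem IsDegree.setMonomial_facet_mul_prod (h₂ : C₂.IsGood) (hL : (C₁.prod C₂).IsDegree L)
    {t₁ : Finset R₁} {t₂ : Finset R₂} (ht : C₂.face t₂) (htc : t₂.card = C₂.dim)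
    (E : List (R₁ ⊕ R₂ → ℝ)) (p : MvPolynomial (R₁ ⊕ R₂) ℝ) :
    L (setMonomial (t₁.disjSum t₂) * ((E.map linForm).prod * p)) =
      L (setMonomial (t₁.disjSum t₂) *
        (rename Sum.inl ((E.map (· ∘ Sum.inl)).map linForm).prod * p)) := by
  induction E generalizing p with
  | nil => simp
  | cons e E ih =>
    simp only [List.map_cons, List.prod_cons, map_mul]
    rw [mul_assoc, hL.setMonomial_facet_mul_linForm h₂ ht htc, mul_left_comm (rename _ _), ih,
      mul_left_comm (rename _ _), ← mul_assoc (rename _ _)]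

/-- The mixed degree forms over a facet of the second factor are those of the first factor. -/
theorem IsDegree.hasOnePos_facet_iff (h₂ : C₂.IsGood) (hL : (C₁.prod C₂).IsDegree L)
    {t₁ : Finset R₁} {t₂ : Finset R₂} (ht : C₂.face t₂) (htc : t₂.card = C₂.dim)
    (E : List (R₁ ⊕ R₂ → ℝ)) :
    HasOnePos (degForm L (setMonomial (t₁.disjSum t₂) * (E.map linForm).prod)) ↔
      HasOnePos (degForm (WeightedComplex.restrictFacet L (C₂.weight t₂) t₂)
        (setMonomial t₁ * ((E.map (· ∘ Sum.inl)).map linForm).prod)) := by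
  have hw := h₂.weight_pos ht htc
  refine hasOnePos_comp_iff (LinearMap.funLeft ℝ ℝ Sum.inl) hw (fun v w => ?_) fun v => ?_
  · have hfl : ∀ u : R₁ ⊕ R₂ → ℝ, LinearMap.funLeft ℝ ℝ Sum.inl u = u ∘ Sum.inl := fun _ => rfl
    rw [degForm_apply, mul_assoc, hL.setMonomial_facet_mul_prod h₂ ht htc,
      mul_left_comm _ (linForm v), hL.setMonomial_facet_mul_linForm h₂ ht htc,
      ← mul_assoc _ _ (linForm w), mul_comm _ (linForm w),
      hL.setMonomial_facet_mul_linForm h₂ ht htc, degForm_apply, restrictFacet_apply,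
      mul_inv_cancel_left₀ hw.ne', setMonomial_disjSum, hfl, hfl]
    refine congrArg L ?_
    simp only [map_mul]
    generalize rename (R := ℝ) (Sum.inl : R₁ → R₁ ⊕ R₂) (setMonomial t₁) = a₁
    generalize rename (R := ℝ) (Sum.inr : R₂ → R₁ ⊕ R₂) (setMonomial t₂) = a₂
    ring
  · refine ⟨Sum.elim v 0, ?_⟩
    have : LinearMap.funLeft ℝ ℝ Sum.inl (Sum.elim v (0 : R₂ → ℝ)) = v :=
      Sum.elim_comp_inl v (0 : R₂ → ℝ)
    simp [this]

end Facet

/-- The definition only asks for some degree functional; uniqueness makes its conclusion available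
for any given one. -/
theorem IsLorentzian.hodgeAt {R : Type*} [Fintype R] [DecidableEq R]
    {C : WeightedComplex R} {L : MvPolynomial R ℝ →ₗ[ℝ] ℝ} (h : C.IsLorentzian)
    (hC : C.IsGood) (hL : C.IsDegree L) (t : Finset R) (ht : C.face t) (htc : t.card + 2 ≤ C.dim) :
    C.HodgeAt L t := by
  obtain ⟨L', hL', hH⟩ := h.exists_hodgeAt (by omega)
  rw [hL.unique hC hL']
  exact hH t ht htc

/-- A factor of a Lorentzian product is Lorentzian. -/
theorem IsLorentzian.of_prod_left (h₂ : C₂.IsGood)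
    (h : (C₁.prod C₂).IsLorentzian) : C₁.IsLorentzian where
  nonempty_conv := by
    obtain ⟨e, he⟩ := h.nonempty_conv
    rw [show (∅ : Finset (R₁ ⊕ R₂)) = (∅ : Finset R₁).disjSum ∅ by simp] at he
    exact ⟨_, comp_inl_mem_conv h₂.empty_face he⟩
  exists_hodgeAt hd := by
    obtain ⟨L, hL, hH⟩ := h.exists_hodgeAt (by rw [prod_dim]; omega)
    obtain ⟨t₂, -, ht₂, htc⟩ := h₂.pure h₂.empty_face
    refine ⟨_, hL.restrictFacet h₂ ht₂ htc, fun t₁ ht₁ htc₁ E hE hEc => ?_⟩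
    -- The divisors of the first factor are extended by zero on the second. Around the facet `t₂`
    -- even the zero function is strictly convex, so the extensions are admissible.
    have := hH (t₁.disjSum t₂) (prod_face_disjSum.2 ⟨ht₁, ht₂⟩)
      (by rw [Finset.card_disjSum, prod_dim]; omega) (E.map fun e => Sum.elim e 0)
      (by rw [List.length_map, Finset.card_disjSum, prod_dim]; omega) (by
        intro e he
        obtain ⟨e, he', rfl⟩ := List.mem_map.1 he
        exact elim_mem_conv (hEc e he') (h₂.mem_conv_of_card_eq htc 0))
    rw [hL.hasOnePos_facet_iff h₂ ht₂ htc] at this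
    simpa [Function.comp_def] using this

/-- This carries every statement about the first factor over to the second. -/
theorem isRescaling_swap : (C₁.prod C₂).IsRescaling (C₂.prod C₁) (Equiv.sumComm R₁ R₂) 1 := by
  have hl : ∀ φ : R₁ ⊕ R₂ → ℝ, rescale (Equiv.sumComm R₁ R₂) 1 φ ∘ Sum.inl = φ ∘ Sum.inr := by
    intro φ
    ext r
    exact (rescale_apply (Equiv.sumComm R₁ R₂) 1 φ (Sum.inr r)).trans (one_mul _)
  have hr : ∀ φ : R₁ ⊕ R₂ → ℝ, rescale (Equiv.sumComm R₁ R₂) 1 φ ∘ Sum.inr = φ ∘ Sum.inl := by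
    intro φ
    ext r
    exact (rescale_apply (Equiv.sumComm R₁ R₂) 1 φ (Sum.inl r)).trans (one_mul _)
  refine ⟨fun _ => one_pos, fun s => ?_, fun φ => ?_, add_comm _ _, fun s _ _ => ?_⟩
  · simp [WeightedComplex.prod, and_comm]
  · rw [mem_prod_lin, mem_prod_lin, hl, hr, and_comm]
  · simp [WeightedComplex.prod, mul_comm]

theorem IsLorentzian.of_prod_right (h₁ : C₁.IsGood) (h : (C₁.prod C₂).IsLorentzian) :
    C₂.IsLorentzian :=
  (isRescaling_swap.isLorentzian h).of_prod_left h₁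

/-! ### Signatures of the mixed degree forms of a product. -/

section Product

variable {L₁ : MvPolynomial R₁ ℝ →ₗ[ℝ] ℝ} {L₂ : MvPolynomial R₂ ℝ →ₗ[ℝ] ℝ}
    {L : MvPolynomial (R₁ ⊕ R₂) ℝ →ₗ[ℝ] ℝ}

theorem hodgeAt_prod_of_facet (h₁ : C₁.IsGood) (h₂ : C₂.IsGood)
    (hL₁ : C₁.IsDegree L₁) (hL : (C₁.prod C₂).IsDegree L)
    {t₁ : Finset R₁} {t₂ : Finset R₂} (ht₂ : C₂.face t₂)
    (hH : C₁.HodgeAt L₁ t₁) (htc : t₂.card = C₂.dim) :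
    (C₁.prod C₂).HodgeAt L (t₁.disjSum t₂) := by
  intro E hcard hE
  rw [hL.hasOnePos_facet_iff h₂ ht₂ htc, ← hL₁.unique h₁ (hL.restrictFacet h₂ ht₂ htc)]
  refine hH _ ?_ fun e he => ?_
  · rw [Finset.card_disjSum, prod_dim] at hcard
    rw [List.length_map]
    omega
  · obtain ⟨e', he', rfl⟩ := List.mem_map.1 he
    exact comp_inl_mem_conv ht₂ (hE e' he')

/-- By uniqueness `L` is the pullback, under the exchange of the factors, of the tensor product in
the opposite order. This reduces the claim to `hodgeAt_prod_of_facet`. -/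
theorem hodgeAt_prod_of_facet_left (h₁ : C₁.IsGood) (h₂ : C₂.IsGood)
    (hL₁ : C₁.IsDegree L₁) (hL₂ : C₂.IsDegree L₂) (hL : (C₁.prod C₂).IsDegree L)
    {t₁ : Finset R₁} {t₂ : Finset R₂} (ht₁ : C₁.face t₁)
    (hH : C₂.HodgeAt L₂ t₂) (htc : t₁.card = C₁.dim) :
    (C₁.prod C₂).HodgeAt L (t₁.disjSum t₂) := by
  obtain ⟨L', hL'⟩ := exists_tensor L₂ L₁
  have hdeg := IsDegree.prod h₂ h₁ hL₂ hL₁ hL'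
  rw [hL.unique (h₁.prod h₂) (isRescaling_swap.isDegree hdeg)]
  refine isRescaling_swap.hodgeAt ?_
  convert hodgeAt_prod_of_facet h₂ h₁ hL₂ hdeg ht₁ hH htc using 1
  rw [Finset.eq_disjSum_iff]
  simp

theorem IsDegree.exists_linForm_pos {R : Type*} [Fintype R] [DecidableEq R]
    {C : WeightedComplex R} {M : MvPolynomial R ℝ →ₗ[ℝ] ℝ} {t : Finset R} (hM : C.IsDegree M)
    (hC : C.IsGood) (ht : C.face t) (htc : t.card + 1 = C.dim) :
    ∃ w, 0 < M (setMonomial t * linForm w) := by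
  obtain ⟨r, hr⟩ := hC.link_nonempty ht (by omega)
  obtain ⟨hrt, hf⟩ := mem_link.1 hr
  refine ⟨Pi.single r 1, ?_⟩
  have hfc : (insert r t).card = C.dim := by rw [Finset.card_insert_of_notMem hrt, htc]
  rw [linForm_single, mul_comm, ← setMonomial_insert hrt, hM.face _ hf, if_pos hfc]
  exact hC.weight_pos hf hfc

/-- The product of two one-dimensional stars is a hyperbolic plane modulo its radical. -/
theorem hasOnePos_prod_of_ridge (h₁ : C₁.IsGood) (h₂ : C₂.IsGood)
    (hL₁ : C₁.IsDegree L₁) (hL₂ : C₂.IsDegree L₂)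
    (hL : ∀ p q, L (rename Sum.inl p * rename Sum.inr q) = L₁ p * L₂ q)
    {t₁ : Finset R₁} {t₂ : Finset R₂} (ht₁ : C₁.face t₁) (ht₂ : C₂.face t₂)
    (htc₁ : t₁.card + 1 = C₁.dim) (htc₂ : t₂.card + 1 = C₂.dim) :
    HasOnePos (degForm L (setMonomial (t₁.disjSum t₂))) := by
  set a : (R₁ ⊕ R₂ → ℝ) → ℝ := fun w => L₁ (setMonomial t₁ * linForm (w ∘ Sum.inl)) with ha
  set b : (R₁ ⊕ R₂ → ℝ) → ℝ := fun w => L₂ (setMonomial t₂ * linForm (w ∘ Sum.inr)) with hb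
  -- The terms with both divisors from the same factor vanish, since they contain the value of `L₁`
  -- or `L₂` on the monomial of a face that is not a facet. A symmetrised product of two linear
  -- functionals remains.
  have hform : ∀ v w, degForm L (setMonomial (t₁.disjSum t₂)) v w = a v * b w + a w * b v := by
    intro v w
    have e₁ := hL₁.face t₁ ht₁
    have e₂ := hL₂.face t₂ ht₂
    rw [if_neg (by omega)] at e₁ e₂
    set v₁ := linForm (v ∘ Sum.inl)
    set v₂ := linForm (v ∘ Sum.inr)
    set w₁ := linForm (w ∘ Sum.inl)
    set w₂ := linForm (w ∘ Sum.inr)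
    have : setMonomial (t₁.disjSum t₂) * (linForm v * linForm w) =
        rename Sum.inl (setMonomial t₁ * (v₁ * w₁)) * rename Sum.inr (setMonomial t₂)
        + rename Sum.inl (setMonomial t₁) * rename Sum.inr (setMonomial t₂ * (v₂ * w₂))
        + rename Sum.inl (setMonomial t₁ * v₁) * rename Sum.inr (setMonomial t₂ * w₂)
        + rename Sum.inl (setMonomial t₁ * w₁) * rename Sum.inr (setMonomial t₂ * v₂) := by
      rw [linForm_sum v, linForm_sum w, setMonomial_disjSum]
      simp only [map_mul]
      ring
    rw [degForm_apply, this]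
    simp only [map_add, hL, e₁, e₂, ha, hb]
    ring
  refine ⟨?_, fun v x hv hx => ?_⟩
  · obtain ⟨w₁, hw₁⟩ := hL₁.exists_linForm_pos h₁ ht₁ htc₁
    obtain ⟨w₂, hw₂⟩ := hL₂.exists_linForm_pos h₂ ht₂ htc₂
    refine ⟨Sum.elim w₁ w₂, ?_⟩
    have := mul_pos hw₁ hw₂
    rw [hform]
    simp only [ha, hb, Sum.elim_comp_inl, Sum.elim_comp_inr]
    linarith
  · rw [hform] at hv hx ⊢
    -- Orthogonality means `a v * b x = - (a x * b v)`, so the values of the form at `x` and at `v`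
    -- have a nonpositive product.
    have h3 : (a x * b x + a x * b x) * (a v * b v) = - 2 * (a x * b v) ^ 2 := by
      linear_combination (2 * a x * b v) * hx
    nlinarith [sq_nonneg (a x * b v)]

/-- Induction on the number of divisors. When neither `t₁` nor `t₂` is a facet, the link of `t₁ ⊔
t₂` is the join of two nonempty links and thus connected, so the Bochner step applies; otherwise the
form already comes from one factor. -/
theorem hasOnePos_prod (h₁ : C₁.IsGood) (h₂ : C₂.IsGood)
    (hL₁ : C₁.IsDegree L₁) (hL₂ : C₂.IsDegree L₂)
    (hL : ∀ p q, L (rename Sum.inl p * rename Sum.inr q) = L₁ p * L₂ q)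
    (hH₁ : ∀ t, C₁.face t → t.card + 2 ≤ C₁.dim → C₁.HodgeAt L₁ t)
    (hH₂ : ∀ t, C₂.face t → t.card + 2 ≤ C₂.dim → C₂.HodgeAt L₂ t)
    (E : List (R₁ ⊕ R₂ → ℝ)) {t₁ : Finset R₁} {t₂ : Finset R₂} (ht₁ : C₁.face t₁)
    (ht₂ : C₂.face t₂) (hcard : E.length + 2 + (t₁.card + t₂.card) = C₁.dim + C₂.dim)
    (hE : ∀ e ∈ E, e ∈ (C₁.prod C₂).conv (t₁.disjSum t₂)) :
    HasOnePos (degForm L (setMonomial (t₁.disjSum t₂) * (E.map linForm).prod)) := by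
  have hdeg := IsDegree.prod h₁ h₂ hL₁ hL₂ hL
  induction E generalizing t₁ t₂ with
  | nil =>
    have hc₁ := h₁.card_le ht₁
    have hc₂ := h₂.card_le ht₂
    have hcard' : (t₁.disjSum t₂).card + 2 = C₁.dim + C₂.dim := by
      rw [Finset.card_disjSum]
      simpa [add_comm] using hcard
    simp only [List.length_nil] at hcard
    -- The total codimension is two, split between the factors as `2 + 0`, `1 + 1` or `0 + 2`.
    rcases lt_trichotomy (t₁.card + 1) C₁.dim with h | h | h
    · exact hodgeAt_prod_of_facet h₁ h₂ hL₁ hdeg ht₂ (hH₁ t₁ ht₁ (by omega)) (by omega) []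
        (by simpa [add_comm, prod_dim] using hcard') (by simp)
    · rw [List.map_nil, List.prod_nil, mul_one]
      exact hasOnePos_prod_of_ridge h₁ h₂ hL₁ hL₂ hL ht₁ ht₂ h (by omega)
    · exact hodgeAt_prod_of_facet_left h₁ h₂ hL₁ hL₂ hdeg ht₁ (hH₂ t₂ ht₂ (by omega)) (by omega) []
        (by simpa [add_comm, prod_dim] using hcard') (by simp)
  | cons e E ih =>
    have hc₁ := h₁.card_le ht₁
    have hc₂ := h₂.card_le ht₂
    have hcard' : (e :: E).length + 2 + (t₁.disjSum t₂).card = C₁.dim + C₂.dim := by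
      rwa [Finset.card_disjSum]
    rw [List.length_cons] at hcard
    -- Over a facet one of the two links is empty, and the connectedness of the join is lost; here
    -- the assumption on the other factor is used directly.
    by_cases hf₂ : t₂.card = C₂.dim
    · exact hodgeAt_prod_of_facet h₁ h₂ hL₁ hdeg ht₂ (hH₁ t₁ ht₁ (by omega)) hf₂ _ hcard' hE
    by_cases hf₁ : t₁.card = C₁.dim
    · exact hodgeAt_prod_of_facet_left h₁ h₂ hL₁ hL₂ hdeg ht₁ (hH₂ t₂ ht₂ (by omega)) hf₁ _
        hcard' hE
    have hl : ∀ r, Sum.inl r ∈ (C₁.prod C₂).link (t₁.disjSum t₂) → r ∈ C₁.link t₁ := by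
      intro r hr
      obtain ⟨hr1, hr2⟩ := mem_link.1 hr
      have := hr2.1
      rw [Finset.toLeft_insert_inl, Finset.toLeft_disjSum] at this
      exact mem_link.2 ⟨by simpa using hr1, this⟩
    have hr : ∀ r, Sum.inr r ∈ (C₁.prod C₂).link (t₁.disjSum t₂) → r ∈ C₂.link t₂ := by
      intro r hr
      obtain ⟨hr1, hr2⟩ := mem_link.1 hr
      have := hr2.2
      rw [Finset.toRight_insert_inr, Finset.toRight_disjSum] at this
      exact mem_link.2 ⟨by simpa using hr1, this⟩
    refine hdeg.hasOnePos_cons (h₁.prod h₂) (prod_face_disjSum.2 ⟨ht₁, ht₂⟩) ?_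
      (hE e (by simp)) (fun e he => hE e (by simp [he])) ?_ ?_
    · rw [prod_dim, ← hcard', List.length_cons]
    · have hmono : ∀ r, ∀ e ∈ E, e ∈ (C₁.prod C₂).conv (insert r (t₁.disjSum t₂)) :=
        fun r e he => conv_mono (Finset.subset_insert _ _) (hE e (by simp [he]))
      rintro (r | r) hrl
      · obtain ⟨h1, h2⟩ := mem_link.1 (hl r hrl)
        have h3 : insert (Sum.inl r) (t₁.disjSum t₂) = (insert r t₁).disjSum t₂ := by
          rw [Finset.eq_disjSum_iff]
          simp
        rw [h3]
        exact ih h2 ht₂ (by rw [Finset.card_insert_of_notMem h1]; omega) (h3 ▸ hmono _)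
      · obtain ⟨h1, h2⟩ := mem_link.1 (hr r hrl)
        have h3 : insert (Sum.inr r) (t₁.disjSum t₂) = t₁.disjSum (insert r t₂) := by
          rw [Finset.eq_disjSum_iff]
          simp
        rw [h3]
        exact ih ht₁ h2 (by rw [Finset.card_insert_of_notMem h1]; omega) (h3 ▸ hmono _)
    -- Two elements from different factors are always adjacent. Two elements from the same factor
    -- are linked through an element of the other one.
    · intro y hy
      have hlr : ∀ r r', Sum.inl r ∈ (C₁.prod C₂).link (t₁.disjSum t₂) →
          Sum.inr r' ∈ (C₁.prod C₂).link (t₁.disjSum t₂) → y (Sum.inl r) = y (Sum.inr r') := by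
        intro r r' h h'
        refine hy _ h _ h' (by simp) ?_
        have h1 := (mem_link.1 (hl r h)).2
        have h2 := (mem_link.1 (hr r' h')).2
        refine ⟨?_, ?_⟩
        · rwa [Finset.toLeft_insert_inr, Finset.toLeft_insert_inl, Finset.toLeft_disjSum]
        · rwa [Finset.toRight_insert_inr, Finset.toRight_insert_inl, Finset.toRight_disjSum]
      obtain ⟨r₁, hr₁⟩ := h₁.link_nonempty ht₁ hf₁
      obtain ⟨r₂, hr₂⟩ := h₂.link_nonempty ht₂ hf₂
      have hr₁' : Sum.inl r₁ ∈ (C₁.prod C₂).link (t₁.disjSum t₂) := by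
        obtain ⟨h1, h2⟩ := mem_link.1 hr₁
        refine mem_link.2 ⟨by simpa using h1, ?_, ?_⟩
        · rwa [Finset.toLeft_insert_inl, Finset.toLeft_disjSum]
        · rwa [Finset.toRight_insert_inl, Finset.toRight_disjSum]
      have hr₂' : Sum.inr r₂ ∈ (C₁.prod C₂).link (t₁.disjSum t₂) := by
        obtain ⟨h1, h2⟩ := mem_link.1 hr₂
        refine mem_link.2 ⟨by simpa using h1, ?_, ?_⟩
        · rwa [Finset.toLeft_insert_inr, Finset.toLeft_disjSum]
        · rwa [Finset.toRight_insert_inr, Finset.toRight_disjSum]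
      have hall : ∀ r ∈ (C₁.prod C₂).link (t₁.disjSum t₂), y r = y (Sum.inl r₁) := by
        rintro (r | r) h
        · rw [hlr r r₂ h hr₂', hlr r₁ r₂ hr₁' hr₂']
        · rw [hlr r₁ r hr₁' h]
      intro r h r' h'
      rw [hall r h, hall r' h']

/-- The product of two weighted complexes with the Lorentzian property has it as well. The degree
functionals are only needed in low dimension, where the property says nothing about them. -/
theorem IsLorentzian.prod (h₁ : C₁.IsGood) (h₂ : C₂.IsGood) (hL₁ : C₁.IsDegree L₁)
    (hL₂ : C₂.IsDegree L₂) (hC₁ : C₁.IsLorentzian) (hC₂ : C₂.IsLorentzian) :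
    (C₁.prod C₂).IsLorentzian where
  nonempty_conv := by
    obtain ⟨e₁, he₁⟩ := hC₁.nonempty_conv
    obtain ⟨e₂, he₂⟩ := hC₂.nonempty_conv
    refine ⟨Sum.elim e₁ e₂, ?_⟩
    rw [show (∅ : Finset (R₁ ⊕ R₂)) = (∅ : Finset R₁).disjSum ∅ by simp]
    exact elim_mem_conv he₁ he₂
  exists_hodgeAt _ := by
    obtain ⟨L, hL⟩ := exists_tensor L₁ L₂
    refine ⟨L, IsDegree.prod h₁ h₂ hL₁ hL₂ hL, fun t ht _ E hE hEc => ?_⟩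
    rw [← t.toLeft_disjSum_toRight] at hEc ⊢
    refine hasOnePos_prod h₁ h₂ hL₁ hL₂ hL (hC₁.hodgeAt h₁ hL₁) (hC₂.hodgeAt h₂ hL₂) E ht.1 ht.2
      ?_ hEc
    rwa [Finset.card_toLeft_add_card_toRight]

end Product

end WeightedComplex

end LorentzianFans

end

noncomputable section

namespace LorentzianFans

open MvPolynomial

/-! ### Stars of weighted complexes -/

namespace WeightedComplex

variable {R : Type*} [DecidableEq R]

/-- The star of a face `t`, on the same set of elements. -/
def star (C : WeightedComplex R) (t : Finset R) : WeightedComplex R where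
  face s := Disjoint s t ∧ C.face (s ∪ t)
  lin := C.lin ⊓
    { carrier := {φ | ∀ r ∈ t, φ r = 0}
      zero_mem' := fun _ _ => rfl
      add_mem' := fun ha hb r hr => by simp [ha r hr, hb r hr]
      smul_mem' := fun c a ha r hr => by simp [ha r hr] }
  dim := C.dim - t.card
  weight s := C.weight (s ∪ t)

variable {C : WeightedComplex R} {t : Finset R}

theorem mem_star_lin {φ : R → ℝ} : φ ∈ (C.star t).lin ↔ φ ∈ C.lin ∧ ∀ r ∈ t, φ r = 0 := Iff.rfl

theorem star_dim : (C.star t).dim = C.dim - t.card := rfl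

theorem star_weight (s : Finset R) : (C.star t).weight s = C.weight (s ∪ t) := rfl

theorem star_empty : C.star ∅ = C := by
  obtain ⟨face, lin, dim, weight⟩ := C
  simp only [star, Finset.disjoint_empty_right, Finset.union_empty, true_and,
    Finset.card_empty, Nat.sub_zero, Finset.notMem_empty, false_implies, implies_true]
  congr
  ext φ
  simp

theorem star_face_sdiff {s : Finset R} (hts : t ⊆ s) (hs : C.face s) :
    (C.star t).face (s \ t) :=
  ⟨Finset.sdiff_disjoint, by rwa [Finset.sdiff_union_of_subset hts]⟩

theorem IsGood.star (hC : C.IsGood) (ht : C.face t) : (C.star t).IsGood where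
  empty_face := ⟨Finset.disjoint_empty_left _, by rwa [Finset.empty_union]⟩
  mono {s s'} hs hss := ⟨hs.1.mono_left hss, hC.mono hs.2 (Finset.union_subset_union_left hss)⟩
  pure {s} hs := by
    obtain ⟨q, hsq, hq, hqc⟩ := hC.pure hs.2
    have htq := Finset.union_subset_right hsq
    refine ⟨q \ t, ?_, star_face_sdiff htq hq, ?_⟩
    · exact Finset.subset_sdiff.2 ⟨Finset.union_subset_left hsq, hs.1⟩
    · rw [Finset.card_sdiff_of_subset htq, hqc, star_dim]
  exists_dual {s} hs r hr := by
    obtain ⟨φ, hφ, h1, h0⟩ := hC.exists_dual hs.2 r (Finset.mem_union_left _ hr)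
    refine ⟨φ, ⟨hφ, fun r' hr' => h0 r' (Finset.mem_union_right _ hr') ?_⟩, h1,
      fun r' hr' => h0 r' (Finset.mem_union_left _ hr')⟩
    rintro rfl
    exact Finset.disjoint_left.1 hs.1 hr hr'
  weight_pos {s} hs hsc := by
    refine hC.weight_pos hs.2 ?_
    have := hC.card_le ht
    rw [Finset.card_union_of_disjoint hs.1, hsc, star_dim]
    omega

/-- Set the values on `t` to zero. -/
def vanishOn (t : Finset R) : (R → ℝ) →ₗ[ℝ] (R → ℝ) :=
  LinearMap.pi fun r => if r ∈ t then 0 else LinearMap.proj r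

theorem vanishOn_apply (w : R → ℝ) (r : R) : vanishOn t w r = if r ∈ t then 0 else w r := by
  simp only [vanishOn, LinearMap.pi_apply]
  split_ifs <;> simp

theorem vanishOn_eq_self {w : R → ℝ} (h : ∀ r ∈ t, w r = 0) : vanishOn t w = w := by
  ext r
  rw [vanishOn_apply]
  split_ifs with hr
  · exact (h r hr).symm
  · rfl

/-- Faces of `C` containing `t` correspond to faces of the star by removing `t`. The elements of `t`
belong to no face of the star, so convexity there does not control the values on them, and they have
to be reset to zero. -/
theorem vanishOn_mem_conv {e : R → ℝ} (he : e ∈ (C.star t).conv ∅) : vanishOn t e ∈ C.conv t := by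
  intro s hts hs
  obtain ⟨φ, hφ, h1, h2⟩ := he (s \ t) (Finset.empty_subset _) (star_face_sdiff hts hs)
  obtain ⟨hφ, h0⟩ := mem_star_lin.1 hφ
  refine ⟨φ, hφ, fun r hr => ?_, fun r hr hrs => ?_⟩
  · rw [vanishOn_apply]
    split_ifs with hrt
    · exact (h0 r hrt).symm
    · exact h1 r (Finset.mem_sdiff.2 ⟨hr, hrt⟩)
  · have hrt : r ∉ t := fun h => hr (hts h)
    rw [vanishOn_apply, if_neg hrt]
    refine h2 r (fun h => hr (Finset.mem_sdiff.1 h).1) ?_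
    rw [← Finset.insert_sdiff_of_notMem _ hrt]
    exact star_face_sdiff (hts.trans (Finset.subset_insert _ _)) hrs

theorem mem_star_conv_of_vanish {e : R → ℝ} (he : e ∈ C.conv t) (h0 : ∀ r ∈ t, e r = 0) :
    e ∈ (C.star t).conv ∅ := by
  intro s _ hs
  obtain ⟨φ, hφ, h1, h2⟩ := he (s ∪ t) Finset.subset_union_right hs.2
  refine ⟨φ, ⟨hφ, fun r hr => ?_⟩, fun r hr => h1 r (Finset.mem_union_left _ hr),
    fun r hr hrs => ?_⟩
  · rw [← h1 r (Finset.mem_union_right _ hr), h0 r hr]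
  · have hrt : r ∉ t := Finset.disjoint_left.1 hrs.1 (Finset.mem_insert_self r s)
    refine h2 r (by simp [hr, hrt]) ?_
    have := hrs.2
    rwa [Finset.insert_union] at this

variable [Fintype R] {L : MvPolynomial R ℝ →ₗ[ℝ] ℝ}

/-- The functional induced by `L` on the star of `t`. -/
def starFunctional (L : MvPolynomial R ℝ →ₗ[ℝ] ℝ) (t : Finset R) : MvPolynomial R ℝ →ₗ[ℝ] ℝ :=
  L ∘ₗ LinearMap.mulLeft ℝ (setMonomial t) ∘ₗ
    (aeval fun r => if r ∈ t then 0 else X r : MvPolynomial R ℝ →ₐ[ℝ] _).toLinearMap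

theorem starFunctional_apply (p : MvPolynomial R ℝ) : starFunctional L t p =
    L (setMonomial t * aeval (fun r => if r ∈ t then 0 else X r) p) := rfl

theorem starFunctional_mul (p q : MvPolynomial R ℝ) : starFunctional L t (p * q) =
    L (setMonomial t * (aeval (fun r => if r ∈ t then 0 else X r) p *
      aeval (fun r => if r ∈ t then 0 else X r) q)) := by
  rw [starFunctional_apply, ← map_mul (aeval _)]

theorem aeval_vanish_linForm (w : R → ℝ) :
    aeval (fun r => if r ∈ t then 0 else (X r : MvPolynomial R ℝ)) (linForm w) =
      linForm (vanishOn t w) := by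
  simp only [linForm_apply, map_sum, map_smul, aeval_X, vanishOn_apply]
  exact Finset.sum_congr rfl fun r _ => by split_ifs <;> simp

theorem aeval_vanish_setMonomial {s : Finset R} (hs : Disjoint s t) :
    aeval (fun r => if r ∈ t then 0 else (X r : MvPolynomial R ℝ)) (setMonomial s) =
      setMonomial s := by
  simp only [setMonomial, map_prod, aeval_X]
  exact Finset.prod_congr rfl fun r hr => if_neg (Finset.disjoint_left.1 hs hr)

/-- On the common set of variables the elements of `t` are nonfaces of the star. The substitution of
zero for their variables enforces exactly these additional relations. -/
theorem IsDegree.starFunctional (hC : C.IsGood) (hL : C.IsDegree L) (ht : C.face t) :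
    (C.star t).IsDegree (starFunctional L t) where
  nonface s hs p := by
    rw [starFunctional_mul]
    by_cases hst : Disjoint s t
    · rw [aeval_vanish_setMonomial hst, ← mul_assoc, ← setMonomial_union hst.symm]
      exact hL.nonface _ (fun h => hs ⟨hst, by rwa [Finset.union_comm]⟩) _
    · obtain ⟨r, hrs, hrt⟩ := Finset.not_disjoint_iff.1 hst
      have : aeval (fun r => if r ∈ t then 0 else (X r : MvPolynomial R ℝ)) (setMonomial s)
          = 0 := by
        simp only [setMonomial, map_prod, aeval_X]
        exact Finset.prod_eq_zero hrs (if_pos hrt)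
      rw [this, zero_mul, mul_zero, map_zero]
  lin φ hφ p := by
    obtain ⟨hφ, h0⟩ := mem_star_lin.1 hφ
    rw [starFunctional_mul, aeval_vanish_linForm, vanishOn_eq_self h0, mul_left_comm]
    exact hL.lin φ hφ _
  face s hs := by
    rw [starFunctional_apply, aeval_vanish_setMonomial hs.1, ← setMonomial_union hs.1.symm,
      Finset.union_comm, hL.face _ hs.2, Finset.card_union_of_disjoint hs.1, star_dim, star_weight]
    have := hC.card_le ht
    exact if_congr (by omega) rfl rfl

theorem prod_linForm_congr (g : (R → ℝ) → (R → ℝ)) (E : List (R → ℝ))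
    (hg : ∀ e ∈ E, ∀ p, L (linForm e * p) = L (linForm (g e) * p)) (p : MvPolynomial R ℝ) :
    L ((E.map linForm).prod * p) = L (((E.map g).map linForm).prod * p) := by
  induction E generalizing p with
  | nil => rfl
  | cons e E ih =>
    simp only [List.map_cons, List.prod_cons, mul_assoc]
    rw [hg e (by simp), mul_left_comm, ih fun e he => hg e (by simp [he]),
      mul_left_comm]

/-- The form of the star is the pullback along `vanishOn t` of the form at `t`. This map is
surjective modulo the radical, because every function can be moved by a linear one to a function
vanishing on `t`. -/
theorem IsDegree.hasOnePos_starFunctional_iff (hC : C.IsGood) (hL : C.IsDegree L) (ht : C.face t)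
    (E : List (R → ℝ)) :
    HasOnePos (degForm (WeightedComplex.starFunctional L t)
      (setMonomial ∅ * (E.map linForm).prod)) ↔
    HasOnePos (degForm L (setMonomial t * ((E.map (vanishOn t)).map linForm).prod)) := by
  have hprod : aeval (fun r => if r ∈ t then 0 else (X r : MvPolynomial R ℝ))
      (E.map linForm).prod = ((E.map (vanishOn t)).map linForm).prod := by
    rw [map_list_prod, List.map_map, List.map_map]
    congr 1
    exact List.map_congr_left fun w _ => aeval_vanish_linForm w
  refine hasOnePos_comp_iff (vanishOn t) one_pos (fun v w => ?_) fun v => ?_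
  · rw [one_mul, degForm_apply, degForm_apply, starFunctional_mul, setMonomial_empty, one_mul,
      hprod, ← mul_assoc, ← aeval_vanish_linForm v, ← aeval_vanish_linForm w,
      ← map_mul (aeval _)]
  · obtain ⟨φ, hφ, h⟩ := hC.exists_lin_eqOn ht v
    have h1 : vanishOn t (v - φ) = v - φ := vanishOn_eq_self fun r hr => by simp [h r hr]
    have h2 : ∀ p x, degForm L p v x = degForm L p (vanishOn t (v - φ)) x := fun p x => by
      rw [h1, map_sub, LinearMap.sub_apply, hL.degForm_lin hφ, sub_zero]
    exact ⟨v - φ, h2 _, fun x => by rw [degForm_symm, h2, degForm_symm]⟩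

/-- The mixed degree forms over `t` are the mixed degree forms of the star. -/
theorem IsDegree.hodgeAt_starFunctional_iff (hC : C.IsGood) (hL : C.IsDegree L) (ht : C.face t) :
    (C.star t).HodgeAt (WeightedComplex.starFunctional L t) ∅ ↔ C.HodgeAt L t := by
  have htc := hC.card_le ht
  constructor
  · intro h E hcard hE
    -- Each divisor is replaced by its representative `e - φ e` vanishing on `t`, which does not
    -- change the form and is fixed by `vanishOn t`.
    choose! φ hφ h0 _ using fun e he => hE e he t subset_rfl ht
    have h1 := h (E.map fun e => e - φ e)
      (by rw [List.length_map, star_dim, Finset.card_empty]; omega) (by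
      intro e' he'
      obtain ⟨e, he, rfl⟩ := List.mem_map.1 he'
      exact mem_star_conv_of_vanish (sub_mem_conv (hE e he) (hφ e he))
        fun r hr => by simp [h0 e he r hr])
    rw [hL.hasOnePos_starFunctional_iff hC ht] at h1
    have h2 : (E.map fun e => e - φ e).map (vanishOn t) = E.map fun e => e - φ e := by
      rw [List.map_map]
      refine List.map_congr_left fun e he => ?_
      exact vanishOn_eq_self fun r hr => by simp [h0 e he r hr]
    rw [h2] at h1
    convert h1 using 1
    refine LinearMap.ext₂ fun v w => ?_
    rw [degForm_apply, degForm_apply, mul_comm (setMonomial t), mul_assoc,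
      prod_linForm_congr (fun e => e - φ e) E
        fun e he => hL.linForm_congr (by simpa using hφ e he),
      ← mul_assoc, mul_comm _ (setMonomial t)]
  · intro h E hcard hE
    rw [hL.hasOnePos_starFunctional_iff hC ht]
    rw [star_dim, Finset.card_empty] at hcard
    refine h _ (by rw [List.length_map]; omega) fun e' he' => ?_
    obtain ⟨e, he, rfl⟩ := List.mem_map.1 he'
    exact vanishOn_mem_conv (hE e he)

/-- In dimension at most one a degree functional exists. -/
theorem IsGood.exists_isDegree_of_dim_le_one (hC : C.IsGood) (hd : C.dim ≤ 1)
    (hbal : C.dim = 1 → ∀ φ ∈ C.lin, ∑ r ∈ C.link ∅, C.weight {r} * φ r = 0) :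
    ∃ L, C.IsDegree L := by
  have hconst : ∀ s : Finset R, s ≠ ∅ → constantCoeff (setMonomial s) = (0 : ℝ) := by
    intro s hs
    obtain ⟨r, hr⟩ := Finset.nonempty_iff_ne_empty.2 hs
    rw [setMonomial, map_prod]
    exact Finset.prod_eq_zero hr (constantCoeff_X (R := ℝ) r)
  have hlin : ∀ φ : R → ℝ, constantCoeff (linForm φ) = 0 := by
    intro φ
    simp [linForm_apply, constantCoeff_smul]
  let K : MvPolynomial R ℝ →ₗ[ℝ] ℝ := (aeval fun _ => (0 : ℝ)).toLinearMap
  have hK : ∀ p, K p = constantCoeff p := fun p => by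
    simp [K, aeval_def, constantCoeff_eq]
  have hne : ∀ s, ¬ C.face s → s ≠ ∅ := by
    rintro s hs rfl
    exact hs hC.empty_face
  rcases Nat.le_one_iff_eq_zero_or_eq_one.1 hd with hd | hd
  -- In dimension zero the functional is a multiple of the constant term.
  · refine ⟨C.weight ∅ • K, fun s hs p => ?_, fun φ hφ p => ?_, fun s hs => ?_⟩
    · rw [LinearMap.smul_apply, hK, map_mul, hconst s (hne s hs), zero_mul, smul_zero]
    · rw [LinearMap.smul_apply, hK, map_mul, hlin, zero_mul, smul_zero]
    · have := hC.card_le hs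
      obtain rfl : s = ∅ := Finset.card_eq_zero.1 (by omega)
      simp [hd, hK]
  -- In dimension one it is the weighted sum of the linear coefficients, and balancing says that it
  -- kills the linear relations.
  · refine ⟨∑ r ∈ C.link ∅, C.weight {r} • (K ∘ₗ (pderiv r).toLinearMap), ?_, ?_, ?_⟩
    · intro s hs p
      rw [LinearMap.sum_apply]
      refine Finset.sum_eq_zero fun r hr => ?_
      obtain ⟨a, ha⟩ := Finset.nonempty_iff_ne_empty.2 (hne s hs)
      rw [LinearMap.smul_apply, LinearMap.comp_apply, hK, ← Finset.insert_erase ha,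
        setMonomial_insert (Finset.notMem_erase _ _), mul_assoc]
      change _ • constantCoeff (pderiv r _) = _
      rw [pderiv_mul, map_add, map_mul, map_mul, map_mul, constantCoeff_X, zero_mul,
        add_zero]
      rcases eq_or_ne a r with rfl | har
      · rw [hconst, zero_mul, mul_zero, smul_zero]
        intro h
        refine hs ?_
        rw [← Finset.insert_erase ha, h]
        exact (mem_link.1 hr).2
      · rw [pderiv_X_of_ne har, map_zero, zero_mul, smul_zero]
    · intro φ hφ p
      rw [LinearMap.sum_apply]
      have : ∀ r, constantCoeff (pderiv r (linForm φ)) = φ r := by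
        intro r
        rw [linForm_apply, map_sum, map_sum, Finset.sum_eq_single r]
        · simp [constantCoeff_smul]
        · intro a _ har
          simp [pderiv_X_of_ne har]
        · simp
      rw [Finset.sum_congr rfl fun r _ => show
        (C.weight {r} • (K ∘ₗ (pderiv r).toLinearMap)) (linForm φ * p) =
          (C.weight {r} * φ r) * constantCoeff p by
        rw [LinearMap.smul_apply, LinearMap.comp_apply, hK]
        change _ • constantCoeff (pderiv r _) = _
        rw [pderiv_mul, map_add, map_mul, map_mul, hlin, this, zero_mul, add_zero, smul_eq_mul,
          mul_assoc], ← Finset.sum_mul, hbal hd φ hφ, zero_mul]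
    · intro s hs
      have := hC.card_le hs
      rw [hd] at this ⊢
      rw [LinearMap.sum_apply]
      have hterm : ∀ r, (C.weight {r} • (K ∘ₗ (pderiv r).toLinearMap)) (setMonomial s) =
          C.weight {r} * constantCoeff (pderiv r (setMonomial s)) := fun r => by
        rw [LinearMap.smul_apply, LinearMap.comp_apply, hK]
        rfl
      simp only [hterm]
      rcases Nat.le_one_iff_eq_zero_or_eq_one.1 this with h0 | h0
      · obtain rfl := Finset.card_eq_zero.1 h0
        simp
      · obtain ⟨a, rfl⟩ := Finset.card_eq_one.1 h0
        rw [if_pos h0, Finset.sum_eq_single a]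
        · simp [setMonomial]
        · intro b _ hb
          simp [setMonomial, pderiv_X_of_ne hb.symm]
        · intro h
          exact absurd (mem_link.2 ⟨by simp, by simpa using hs⟩) h

end WeightedComplex

end LorentzianFans

end

noncomputable section

namespace LorentzianFans

open scoped Classical

/-! ### Simplicial cones -/

section Cone

variable {V : Type*} [AddCommGroup V] [Module ℝ V] {R : Type*}

/-- The cone generated by the vectors `u r`, `r ∈ s`. -/
def cone (u : R → V) (s : Finset R) : PointedCone ℝ V := PointedCone.hull ℝ (u '' s)

/-- There are dual functionals to the vectors `u r`, `r ∈ s`. -/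
def IsFree (u : R → V) (s : Finset R) : Prop :=
  ∀ r ∈ s, ∃ l : Module.Dual ℝ V, l (u r) = 1 ∧ ∀ r' ∈ s, r' ≠ r → l (u r') = 0

variable {u : R → V} {s t : Finset R}

theorem mem_cone_of_mem {r : R} (hr : r ∈ s) : u r ∈ cone u s :=
  Submodule.subset_span ⟨r, hr, rfl⟩

theorem cone_le_iff_forall {σ : PointedCone ℝ V} : cone u s ≤ σ ↔ ∀ r ∈ s, u r ∈ σ := by
  rw [cone, Submodule.span_le]
  exact Set.image_subset_iff

theorem cone_mono (h : s ⊆ t) : cone u s ≤ cone u t :=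
  cone_le_iff_forall.2 fun _ hr => mem_cone_of_mem (h hr)

theorem mem_cone {x : V} : x ∈ cone u s ↔
    ∃ c : R → ℝ, (∀ r ∈ s, 0 ≤ c r) ∧ x = ∑ r ∈ s, c r • u r := by
  constructor
  · intro hx
    induction hx using Submodule.span_induction with
    | mem x hx =>
      obtain ⟨r, hr, rfl⟩ := hx
      refine ⟨Pi.single r 1, fun r' _ => ?_, ?_⟩
      · rw [Pi.single_apply]
        split_ifs <;> norm_num
      · rw [Finset.sum_eq_single r]
        · simp
        · intro b _ hb
          simp [hb]
        · exact fun h => absurd hr h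
    | zero => exact ⟨0, by simp, by simp⟩
    | add x y _ _ hx hy =>
      obtain ⟨c, hc, rfl⟩ := hx
      obtain ⟨d, hd, rfl⟩ := hy
      exact ⟨c + d, fun r hr => add_nonneg (hc r hr) (hd r hr), by
        simp [add_smul, Finset.sum_add_distrib]⟩
    | smul a x _ hx =>
      obtain ⟨c, hc, rfl⟩ := hx
      refine ⟨(a : ℝ) • c, fun r hr => mul_nonneg a.2 (hc r hr), ?_⟩
      rw [Finset.smul_sum]
      refine Finset.sum_congr rfl fun r _ => ?_
      rw [Pi.smul_apply, smul_eq_mul, mul_smul]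
      rfl
  · rintro ⟨c, hc, rfl⟩
    exact Submodule.sum_mem _ fun r hr => PointedCone.smul_mem _ (hc r hr) (mem_cone_of_mem hr)

@[simp]
theorem cone_empty : cone u ∅ = ⊥ := by simp [cone]

theorem map_cone {W : Type*} [AddCommGroup W] [Module ℝ W] (f : V →ₗ[ℝ] W) :
    (cone u s).map f = cone (fun r => f (u r)) s := by
  ext y
  rw [PointedCone.mem_map, mem_cone]
  constructor
  · rintro ⟨x, hx, rfl⟩
    obtain ⟨c, hc, rfl⟩ := mem_cone.1 hx
    exact ⟨c, hc, by simp⟩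
  · rintro ⟨c, hc, rfl⟩
    exact ⟨_, mem_cone.2 ⟨c, hc, rfl⟩, by simp⟩

theorem coneSpan_cone : coneSpan (cone u s) = Submodule.span ℝ (u '' s) :=
  Submodule.span_span_of_tower _ _ _

theorem mkQ_eq_zero_of_mem {r : R} (hr : r ∈ t) : (coneSpan (cone u t)).mkQ (u r) = 0 :=
  (Submodule.Quotient.mk_eq_zero _).2 (Submodule.subset_span (mem_cone_of_mem hr))

theorem isFree_iff_linearIndepOn : IsFree u s ↔ LinearIndepOn ℝ u (s : Set R) := by
  constructor
  · intro h
    rw [linearIndepOn_finset_iff]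
    intro c hc r hr
    obtain ⟨l, h1, h0⟩ := h r hr
    have := congrArg l hc
    rw [map_sum, map_zero, Finset.sum_eq_single r] at this
    · simpa [h1] using this
    · intro b hb hbr
      rw [map_smul, h0 b hb hbr, smul_zero]
    · exact fun h => absurd hr h
  · intro h r hr
    have hli : LinearIndependent ℝ fun i : (s : Set R) => u i := h
    obtain ⟨l, hl⟩ := LinearMap.exists_extend
      ((Finsupp.lapply (R := ℝ) (⟨r, hr⟩ : (s : Set R))).comp hli.repr)
    have key : ∀ i : (s : Set R), l (u i) = Finsupp.single i (1 : ℝ) ⟨r, hr⟩ := by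
      intro i
      have h1 := LinearMap.congr_fun hl ⟨u i, Submodule.subset_span ⟨i, rfl⟩⟩
      rw [LinearMap.comp_apply, LinearMap.comp_apply, hli.repr_eq_single i _ rfl] at h1
      simpa using h1
    refine ⟨l, ?_, fun r' hr' hne => ?_⟩
    · simpa using key ⟨r, hr⟩
    · have := key ⟨r', hr'⟩
      rwa [Finsupp.single_eq_of_ne] at this
      exact fun h => hne (congrArg Subtype.val h).symm

theorem IsFree.mono (h : IsFree u t) (hst : s ⊆ t) : IsFree u s := fun r hr => by
  obtain ⟨l, h1, h0⟩ := h r (hst hr)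
  exact ⟨l, h1, fun r' hr' => h0 r' (hst hr')⟩

theorem IsFree.coneDim (h : IsFree u s) : coneDim (cone u s) = s.card := by
  rw [LorentzianFans.coneDim, coneSpan_cone]
  have hli : LinearIndependent ℝ fun i : (s : Set R) => u i := isFree_iff_linearIndepOn.1 h
  have := finrank_span_eq_card hli
  rw [Set.image_eq_range]
  simpa using this

theorem IsFree.isSimplicial (h : IsFree u s) : (cone u s).IsSimplicial :=
  ⟨u '' s, s.finite_toSet.image u, (isFree_iff_linearIndepOn.1 h).id_image, rfl⟩

theorem IsFree.ne_zero (h : IsFree u s) {r : R} (hr : r ∈ s) : u r ≠ 0 := by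
  obtain ⟨l, h1, -⟩ := h r hr
  intro h0
  simp [h0] at h1

/-- Linear functionals take arbitrary values on a free family. -/
theorem IsFree.exists_dual (h : IsFree u s) (e : R → ℝ) :
    ∃ l : Module.Dual ℝ V, ∀ r ∈ s, l (u r) = e r := by
  choose! f hf using h
  refine ⟨∑ r ∈ s, e r • f r, fun r hr => ?_⟩
  rw [LinearMap.sum_apply, Finset.sum_eq_single r]
  · simp [(hf r hr).1]
  · intro b hb hbr
    simp [(hf b hb).2 r hr hbr.symm]
  · exact fun h => absurd hr h

/-- The functional dual to a generator outside `s` reads off its coefficient. On a sum lying in the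
cone over `s` it vanishes, and as the coefficients of both summands are nonnegative, each of them is
zero. -/
theorem IsFree.isFaceOf (h : IsFree u t) (hst : s ⊆ t) : (cone u s).IsFaceOf (cone u t) := by
  refine ⟨cone_mono hst, fun {x y a} hx hy ha hxy => ?_⟩
  obtain ⟨c, hc, rfl⟩ := mem_cone.1 hx
  obtain ⟨d, hd, rfl⟩ := mem_cone.1 hy
  obtain ⟨b, hb, hab⟩ := mem_cone.1 hxy
  refine mem_cone.2 ⟨c, fun r hr => hc r (hst hr), ?_⟩
  refine (Finset.sum_subset hst fun r hr hrs => ?_).symm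
  obtain ⟨l, h1, h0⟩ := h r hr
  have hval : ∀ e : R → ℝ, l (∑ r ∈ t, e r • u r) = e r := by
    intro e
    rw [map_sum, Finset.sum_eq_single r]
    · simp [h1]
    · intro b hb hbr
      rw [map_smul, h0 b hb hbr, smul_zero]
    · exact fun h => absurd hr h
  have h2 := congrArg l hab
  rw [map_add, map_smul, hval, hval, map_sum, Finset.sum_eq_zero (s := s)] at h2
  · have := mul_nonneg ha.le (hc r hr)
    have h3 : a * c r = 0 := by
      have := hd r hr
      rw [smul_eq_mul] at h2
      linarith
    rw [(mul_eq_zero.1 h3).resolve_left ha.ne', zero_smul]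
  · intro r' hr'
    rw [map_smul, h0 r' (hst hr') (fun h => hrs (h ▸ hr')), smul_zero]

/-- A face contains every generator that occurs with positive coefficient in one of its points, so
it is generated by the generators it contains. -/
theorem exists_eq_cone_of_isFaceOf {σ : PointedCone ℝ V} (h : σ.IsFaceOf (cone u t)) :
    ∃ s ⊆ t, σ = cone u s := by
  refine ⟨t.filter fun r => u r ∈ σ, Finset.filter_subset _ _, le_antisymm (fun x hx => ?_) ?_⟩
  · obtain ⟨c, hc, rfl⟩ := mem_cone.1 (h.le hx)
    refine Submodule.sum_mem _ fun r hr => ?_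
    rcases (hc r hr).eq_or_lt with h0 | h0
    · rw [← h0, zero_smul]
      exact Submodule.zero_mem _
    · refine PointedCone.smul_mem _ h0.le (mem_cone_of_mem (Finset.mem_filter.2 ⟨hr, ?_⟩))
      rw [← Finset.add_sum_erase t _ hr] at hx
      refine h.mem_of_smul_add_mem (mem_cone_of_mem hr) (Submodule.sum_mem _ fun r' hr' => ?_) h0 hx
      have hr' := Finset.mem_of_mem_erase hr'
      exact PointedCone.smul_mem _ (hc r' hr') (mem_cone_of_mem hr')
  · exact cone_le_iff_forall.2 fun r hr => (Finset.mem_filter.1 hr).2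

end Cone

/-! ### Fans described by weighted complexes -/

section Model

variable {V : Type*} [AddCommGroup V] [Module ℝ V] {R : Type*} [DecidableEq R]

/-- The vectors `u` realize the faces of `C` as cones that meet along common faces. -/
structure Realizes (C : WeightedComplex R) (u : R → V) : Prop where
  lin_iff : ∀ φ, φ ∈ C.lin ↔ ∃ l : Module.Dual ℝ V, ∀ r, φ r = l (u r)
  inter : ∀ s t, C.face s → C.face t → ∀ x, x ∈ cone u s → x ∈ cone u t → x ∈ cone u (s ∩ t)

namespace Realizes

variable {C : WeightedComplex R} {u : R → V} {s t : Finset R}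

theorem isFree (hu : Realizes C u) (hC : C.IsGood) (hs : C.face s) : IsFree u s := by
  intro r hr
  obtain ⟨φ, hφ, h1, h0⟩ := hC.exists_dual hs r hr
  obtain ⟨l, hl⟩ := (hu.lin_iff φ).1 hφ
  exact ⟨l, by rw [← hl, h1], fun r' hr' hne => by rw [← hl, h0 r' hr' hne]⟩

/-- Otherwise `{r}` and `t` would be disjoint, so their cones would meet only in zero, whereas `u r`
is nonzero. -/
theorem mem_of_mem_cone (hu : Realizes C u) (hC : C.IsGood) (ht : C.face t) {r : R}
    (hr : C.face {r}) (h : u r ∈ cone u t) : r ∈ t := by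
  by_contra hrt
  have h1 := hu.inter _ _ hr ht _ (mem_cone_of_mem (Finset.mem_singleton_self r)) h
  rw [Finset.singleton_inter_of_notMem hrt, cone_empty] at h1
  exact (hu.isFree hC hr).ne_zero (Finset.mem_singleton_self r) h1

theorem cone_le_iff (hu : Realizes C u) (hC : C.IsGood) (hs : C.face s) (ht : C.face t) :
    cone u s ≤ cone u t ↔ s ⊆ t :=
  ⟨fun h _ hr => hu.mem_of_mem_cone hC ht (hC.mono hs (Finset.singleton_subset_iff.2 hr))
    (h (mem_cone_of_mem hr)), cone_mono⟩

theorem cone_inj (hu : Realizes C u) (hC : C.IsGood) (hs : C.face s) (ht : C.face t) :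
    cone u s = cone u t ↔ s = t :=
  ⟨fun h => ((hu.cone_le_iff hC hs ht).1 h.le).antisymm ((hu.cone_le_iff hC ht hs).1 h.ge),
    fun h => h ▸ rfl⟩

theorem isFaceOf_iff (hu : Realizes C u) (hC : C.IsGood) (hs : C.face s) (ht : C.face t) :
    (cone u s).IsFaceOf (cone u t) ↔ s ⊆ t :=
  ⟨fun h => (hu.cone_le_iff hC hs ht).1 h.le, fun h => (hu.isFree hC ht).isFaceOf h⟩

theorem coneDim (hu : Realizes C u) (hC : C.IsGood) (hs : C.face s) :
    coneDim (cone u s) = s.card :=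
  (hu.isFree hC hs).coneDim

/-- The images of the vectors in the quotient realize the star. -/
theorem star (hu : Realizes C u) (t : Finset R) :
    Realizes (C.star t) fun r => (coneSpan (cone u t)).mkQ (u r) where
  lin_iff φ := by
    rw [WeightedComplex.mem_star_lin, hu.lin_iff]
    constructor
    · rintro ⟨⟨l, hl⟩, h0⟩
      refine ⟨(coneSpan (cone u t)).liftQ l ?_, fun r => ?_⟩
      · rw [coneSpan_cone, Submodule.span_le]
        rintro _ ⟨r, hr, rfl⟩
        exact (hl r).symm.trans (h0 r hr)
      · rw [Submodule.mkQ_apply, Submodule.liftQ_apply, hl]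
    · rintro ⟨l, hl⟩
      refine ⟨⟨l ∘ₗ (coneSpan (cone u t)).mkQ, hl⟩, fun r hr => ?_⟩
      rw [hl, mkQ_eq_zero_of_mem hr, map_zero]
  inter := by
    intro s s' hs hs' x hx hx'
    rw [← map_cone, PointedCone.mem_map] at hx hx'
    obtain ⟨y, hy, rfl⟩ := hx
    obtain ⟨y', hy', hyy⟩ := hx'
    have h1 : y' - y ∈ Submodule.span ℝ (u '' (t : Set R)) := by
      rw [← coneSpan_cone]
      exact (Submodule.Quotient.eq _).1 hyy
    -- Positive and negative parts write an element of the span of `t` as a difference of points of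
    -- its cone. Then `y + a = y' + b` lies in the cones over `s ∪ t` and `s' ∪ t`, hence in the
    -- cone over `(s ∩ s') ∪ t`, and `t` disappears in the quotient.
    obtain ⟨a, ha, b, hb, hab⟩ : ∃ a ∈ cone u t, ∃ b ∈ cone u t, y' - y = a - b := by
      rw [Submodule.mem_span_image_finset_iff_exists_fun'] at h1
      obtain ⟨c, hc⟩ := h1
      refine ⟨∑ r ∈ t, (c r)⁺ • u r, mem_cone.2 ⟨fun r => (c r)⁺, fun r _ => posPart_nonneg _, rfl⟩,
        ∑ r ∈ t, (c r)⁻ • u r, mem_cone.2 ⟨fun r => (c r)⁻, fun r _ => negPart_nonneg _, rfl⟩, ?_⟩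
      rw [← hc, ← Finset.sum_sub_distrib]
      refine Finset.sum_congr rfl fun r _ => ?_
      rw [← sub_smul, posPart_sub_negPart]
    have h2 : y + a = y' + b := by
      rw [sub_eq_sub_iff_add_eq_add] at hab
      rw [add_comm, hab]
    have h3 := hu.inter _ _ hs.2 hs'.2 (y + a)
      (add_mem (cone_mono Finset.subset_union_left hy) (cone_mono Finset.subset_union_right ha))
      (h2 ▸ add_mem (cone_mono Finset.subset_union_left hy')
        (cone_mono Finset.subset_union_right hb))
    rw [← Finset.inter_union_distrib_right] at h3
    have h4 : (coneSpan (cone u t)).mkQ y = (coneSpan (cone u t)).mkQ (y + a) := by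
      rw [map_add, left_eq_add]
      exact (Submodule.Quotient.mk_eq_zero _).2 (Submodule.subset_span ha)
    rw [h4]
    have h5 := (PointedCone.mem_map (f := (coneSpan (cone u t)).mkQ)).2 ⟨_, h3, rfl⟩
    rw [map_cone] at h5
    refine (cone_le_iff_forall.2 fun r hr => ?_) h5
    rcases Finset.mem_union.1 hr with hr | hr
    · exact mem_cone_of_mem (u := fun r => (coneSpan (cone u t)).mkQ (u r)) hr
    · change (coneSpan (cone u t)).mkQ (u r) ∈ _
      rw [mkQ_eq_zero_of_mem hr]
      exact Submodule.zero_mem _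

end Realizes

/-- The fan `F` is described by the complex `C` and the vectors `u`. -/
structure IsModel (F : FanData V) (C : WeightedComplex R) (u : R → V) : Prop extends
    Realizes C u where
  mem_cones : ∀ σ, σ ∈ F.cones ↔ ∃ s, C.face s ∧ cone u s = σ
  dim_eq : F.dim = C.dim
  mark_eq : ∀ r, C.face {r} → F.mark (cone u {r}) = u r
  weight_eq : ∀ s, C.face s → s.card = C.dim → F.weight (cone u s) = C.weight s

namespace IsModel

variable {F : FanData V} {C : WeightedComplex R} {u : R → V} {t : Finset R}

theorem mem_nbhd (hM : IsModel F C u) (hC : C.IsGood) (ht : C.face t) {π : PointedCone ℝ V} :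
    π ∈ F.nbhd (cone u t) ↔ ∃ s, C.face (s ∪ t) ∧ cone u s = π := by
  simp only [FanData.nbhd, Finset.mem_filter, hM.mem_cones]
  constructor
  · rintro ⟨⟨s, hs, rfl⟩, _, ⟨q, hq, rfl⟩, h1, h2⟩
    rw [hM.isFaceOf_iff hC ht hq] at h1
    rw [hM.isFaceOf_iff hC hs hq] at h2
    exact ⟨s, hC.mono hq (Finset.union_subset h2 h1), rfl⟩
  · rintro ⟨s, hs, rfl⟩
    have hs' := hC.mono hs Finset.subset_union_left
    refine ⟨⟨s, hs', rfl⟩, _, ⟨_, hs, rfl⟩, ?_, ?_⟩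
    · exact (hM.isFaceOf_iff hC ht hs).2 Finset.subset_union_right
    · exact (hM.isFaceOf_iff hC hs' hs).2 Finset.subset_union_left

theorem map_cone_sdiff (s : Finset R) : (cone u s).map (coneSpan (cone u t)).mkQ =
    cone (fun r => (coneSpan (cone u t)).mkQ (u r)) (s \ t) := by
  rw [map_cone]
  refine le_antisymm (cone_le_iff_forall.2 fun r hr => ?_) (cone_mono Finset.sdiff_subset)
  by_cases hrt : r ∈ t
  · change (coneSpan (cone u t)).mkQ (u r) ∈ _
    rw [mkQ_eq_zero_of_mem hrt]
    exact Submodule.zero_mem _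
  · exact mem_cone_of_mem (u := fun r => (coneSpan (cone u t)).mkQ (u r))
      (Finset.mem_sdiff.2 ⟨hr, hrt⟩)

/-- The star of a fan is described by the star of the complex. -/
theorem star (hM : IsModel F C u) (hC : C.IsGood) (ht : C.face t) :
    IsModel (F.starFan (cone u t)) (C.star t) fun r => (coneSpan (cone u t)).mkQ (u r) where
  toRealizes := hM.toRealizes.star t
  mem_cones σ := by
    simp only [FanData.starFan, Finset.mem_image, hM.mem_nbhd hC ht]
    constructor
    · rintro ⟨_, ⟨s, hs, rfl⟩, rfl⟩
      exact ⟨s \ t, ⟨Finset.sdiff_disjoint, by rwa [Finset.sdiff_union_self_eq_union]⟩,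
        (map_cone_sdiff s).symm⟩
    · rintro ⟨s, hs, rfl⟩
      exact ⟨_, ⟨s, hs.2, rfl⟩, map_cone _⟩
  dim_eq := by
    change F.dim - coneDim _ = _
    rw [hM.coneDim hC ht, hM.dim_eq, WeightedComplex.star_dim]
  mark_eq r hr := by
    have hr' : C.face {r} := hC.mono hr.2 Finset.subset_union_left
    have hex : ∃ ρ ∈ F.nbhd (cone u t), coneDim ρ = 1 ∧ ρ.map (coneSpan (cone u t)).mkQ =
        cone (fun r => (coneSpan (cone u t)).mkQ (u r)) {r} :=
      ⟨cone u {r}, (hM.mem_nbhd hC ht).2 ⟨_, hr.2, rfl⟩, hM.coneDim hC hr', map_cone _⟩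
    have h0 : (F.starFan (cone u t)).mark
        (cone (fun r => (coneSpan (cone u t)).mkQ (u r)) {r}) =
        (coneSpan (cone u t)).mkQ (F.mark hex.choose) := dif_pos hex
    -- The chosen ray is not explicit; injectivity of cones in the star and the dimension identify
    -- it with the cone over `{r}`.
    obtain ⟨h1, h2, h3⟩ := hex.choose_spec
    obtain ⟨s, hs, hs'⟩ := (hM.mem_nbhd hC ht).1 h1
    rw [h0, ← hs']
    rw [← hs', map_cone_sdiff, (hM.toRealizes.star t).cone_inj (hC.star ht)
      ⟨Finset.sdiff_disjoint, by rwa [Finset.sdiff_union_self_eq_union]⟩ hr] at h3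
    rw [← hs', hM.coneDim hC (hC.mono hs Finset.subset_union_left)] at h2
    have h4 : s = {r} := by
      symm
      apply Finset.eq_of_subset_of_card_le
      · rw [← h3]
        exact Finset.sdiff_subset
      · rw [h2, Finset.card_singleton]
    rw [h4, hM.mark_eq r hr']
  weight_eq s hs hsc := by
    have hc := hC.card_le ht
    have hsu : (s ∪ t).card = C.dim := by
      rw [Finset.card_union_of_disjoint hs.1, hsc, WeightedComplex.star_dim]
      omega
    have hex : ∃ σ ∈ F.nbhd (cone u t), coneDim σ = F.dim ∧ σ.map (coneSpan (cone u t)).mkQ =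
        cone (fun r => (coneSpan (cone u t)).mkQ (u r)) s := by
      refine ⟨cone u (s ∪ t), (hM.mem_nbhd hC ht).2 ⟨_, ?_, rfl⟩, ?_, ?_⟩
      · rw [Finset.union_assoc, Finset.union_self]
        exact hs.2
      · rw [hM.coneDim hC hs.2, hM.dim_eq, hsu]
      · rw [map_cone_sdiff, Finset.union_sdiff_cancel_right hs.1]
    have h0 : (F.starFan (cone u t)).weight
        (cone (fun r => (coneSpan (cone u t)).mkQ (u r)) s) = F.weight hex.choose := dif_pos hex
    obtain ⟨h1, h2, h3⟩ := hex.choose_spec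
    obtain ⟨q, hq, hq'⟩ := (hM.mem_nbhd hC ht).1 h1
    rw [h0, ← hq']
    rw [← hq', map_cone_sdiff, (hM.toRealizes.star t).cone_inj (hC.star ht)
      ⟨Finset.sdiff_disjoint, by rwa [Finset.sdiff_union_self_eq_union]⟩ hs] at h3
    have hq1 := hC.mono hq Finset.subset_union_left
    rw [← hq', hM.coneDim hC hq1, hM.dim_eq] at h2
    -- The face `q` already has maximal size, so it contains `t`.
    have h4 : q = q ∪ t := by
      apply Finset.eq_of_subset_of_card_le Finset.subset_union_left
      rw [h2]
      exact hC.card_le hq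
    have h5 : q = s ∪ t := by rw [← h3, Finset.sdiff_union_self_eq_union, ← h4]
    rw [h5, hM.weight_eq _ hs.2 hsu, WeightedComplex.star_weight]

end IsModel

end Model

end LorentzianFans

end

noncomputable section

namespace LorentzianFans

open scoped Classical

/-! ### The model of a product fan -/

section ProdModel

variable {V W : Type*} [AddCommGroup V] [Module ℝ V] [AddCommGroup W] [Module ℝ W]
  {R₁ R₂ : Type*} {u₁ : R₁ → V} {u₂ : R₂ → W}

/-- The vectors `(u₁ r, 0)` and `(0, u₂ r)`. -/
def sumVec (u₁ : R₁ → V) (u₂ : R₂ → W) : R₁ ⊕ R₂ → V × W :=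
  Sum.elim (fun r => (u₁ r, 0)) fun r => (0, u₂ r)

theorem cone_sumVec (s : Finset (R₁ ⊕ R₂)) : cone (sumVec u₁ u₂) s =
    Submodule.prod (cone u₁ s.toLeft) (cone u₂ s.toRight) := by
  refine le_antisymm (cone_le_iff_forall.2 ?_) ?_
  · rintro (r | r) hr
    · exact ⟨mem_cone_of_mem (Finset.mem_toLeft.2 hr), Submodule.zero_mem _⟩
    · exact ⟨Submodule.zero_mem _, mem_cone_of_mem (Finset.mem_toRight.2 hr)⟩
  · rintro ⟨x, y⟩ ⟨hx, hy⟩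
    have h1 : LinearMap.inl ℝ V W x ∈ cone (sumVec u₁ u₂) s := by
      have := (PointedCone.mem_map (f := LinearMap.inl ℝ V W)).2 ⟨x, hx, rfl⟩
      rw [map_cone] at this
      refine (cone_le_iff_forall.2 fun r hr => ?_) this
      exact mem_cone_of_mem (u := sumVec u₁ u₂) (Finset.mem_toLeft.1 hr)
    have h2 : LinearMap.inr ℝ V W y ∈ cone (sumVec u₁ u₂) s := by
      have := (PointedCone.mem_map (f := LinearMap.inr ℝ V W)).2 ⟨y, hy, rfl⟩
      rw [map_cone] at this
      refine (cone_le_iff_forall.2 fun r hr => ?_) this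
      exact mem_cone_of_mem (u := sumVec u₁ u₂) (Finset.mem_toRight.1 hr)
    have h3 : ((x, y) : V × W) = LinearMap.inl ℝ V W x + LinearMap.inr ℝ V W y := by simp
    rw [h3]
    exact add_mem h1 h2

theorem map_fst_prod (σ : PointedCone ℝ V) (τ : PointedCone ℝ W) :
    PointedCone.map (LinearMap.fst ℝ V W) (Submodule.prod σ τ) = σ := by
  ext x
  simp only [PointedCone.mem_map, Submodule.mem_prod]
  exact ⟨by rintro ⟨y, hy, rfl⟩; exact hy.1, fun hx => ⟨(x, 0), ⟨hx, τ.zero_mem⟩, rfl⟩⟩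

theorem map_snd_prod (σ : PointedCone ℝ V) (τ : PointedCone ℝ W) :
    PointedCone.map (LinearMap.snd ℝ V W) (Submodule.prod σ τ) = τ := by
  ext x
  simp only [PointedCone.mem_map, Submodule.mem_prod]
  exact ⟨by rintro ⟨y, hy, rfl⟩; exact hy.2, fun hx => ⟨(0, x), ⟨σ.zero_mem, hx⟩, rfl⟩⟩

variable {F : FanData V} {G : FanData W} {C₁ : WeightedComplex R₁} {C₂ : WeightedComplex R₂}
  [DecidableEq R₁] [DecidableEq R₂]

/-- Distinguishes the two kinds of rays in a product: one of the projections of such a ray is zero.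
-/
theorem coneDim_bot : coneDim (⊥ : PointedCone ℝ V) = 0 := by
  rw [← cone_empty (u := (id : V → V)), IsFree.coneDim (fun r hr => absurd hr (by simp)),
    Finset.card_empty]

/-- The product of fans is described by the product of complexes. -/
theorem IsModel.prod (h₁ : C₁.IsGood) (h₂ : C₂.IsGood) (hF : IsModel F C₁ u₁)
    (hG : IsModel G C₂ u₂) : IsModel (F.prod G) (C₁.prod C₂) (sumVec u₁ u₂) where
  lin_iff φ := by
    rw [WeightedComplex.mem_prod_lin, hF.lin_iff, hG.lin_iff]
    constructor
    · rintro ⟨⟨l₁, hl₁⟩, l₂, hl₂⟩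
      refine ⟨l₁.coprod l₂, ?_⟩
      rintro (r | r)
      · simpa [sumVec] using hl₁ r
      · simpa [sumVec] using hl₂ r
    · rintro ⟨l, hl⟩
      exact ⟨⟨l ∘ₗ LinearMap.inl ℝ V W, fun r => hl (Sum.inl r)⟩,
        l ∘ₗ LinearMap.inr ℝ V W, fun r => hl (Sum.inr r)⟩
  inter s t hs ht x hxs hxt := by
    rw [cone_sumVec, Submodule.mem_prod] at *
    rw [Finset.toLeft_inter, Finset.toRight_inter]
    exact ⟨hF.inter _ _ hs.1 ht.1 _ hxs.1 hxt.1, hG.inter _ _ hs.2 ht.2 _ hxs.2 hxt.2⟩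
  mem_cones σ := by
    simp only [FanData.prod, Finset.mem_image, Finset.mem_product, hF.mem_cones, hG.mem_cones,
      cone_sumVec]
    constructor
    · rintro ⟨⟨_, _⟩, ⟨⟨s, hs, rfl⟩, t, ht, rfl⟩, rfl⟩
      exact ⟨s.disjSum t, WeightedComplex.prod_face_disjSum.2 ⟨hs, ht⟩, by simp⟩
    · rintro ⟨s, hs, rfl⟩
      exact ⟨(_, _), ⟨⟨_, hs.1, rfl⟩, _, hs.2, rfl⟩, rfl⟩
  dim_eq := by
    rw [WeightedComplex.prod_dim, ← hF.dim_eq, ← hG.dim_eq]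
    rfl
  mark_eq := by
    rintro (r | r) hr
    · have hl : ({Sum.inl r} : Finset (R₁ ⊕ R₂)).toLeft = {r} := by ext; simp
      have hr' : ({Sum.inl r} : Finset (R₁ ⊕ R₂)).toRight = ∅ := by ext; simp
      have h := hr.1
      rw [hl] at h
      simp only [FanData.prod, cone_sumVec, map_fst_prod, map_snd_prod, hl, hr', cone_empty]
      rw [if_pos (by rw [hF.coneDim h₁ h]; rfl), hF.mark_eq r h,
        if_neg (by rw [coneDim_bot]; omega)]
      rfl
    · have hl : ({Sum.inr r} : Finset (R₁ ⊕ R₂)).toLeft = ∅ := by ext; simp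
      have hr' : ({Sum.inr r} : Finset (R₁ ⊕ R₂)).toRight = {r} := by ext; simp
      have h := hr.2
      rw [hr'] at h
      simp only [FanData.prod, cone_sumVec, map_fst_prod, map_snd_prod, hl, hr', cone_empty]
      rw [if_neg (by rw [coneDim_bot]; omega), if_pos (by rw [hG.coneDim h₂ h]; rfl),
        hG.mark_eq r h]
      rfl
  weight_eq s hs hsc := by
    have h3 := h₁.card_le hs.1
    have h4 := h₂.card_le hs.2
    have h5 : s.toLeft.card + s.toRight.card = _ := Finset.card_toLeft_add_card_toRight
    rw [hsc, WeightedComplex.prod_dim] at h5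
    simp only [FanData.prod, cone_sumVec, map_fst_prod, map_snd_prod, WeightedComplex.prod]
    rw [hF.weight_eq _ hs.1 (by omega), hG.weight_eq _ hs.2 (by omega)]

end ProdModel

/-! ### Rays, change of marking and balancing in terms of a model. -/

section Model

variable {V : Type*} [AddCommGroup V] [Module ℝ V] {R : Type*} [DecidableEq R]
  {F : FanData V} {C : WeightedComplex R} {u : R → V}

namespace IsModel

theorem mem_conesOfDim (hM : IsModel F C u) (hC : C.IsGood) {k : ℕ} {σ : PointedCone ℝ V} :
    σ ∈ F.conesOfDim k ↔ ∃ s, C.face s ∧ s.card = k ∧ cone u s = σ := by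
  rw [FanData.conesOfDim, Finset.mem_filter, hM.mem_cones]
  constructor
  · rintro ⟨⟨s, hs, rfl⟩, h⟩
    exact ⟨s, hs, by rwa [hM.coneDim hC hs] at h, rfl⟩
  · rintro ⟨s, hs, hk, rfl⟩
    exact ⟨⟨s, hs, rfl⟩, by rwa [hM.coneDim hC hs]⟩

theorem mem_rays (hM : IsModel F C u) (hC : C.IsGood) {σ : PointedCone ℝ V} :
    σ ∈ F.conesOfDim 1 ↔ ∃ r, C.face {r} ∧ cone u {r} = σ := by
  rw [hM.mem_conesOfDim hC]
  constructor
  · rintro ⟨s, hs, hk, rfl⟩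
    obtain ⟨r, rfl⟩ := Finset.card_eq_one.1 hk
    exact ⟨r, hs, rfl⟩
  · rintro ⟨r, hr, rfl⟩
    exact ⟨_, hr, Finset.card_singleton r, rfl⟩

theorem face_singleton (hC : C.IsGood) {s : Finset R} (hs : C.face s) {r : R} (hr : r ∈ s) :
    C.face {r} :=
  hC.mono hs (Finset.singleton_subset_iff.2 hr)

theorem raysOf_cone (hM : IsModel F C u) (hC : C.IsGood) {s : Finset R} (hs : C.face s) :
    F.raysOf (cone u s) = s.image fun r => cone u {r} := by
  ext σ
  rw [FanData.raysOf, Finset.mem_filter, hM.mem_rays hC, Finset.mem_image]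
  constructor
  · rintro ⟨⟨r, hr, rfl⟩, h⟩
    rw [hM.isFaceOf_iff hC hr hs, Finset.singleton_subset_iff] at h
    exact ⟨r, h, rfl⟩
  · rintro ⟨r, hr, rfl⟩
    have hr' := face_singleton hC hs hr
    refine ⟨⟨r, hr', rfl⟩, ?_⟩
    rwa [hM.isFaceOf_iff hC hr' hs, Finset.singleton_subset_iff]

theorem cone_singleton_injOn (hM : IsModel F C u) (hC : C.IsGood) {s : Finset R} (hs : C.face s) :
    Set.InjOn (fun r => cone u {r}) s := by
  intro r hr r' hr' h
  have := (hM.cone_inj hC (face_singleton hC hs hr) (face_singleton hC hs hr')).1 h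
  simpa using this

/-- Equivalent fans are described by rescaled complexes. -/
theorem exists_rescale (hM : IsModel F C u) (hC : C.IsGood) {G : FanData V}
    (h : F.Equivalent G) : ∃ (C' : WeightedComplex R) (u' : R → V) (c : R → ℝ),
      C'.IsGood ∧ IsModel G C' u' ∧ C.IsRescaling C' (Equiv.refl R) c := by
  obtain ⟨c₀, hc₀, hw⟩ := h.exists_scaling
  -- Equivalence provides a scalar only for the rays; elements in no face receive `1`, as a
  -- rescaling must be positive everywhere.
  set c : R → ℝ := fun r => if C.face {r} then c₀ (cone u {r}) else 1 with hc
  have hcpos : ∀ r, 0 < c r := by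
    intro r
    rw [hc]
    dsimp only
    split_ifs with hr
    · exact (hc₀ _ ((hM.mem_rays hC).2 ⟨r, hr, rfl⟩)).1
    · exact one_pos
  have hcone : ∀ s, cone (fun r => c r • u r) s = cone u s := by
    intro s
    refine le_antisymm (cone_le_iff_forall.2 fun r hr => ?_) (cone_le_iff_forall.2 fun r hr => ?_)
    · exact PointedCone.smul_mem _ (hcpos r).le (mem_cone_of_mem hr)
    · have := PointedCone.smul_mem _ (inv_pos.2 (hcpos r)).le
        (mem_cone_of_mem (u := fun r => c r • u r) hr)
      rwa [inv_smul_smul₀ (hcpos r).ne'] at this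
  have hinj : Function.Injective (WeightedComplex.rescale (Equiv.refl R) c) := by
    intro φ ψ hφψ
    ext r
    have := congrFun hφψ r
    exact mul_left_cancel₀ (hcpos r).ne' this
  refine ⟨⟨C.face, C.lin.map (WeightedComplex.rescale (Equiv.refl R) c), C.dim,
    fun s => (∏ r ∈ s, (c r)⁻¹) * C.weight s⟩, fun r => c r • u r, c, ?_, ?_, ?_⟩
  · refine ⟨hC.empty_face, hC.mono, hC.pure, fun {s} hs r hr => ?_, fun {s} hs hsc => ?_⟩
    · obtain ⟨φ, hφ, h1, h0⟩ := hC.exists_dual hs r hr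
      refine ⟨(c r)⁻¹ • WeightedComplex.rescale (Equiv.refl R) c φ,
        Submodule.smul_mem _ _ ⟨φ, hφ, rfl⟩, ?_, fun r' hr' hne => ?_⟩
      · change (c r)⁻¹ * (c r * φ r) = 1
        rw [h1, mul_one, inv_mul_cancel₀ (hcpos r).ne']
      · change (c r)⁻¹ * (c r' * φ r') = 0
        rw [h0 r' hr' hne, mul_zero, mul_zero]
    · exact mul_pos (Finset.prod_pos fun r _ => inv_pos.2 (hcpos r)) (hC.weight_pos hs hsc)
  · refine ⟨⟨fun φ => ?_, fun s t hs ht x => ?_⟩, fun σ => ?_, ?_, fun r hr => ?_,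
      fun s hs hsc => ?_⟩
    · rw [Submodule.mem_map]
      constructor
      · rintro ⟨φ, hφ, rfl⟩
        obtain ⟨l, hl⟩ := (hM.lin_iff φ).1 hφ
        refine ⟨l, fun r => ?_⟩
        rw [map_smul, ← hl]
        rfl
      · rintro ⟨l, hl⟩
        refine ⟨fun r => l (u r), (hM.lin_iff _).2 ⟨l, fun _ => rfl⟩, ?_⟩
        ext r
        rw [hl, map_smul]
        rfl
    · simp only [hcone]
      exact hM.inter s t hs ht x
    · rw [h.cones_eq, hM.mem_cones]
      simp only [hcone]
    · rw [h.dim_eq, hM.dim_eq]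
    · rw [hcone, (hc₀ _ ((hM.mem_rays hC).2 ⟨r, hr, rfl⟩)).2, hM.mark_eq r hr]
      simp only [hc]
      rw [if_pos hr]
    · rw [hcone, hw _ ((hM.mem_conesOfDim hC).2 ⟨s, hs, by rw [hM.dim_eq]; exact hsc, rfl⟩),
        hM.raysOf_cone hC hs, Finset.prod_image (hM.cone_singleton_injOn hC hs),
        hM.weight_eq s hs hsc]
      congr 1
      refine Finset.prod_congr rfl fun r hr => ?_
      simp only [hc]
      rw [if_pos (face_singleton hC hs hr)]
  · refine ⟨hcpos, fun s => ?_, fun φ => ?_, rfl, fun s _ _ => ?_⟩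
    · simp
    · exact ⟨fun ⟨ψ, hψ, h⟩ => hinj h ▸ hψ, fun h => ⟨φ, h, rfl⟩⟩
    · simp

variable [Fintype R]

/-- The facets containing a ridge `t` are the sets `t ∪ {r}` with `r` in the link, and the inner sum
is over the single ray of `r`. -/
theorem balance_sum (hM : IsModel F C u) (hC : C.IsGood) {t : Finset R} (ht : C.face t)
    (htc : t.card + 1 = C.dim) :
    (∑ σ ∈ (F.conesOfDim F.dim).filter (fun σ => (cone u t).IsFaceOf σ),
      ∑ ρ ∈ F.raysOf σ \ F.raysOf (cone u t), F.weight σ • F.mark ρ) =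
    ∑ r ∈ C.link t, C.weight (insert r t) • u r := by
  have himg : (F.conesOfDim F.dim).filter (fun σ => (cone u t).IsFaceOf σ) =
      (C.link t).image fun r => cone u (insert r t) := by
    ext σ
    rw [Finset.mem_filter, hM.mem_conesOfDim hC, Finset.mem_image]
    constructor
    · rintro ⟨⟨s, hs, hsc, rfl⟩, hts⟩
      rw [hM.isFaceOf_iff hC ht hs] at hts
      rw [hM.dim_eq, ← htc] at hsc
      obtain ⟨r, hr, rfl⟩ := Finset.exists_eq_insert_iff.2 ⟨hts, hsc.symm⟩
      exact ⟨r, WeightedComplex.mem_link.2 ⟨hr, hs⟩, rfl⟩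
    · rintro ⟨r, hr, rfl⟩
      obtain ⟨hrt, hr⟩ := WeightedComplex.mem_link.1 hr
      refine ⟨⟨_, hr, ?_, rfl⟩, ?_⟩
      · rw [Finset.card_insert_of_notMem hrt, htc, hM.dim_eq]
      · rw [hM.isFaceOf_iff hC ht hr]
        exact Finset.subset_insert r t
  rw [himg, Finset.sum_image]
  · refine Finset.sum_congr rfl fun r hr => ?_
    obtain ⟨hrt, hr⟩ := WeightedComplex.mem_link.1 hr
    have hr1 := face_singleton hC hr (Finset.mem_insert_self r t)
    have hsd : F.raysOf (cone u (insert r t)) \ F.raysOf (cone u t) = {cone u {r}} := by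
      rw [hM.raysOf_cone hC hr, hM.raysOf_cone hC ht, Finset.image_insert,
        Finset.insert_sdiff_of_notMem, Finset.sdiff_self, insert_empty_eq]
      intro hmem
      obtain ⟨r', hr', h⟩ := Finset.mem_image.1 hmem
      have := (hM.cone_inj hC (face_singleton hC ht hr') hr1).1 h
      rw [Finset.singleton_inj] at this
      exact hrt (this ▸ hr')
    rw [hsd, Finset.sum_singleton, hM.mark_eq r hr1, hM.weight_eq _ hr
      (by rw [Finset.card_insert_of_notMem hrt, htc])]
  · intro r hr r' hr' h
    obtain ⟨hrt, hr⟩ := WeightedComplex.mem_link.1 hr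
    obtain ⟨hrt', hr'⟩ := WeightedComplex.mem_link.1 hr'
    have := (hM.cone_inj hC hr hr').1 h
    have h2 : r ∈ insert r' t := this ▸ Finset.mem_insert_self r t
    exact (Finset.mem_insert.1 h2).resolve_right hrt

/-- A fan described by a complex that carries a degree functional is tropical. -/
theorem isTropical (hM : IsModel F C u) (hC : C.IsGood) {L : MvPolynomial R ℝ →ₗ[ℝ] ℝ}
    (hL : C.IsDegree L) : F.IsTropical where
  isSimplicialFan :=
    { nonempty := ⟨_, (hM.mem_cones _).2 ⟨∅, hC.empty_face, rfl⟩⟩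
      simplicial := by
        intro σ hσ
        obtain ⟨s, hs, rfl⟩ := (hM.mem_cones σ).1 hσ
        exact (hM.isFree hC hs).isSimplicial
      face_mem := by
        intro σ hσ τ hτ
        obtain ⟨s, hs, rfl⟩ := (hM.mem_cones σ).1 hσ
        obtain ⟨t, hts, rfl⟩ := exists_eq_cone_of_isFaceOf hτ
        exact (hM.mem_cones _).2 ⟨t, hC.mono hs hts, rfl⟩
      inter_isFaceOf := by
        intro σ hσ τ hτ
        obtain ⟨s, hs, rfl⟩ := (hM.mem_cones σ).1 hσ
        obtain ⟨t, ht, rfl⟩ := (hM.mem_cones τ).1 hτ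
        have : cone u s ⊓ cone u t = cone u (s ∩ t) :=
          le_antisymm (fun x hx => hM.inter s t hs ht x hx.1 hx.2)
            (le_inf (cone_mono Finset.inter_subset_left) (cone_mono Finset.inter_subset_right))
        rw [this]
        exact ⟨(hM.isFree hC hs).isFaceOf Finset.inter_subset_left,
          (hM.isFree hC ht).isFaceOf Finset.inter_subset_right⟩ }
  isPure := by
    intro σ hσ
    obtain ⟨s, hs, rfl⟩ := (hM.mem_cones σ).1 hσ.prop
    obtain ⟨t, hst, ht, htc⟩ := hC.pure hs
    have h1 := hσ.le_of_ge ((hM.mem_cones _).2 ⟨t, ht, rfl⟩) (cone_mono hst)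
    rw [hM.cone_le_iff hC ht hs] at h1
    rw [hM.coneDim hC hs, hst.antisymm h1, htc, hM.dim_eq]
  mark_ne_zero := by
    intro ρ hρ
    obtain ⟨r, hr, rfl⟩ := (hM.mem_rays hC).1 hρ
    rw [hM.mark_eq r hr]
    exact (hM.isFree hC hr).ne_zero (Finset.mem_singleton_self r)
  isBalanced := by
    intro τ hτ hdim
    obtain ⟨t, ht, rfl⟩ := (hM.mem_cones τ).1 hτ
    rw [hM.coneDim hC ht, hM.dim_eq] at hdim
    have hbal := hM.balance_sum hC ht hdim
    refine hbal ▸ ?_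
    -- Membership in the span is tested on functionals `l` that vanish on it. For such `l` the claim
    -- is the relation `L (linForm l * x_t) = 0`, expanded over the link of `t`.
    rw [← Subspace.forall_mem_dualAnnihilator_apply_eq_zero_iff]
    intro l hl
    rw [Submodule.mem_dualAnnihilator] at hl
    have h1 := hL.lin (fun r => l (u r)) ((hM.lin_iff _).2 ⟨l, fun _ => rfl⟩) (setMonomial t)
    have h2 := hL.setMonomial_mul_linForm (t := t) (e := fun r => l (u r))
      (fun r hr => hl _ (Submodule.subset_span (mem_cone_of_mem hr))) 1
    rw [mul_one, mul_comm, h1] at h2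
    rw [map_sum, h2]
    refine Finset.sum_congr rfl fun r hr => ?_
    obtain ⟨hrt, hr⟩ := WeightedComplex.mem_link.1 hr
    rw [mul_one, hL.face _ hr, if_pos (by rw [Finset.card_insert_of_notMem hrt, hdim]), map_smul,
      smul_eq_mul, mul_comm]
  weight_pos := by
    intro σ hσ
    obtain ⟨s, hs, hsc, rfl⟩ := (hM.mem_conesOfDim hC).1 hσ
    rw [hM.dim_eq] at hsc
    rw [hM.weight_eq s hs hsc]
    exact hC.weight_pos hs hsc

/-- A balanced fan of dimension at most one has a degree functional. -/
theorem exists_isDegree_of_dim_le_one (hM : IsModel F C u) (hC : C.IsGood) (hF : F.IsBalanced)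
    (hd : C.dim ≤ 1) : ∃ L, C.IsDegree L := by
  refine hC.exists_isDegree_of_dim_le_one hd fun hd φ hφ => ?_
  have h1 := hF (cone u ∅) ((hM.mem_cones _).2 ⟨∅, hC.empty_face, rfl⟩)
    (by rw [hM.coneDim hC hC.empty_face, Finset.card_empty, hM.dim_eq, hd])
  have h2 := hM.balance_sum hC hC.empty_face (by rw [Finset.card_empty, hd])
  have h3 : ∑ r ∈ C.link ∅, C.weight (insert r ∅) • u r ∈ coneSpan (cone u ∅) := h2 ▸ h1
  rw [coneSpan_cone, Finset.coe_empty, Set.image_empty, Submodule.span_empty,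
    Submodule.mem_bot] at h3
  obtain ⟨l, hl⟩ := (hM.lin_iff φ).1 hφ
  have h4 := congrArg l h3
  rw [map_sum, map_zero] at h4
  rw [← h4]
  refine Finset.sum_congr rfl fun r _ => ?_
  rw [map_smul, hl, insert_empty_eq, smul_eq_mul]

end IsModel

end Model

end LorentzianFans

end

noncomputable section

namespace LorentzianFans

open scoped Classical

/-! ### The model of a tropical fan -/

namespace FanData

variable {V : Type*} [AddCommGroup V] [Module ℝ V] (F : FanData V)

/-- The marks as a family of vectors indexed by the rays. -/
def markVec (ρ : F.Ray) : V := F.mark ρ.1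

/-- The complex of a fan: sets of rays contained in a common cone. -/
def complex : WeightedComplex F.Ray where
  face s := ∃ σ ∈ F.cones, ∀ ρ ∈ s, ρ.1 ≤ σ
  lin := LinearMap.range (LinearMap.pi fun ρ => Module.Dual.eval ℝ V (F.markVec ρ) :
    Module.Dual ℝ V →ₗ[ℝ] F.Ray → ℝ)
  dim := F.dim
  weight s := F.weight (cone F.markVec s)

/-- The rays contained in a cone. -/
def raysLe (σ : PointedCone ℝ V) : Finset F.Ray := Finset.univ.filter fun ρ => ρ.1 ≤ σ

variable {F}

theorem mem_raysLe {σ : PointedCone ℝ V} {ρ : F.Ray} : ρ ∈ F.raysLe σ ↔ ρ.1 ≤ σ := by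
  simp [raysLe]

/-- A cone of a fan is generated by a free finite set of vectors, whose elements are positive
multiples of the marks of its rays. -/
theorem IsTropical.exists_generators (hF : F.IsTropical) {σ : PointedCone ℝ V}
    (hσ : σ ∈ F.cones) : ∃ S : Finset V, IsFree id S ∧ cone id S = σ ∧
      (∀ v ∈ S, ∃ ρ : F.Ray, ρ.1 = cone id {v} ∧ ∃ a : ℝ, 0 < a ∧ F.markVec ρ = a • v) ∧
      ∀ ρ : F.Ray, ρ.1 ≤ σ → ∃ v ∈ S, ρ.1 = cone id {v} := by
  obtain ⟨S, hfin, hli, rfl⟩ := hF.isSimplicialFan.simplicial σ hσ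
  obtain ⟨S, rfl⟩ := hfin.exists_finset_coe
  have hfree : IsFree id S := isFree_iff_linearIndepOn.2 hli
  have hcone : PointedCone.hull ℝ (S : Set V) = cone id S := by rw [cone, Set.image_id]
  rw [hcone] at hσ ⊢
  refine ⟨S, hfree, rfl, fun v hv => ?_, fun ρ hρ => ?_⟩
  · have hv' : ({v} : Finset V) ⊆ S := Finset.singleton_subset_iff.2 hv
    have h1 := hF.isSimplicialFan.face_mem _ hσ _ (hfree.isFaceOf hv')
    have h2 : coneDim (cone id {v}) = 1 := (hfree.mono hv').coneDim
    have h3 : cone id {v} ∈ F.conesOfDim 1 := Finset.mem_filter.2 ⟨h1, h2⟩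
    refine ⟨⟨_, h3⟩, rfl, ?_⟩
    obtain ⟨c, hc, h4⟩ := mem_cone.1 (F.mark_mem _ h1 h2)
    rw [Finset.sum_singleton] at h4
    have h5 := hF.mark_ne_zero _ h3
    refine ⟨c v, lt_of_le_of_ne (hc v (Finset.mem_singleton_self v)) ?_, h4⟩
    intro h0
    rw [h4, ← h0, zero_smul] at h5
    exact h5 rfl
  · have hρ' := Finset.mem_filter.1 ρ.2
    have h1 := (hF.isSimplicialFan.inter_isFaceOf _ hσ _ hρ'.1).1
    rw [inf_eq_right.2 hρ] at h1
    obtain ⟨s, hs, h2⟩ := exists_eq_cone_of_isFaceOf h1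
    have h3 := hρ'.2
    rw [h2, (hfree.mono hs).coneDim] at h3
    obtain ⟨v, rfl⟩ := Finset.card_eq_one.1 h3
    exact ⟨v, Finset.singleton_subset_iff.1 hs, h2⟩

/-- The rays inside a simplicial cone are exactly the half-lines through its generators, and
positive scaling from generators to marks preserves both freeness and the cone. -/
theorem IsTropical.isFree_raysLe (hF : F.IsTropical) {σ : PointedCone ℝ V}
    (hσ : σ ∈ F.cones) : IsFree F.markVec (F.raysLe σ) ∧ cone F.markVec (F.raysLe σ) = σ := by
  obtain ⟨S, hfree, hcone, hS, hrays⟩ := hF.exists_generators hσ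
  have hmark : ∀ ρ ∈ F.raysLe σ, ∃ v ∈ S, ρ.1 = cone id {v} ∧
      ∃ a : ℝ, 0 < a ∧ F.markVec ρ = a • v := by
    intro ρ hρ
    obtain ⟨v, hv, h1⟩ := hrays ρ (mem_raysLe.1 hρ)
    obtain ⟨ρ', h2, h3⟩ := hS v hv
    obtain rfl : ρ = ρ' := Subtype.ext (h1.trans h2.symm)
    exact ⟨v, hv, h1, h3⟩
  refine ⟨fun ρ hρ => ?_, le_antisymm ?_ ?_⟩
  · obtain ⟨v, hv, h1, a, ha, h2⟩ := hmark ρ hρ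
    obtain ⟨l, hl1, hl0⟩ := hfree v hv
    refine ⟨a⁻¹ • l, ?_, fun ρ' hρ' hne => ?_⟩
    · rw [h2, LinearMap.smul_apply, map_smul]
      change a⁻¹ • a • l (id v) = 1
      rw [hl1, smul_eq_mul, smul_eq_mul, mul_one, inv_mul_cancel₀ ha.ne']
    · obtain ⟨v', hv', h1', a', ha', h2'⟩ := hmark ρ' hρ'
      have hvv : v' ≠ v := by
        rintro rfl
        exact hne (Subtype.ext (h1'.trans h1.symm))
      have := hl0 v' hv' hvv
      rw [id] at this
      rw [h2', LinearMap.smul_apply, map_smul, this, smul_zero, smul_zero]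
  · refine cone_le_iff_forall.2 fun ρ hρ => ?_
    have hρ' := Finset.mem_filter.1 ρ.2
    exact mem_raysLe.1 hρ (F.mark_mem _ hρ'.1 hρ'.2)
  · rw [← hcone]
    refine cone_le_iff_forall.2 fun v hv => ?_
    obtain ⟨ρ, h1, a, ha, h2⟩ := hS v hv
    have h3 : ρ ∈ F.raysLe (cone id S) := by
      rw [mem_raysLe, h1]
      exact cone_mono (Finset.singleton_subset_iff.2 hv)
    have := PointedCone.smul_mem _ (inv_pos.2 ha).le (mem_cone_of_mem (u := F.markVec) h3)
    rwa [h2, inv_smul_smul₀ ha.ne'] at this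

/-- The marks of the rays inside `ρ` freely generate it, so by dimension `ρ` is the only one. -/
theorem IsTropical.cone_singleton (hF : F.IsTropical) (ρ : F.Ray) :
    cone F.markVec {ρ} = ρ.1 := by
  have hρ := Finset.mem_filter.1 ρ.2
  obtain ⟨h1, h2⟩ := hF.isFree_raysLe hρ.1
  have h3 := h1.coneDim
  rw [h2, hρ.2] at h3
  obtain ⟨ρ', h4⟩ := Finset.card_eq_one.1 h3.symm
  have h5 : ρ ∈ F.raysLe ρ.1 := mem_raysLe.2 le_rfl
  rw [h4, Finset.mem_singleton] at h5
  rw [h4, ← h5] at h2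
  exact h2

theorem IsTropical.isFree_of_face (hF : F.IsTropical) {s : Finset F.Ray}
    (hs : F.complex.face s) : IsFree F.markVec s ∧ cone F.markVec s ∈ F.cones := by
  obtain ⟨σ, hσ, hs⟩ := hs
  obtain ⟨h1, h2⟩ := hF.isFree_raysLe hσ
  have hsub : s ⊆ F.raysLe σ := fun ρ hρ => mem_raysLe.2 (hs ρ hρ)
  refine ⟨h1.mono hsub, hF.isSimplicialFan.face_mem σ hσ _ ?_⟩
  have := h1.isFaceOf hsub
  rwa [h2] at this

theorem face_raysLe {σ : PointedCone ℝ V} (hσ : σ ∈ F.cones) : F.complex.face (F.raysLe σ) :=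
  ⟨σ, hσ, fun _ hρ => mem_raysLe.1 hρ⟩

theorem mem_complex_lin {φ : F.Ray → ℝ} :
    φ ∈ F.complex.lin ↔ ∃ l : Module.Dual ℝ V, ∀ ρ, φ ρ = l (F.markVec ρ) := by
  constructor
  · rintro ⟨l, rfl⟩
    exact ⟨l, fun _ => rfl⟩
  · rintro ⟨l, hl⟩
    exact ⟨l, funext fun ρ => (hl ρ).symm⟩

/-- A tropical fan is described by its complex. -/
theorem IsTropical.isModel (hF : F.IsTropical) : IsModel F F.complex F.markVec where
  lin_iff _ := mem_complex_lin
  inter s t hs ht x hxs hxt := by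
    obtain ⟨hs1, hs2⟩ := hF.isFree_of_face hs
    obtain ⟨ht1, ht2⟩ := hF.isFree_of_face ht
    -- The intersection is a face of the cone over `s`, generated by some `s' ⊆ s`. Each ray in `s'`
    -- also lies in the cone over `t`, is therefore a face of it, and so is one of the rays in `t`.
    obtain ⟨s', hs', h1⟩ := exists_eq_cone_of_isFaceOf
      (hF.isSimplicialFan.inter_isFaceOf _ hs2 _ ht2).1
    have hx : x ∈ cone F.markVec s' := h1 ▸ ⟨hxs, hxt⟩
    refine cone_mono (fun ρ hρ => Finset.mem_inter.2 ⟨hs' hρ, ?_⟩) hx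
    have h2 : ρ.1 ≤ cone F.markVec t := by
      rw [← hF.cone_singleton]
      exact ((cone_mono (Finset.singleton_subset_iff.2 hρ)).trans h1.ge).trans inf_le_right
    have hρ' := Finset.mem_filter.1 ρ.2
    have h3 := (hF.isSimplicialFan.inter_isFaceOf _ ht2 _ hρ'.1).1
    rw [inf_eq_right.2 h2] at h3
    obtain ⟨t', ht', h4⟩ := exists_eq_cone_of_isFaceOf h3
    have h5 := (ht1.mono ht').coneDim
    rw [← h4, hρ'.2] at h5
    obtain ⟨ρ', rfl⟩ := Finset.card_eq_one.1 h5.symm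
    rw [hF.cone_singleton] at h4
    rw [Subtype.ext h4]
    exact Finset.singleton_subset_iff.1 ht'
  mem_cones σ := by
    constructor
    · exact fun hσ => ⟨_, face_raysLe hσ, (hF.isFree_raysLe hσ).2⟩
    · rintro ⟨s, hs, rfl⟩
      exact (hF.isFree_of_face hs).2
  dim_eq := rfl
  mark_eq ρ _ := by
    rw [hF.cone_singleton]
    rfl
  weight_eq _ _ _ := rfl

theorem IsTropical.isGood (hF : F.IsTropical) : F.complex.IsGood where
  empty_face := by
    obtain ⟨σ, hσ⟩ := hF.isSimplicialFan.nonempty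
    exact ⟨σ, hσ, by simp⟩
  mono {s t} h hst := by
    obtain ⟨σ, hσ, h⟩ := h
    exact ⟨σ, hσ, fun ρ hρ => h ρ (hst hρ)⟩
  pure {s} hs := by
    obtain ⟨σ, hσ, hs⟩ := hs
    obtain ⟨σ', hσσ', hmax⟩ := F.cones.exists_le_maximal hσ
    refine ⟨F.raysLe σ', fun ρ hρ => mem_raysLe.2 ((hs ρ hρ).trans hσσ'),
      face_raysLe hmax.prop, ?_⟩
    obtain ⟨h1, h2⟩ := hF.isFree_raysLe hmax.prop
    rw [← h1.coneDim, h2]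
    exact hF.isPure σ' hmax
  exists_dual {s} hs ρ hρ := by
    obtain ⟨l, h1, h0⟩ := (hF.isFree_of_face hs).1 ρ hρ
    exact ⟨_, mem_complex_lin.2 ⟨l, fun _ => rfl⟩, h1, h0⟩
  weight_pos {s} hs hsc := by
    obtain ⟨h1, h2⟩ := hF.isFree_of_face hs
    exact hF.weight_pos _ (Finset.mem_filter.2 ⟨h2, h1.coneDim.trans hsc⟩)

end FanData

end LorentzianFans

end

noncomputable section

namespace LorentzianFans

open scoped Classical

open MvPolynomial

/-! ### Divisors and the Chow ring in terms of the model -/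

section Translation

variable {V : Type*} [AddCommGroup V] [Module ℝ V] {R : Type*} [DecidableEq R]
  {F : FanData V} {C : WeightedComplex R} {u : R → V}

theorem eq_of_mem_cone {l l' : Module.Dual ℝ V} {s : Finset R}
    (h : ∀ r ∈ s, l (u r) = l' (u r)) {x : V} (hx : x ∈ cone u s) : l x = l' x := by
  obtain ⟨c, -, rfl⟩ := mem_cone.1 hx
  simp only [map_sum, map_smul]
  exact Finset.sum_congr rfl fun r hr => by rw [h r hr]

/-- The values of a piecewise linear function on the vectors `u r` that span rays, and zero on the
other elements. -/
def evalPL (F : FanData V) (C : WeightedComplex R) (u : R → V) : F.PL →ₗ[ℝ] (R → ℝ) where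
  toFun φ r := if h : u r ∈ F.support ∧ C.face {r} then φ.1 ⟨u r, h.1⟩ else 0
  map_add' φ ψ := by
    ext r
    by_cases h : u r ∈ F.support ∧ C.face {r} <;> simp [h]
  map_smul' c φ := by
    ext r
    by_cases h : u r ∈ F.support ∧ C.face {r} <;> simp [h]

theorem evalPL_apply {r : R} (h : C.face {r}) (φ : F.PL) (h' : u r ∈ F.support) :
    evalPL F C u φ r = φ.1 ⟨u r, h'⟩ :=
  dif_pos ⟨h', h⟩

/-- The restriction of a linear function to the support. -/
def restrictDual (F : FanData V) (l : Module.Dual ℝ V) : F.PL :=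
  ⟨fun x => l x.1, fun _ _ => ⟨l, fun _ _ => rfl⟩⟩

theorem restrictDual_mem (l : Module.Dual ℝ V) : restrictDual F l ∈ F.linearPL :=
  ⟨l, fun _ => rfl⟩

namespace IsModel

theorem mem_support (hM : IsModel F C u) {s : Finset R} (hs : C.face s) {x : V}
    (hx : x ∈ cone u s) : x ∈ F.support :=
  ⟨_, (hM.mem_cones _).2 ⟨s, hs, rfl⟩, hx⟩

theorem mem_support_of_face (hM : IsModel F C u) {r : R} (hr : C.face {r}) : u r ∈ F.support :=
  hM.mem_support hr (mem_cone_of_mem (Finset.mem_singleton_self r))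

theorem exists_of_support (hM : IsModel F C u) (x : F.support) :
    ∃ s, C.face s ∧ x.1 ∈ cone u s := by
  obtain ⟨σ, hσ, hx⟩ := x.2
  obtain ⟨s, hs, rfl⟩ := (hM.mem_cones σ).1 hσ
  exact ⟨s, hs, hx⟩

theorem exists_dual_eqOn (hM : IsModel F C u) (hC : C.IsGood) (φ : F.PL) {s : Finset R}
    (hs : C.face s) : ∃ l : Module.Dual ℝ V, (∀ x : F.support, x.1 ∈ cone u s → φ.1 x = l x.1) ∧
      ∀ r ∈ s, evalPL F C u φ r = l (u r) := by
  obtain ⟨l, hl⟩ := φ.2 _ ((hM.mem_cones _).2 ⟨s, hs, rfl⟩)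
  refine ⟨l, hl, fun r hr => ?_⟩
  have hr' := face_singleton hC hs hr
  rw [evalPL_apply hr' φ (hM.mem_support_of_face hr')]
  exact hl _ (mem_cone_of_mem hr)

theorem evalPL_injective (hM : IsModel F C u) (hC : C.IsGood) :
    Function.Injective (evalPL F C u) := by
  intro φ ψ h
  ext x
  obtain ⟨s, hs, hx⟩ := hM.exists_of_support x
  obtain ⟨l, h1, h2⟩ := hM.exists_dual_eqOn hC φ hs
  obtain ⟨l', h1', h2'⟩ := hM.exists_dual_eqOn hC ψ hs
  rw [h1 x hx, h1' x hx]
  exact eq_of_mem_cone (fun r hr => by rw [← h2 r hr, ← h2' r hr, h]) hx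

/-- On every face the values extend to a linear function. Two such extensions agree on the overlap
of the cones, which is the cone over the common vertices, so they glue. -/
theorem exists_evalPL_eq (hM : IsModel F C u) (hC : C.IsGood) (e : R → ℝ) :
    ∃ φ : F.PL, ∀ r, C.face {r} → evalPL F C u φ r = e r := by
  have hex : ∀ s, ∃ l : Module.Dual ℝ V, C.face s → ∀ r ∈ s, l (u r) = e r := by
    intro s
    by_cases hs : C.face s
    · obtain ⟨l, hl⟩ := (hM.isFree hC hs).exists_dual e
      exact ⟨l, fun _ => hl⟩
    · exact ⟨0, fun h => absurd h hs⟩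
  choose l hl using hex
  choose s hs hxs using hM.exists_of_support
  have key : ∀ (x : F.support) (t : Finset R), C.face t → x.1 ∈ cone u t →
      l (s x) x.1 = l t x.1 := by
    intro x t ht hx
    refine eq_of_mem_cone (u := u) (s := s x ∩ t) (fun r hr => ?_)
      (hM.inter _ _ (hs x) ht _ (hxs x) hx)
    obtain ⟨h1, h2⟩ := Finset.mem_inter.1 hr
    rw [hl _ (hs x) r h1, hl t ht r h2]
  refine ⟨⟨fun x => l (s x) x.1, fun σ hσ => ?_⟩, fun r hr => ?_⟩
  · obtain ⟨t, ht, rfl⟩ := (hM.mem_cones σ).1 hσ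
    exact ⟨l t, fun x hx => key x t ht hx⟩
  · rw [evalPL_apply hr _ (hM.mem_support_of_face hr)]
    have h1 := mem_cone_of_mem (u := u) (Finset.mem_singleton_self r)
    exact (key _ {r} hr h1).trans (hl _ hr r (Finset.mem_singleton_self r))

theorem evalPL_restrictDual (hM : IsModel F C u) (l : Module.Dual ℝ V) {r : R}
    (hr : C.face {r}) : evalPL F C u (restrictDual F l) r = l (u r) :=
  evalPL_apply hr _ (hM.mem_support_of_face hr)

/-- Strict convexity in terms of the model. -/
theorem isStrictlyConvex_iff (hM : IsModel F C u) (hC : C.IsGood) (φ : F.PL) :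
    F.IsStrictlyConvex (Submodule.Quotient.mk φ) ↔ evalPL F C u φ ∈ C.conv ∅ := by
  constructor
  · intro h s _ hs
    obtain ⟨ψ, hψ, h0, hpos⟩ := h _ ((hM.mem_cones _).2 ⟨s, hs, rfl⟩)
    obtain ⟨l, hl⟩ := (Submodule.Quotient.eq _).1 hψ.symm
    have hl' : ∀ x : F.support, φ.1 x = ψ.1 x + l x.1 := fun x => by
      rw [← hl x]
      simp
    refine ⟨fun r => l (u r), (hM.lin_iff _).2 ⟨l, fun _ => rfl⟩, fun r hr => ?_,
      fun r hr hrs => ?_⟩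
    · have hr' := face_singleton hC hs hr
      rw [evalPL_apply hr' φ (hM.mem_support_of_face hr'), hl', h0 _ (mem_cone_of_mem hr), zero_add]
    · have hr' := face_singleton hC hrs (Finset.mem_insert_self r s)
      rw [evalPL_apply hr' φ (hM.mem_support_of_face hr'), hl']
      refine lt_add_of_pos_left _ (hpos _ ⟨_, (hM.mem_nbhd hC hs).2 ⟨{r}, ?_, rfl⟩,
        mem_cone_of_mem (Finset.mem_singleton_self r)⟩ fun hmem =>
          hr (hM.mem_of_mem_cone hC hs hr' hmem))
      rwa [← Finset.insert_eq]
  · intro h τ hτ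
    obtain ⟨s, hs, rfl⟩ := (hM.mem_cones τ).1 hτ
    obtain ⟨χ, hχ, h0, hpos⟩ := h s (Finset.empty_subset s) hs
    obtain ⟨l, hl⟩ := (hM.lin_iff χ).1 hχ
    have hev : ∀ r, C.face {r} →
        evalPL F C u (φ - restrictDual F l) r = evalPL F C u φ r - χ r := fun r hr => by
      rw [map_sub, Pi.sub_apply, hM.evalPL_restrictDual l hr, hl]
    have hev0 : ∀ r ∈ s, evalPL F C u (φ - restrictDual F l) r = 0 := fun r hr => by
      rw [hev r (face_singleton hC hs hr), h0 r hr, sub_self]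
    refine ⟨φ - restrictDual F l, ?_, fun x hx => ?_, ?_⟩
    · rw [Submodule.Quotient.eq, sub_sub_cancel_left]
      exact F.linearPL.neg_mem (restrictDual_mem l)
    · obtain ⟨m, h1, h2⟩ := hM.exists_dual_eqOn hC (φ - restrictDual F l) hs
      rw [h1 x hx]
      exact eq_of_mem_cone (l' := 0) (fun r hr => by rw [← h2 r hr, hev0 r hr]; rfl) hx
    · rintro x ⟨π, hπ, hx⟩ hxs
      obtain ⟨q, hq, rfl⟩ := (hM.mem_nbhd hC hs).1 hπ
      obtain ⟨m, h1, h2⟩ := hM.exists_dual_eqOn hC (φ - restrictDual F l) hq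
      rw [h1 x (cone_mono Finset.subset_union_left hx)]
      obtain ⟨c, hc, hxc⟩ := mem_cone.1 hx
      rw [hxc, map_sum]
      have hrq : ∀ r ∈ q, r ∉ s → 0 < m (u r) := fun r hr hrs => by
        rw [← h2 r (Finset.mem_union_left _ hr),
          hev r (face_singleton hC hq (Finset.mem_union_left _ hr)), sub_pos]
        exact hpos r hrs (hC.mono hq (Finset.insert_subset (Finset.mem_union_left _ hr)
          Finset.subset_union_right))
      have hrs : ∀ r ∈ s, m (u r) = 0 := fun r hr => by
        rw [← h2 r (Finset.mem_union_right _ hr), hev0 r hr]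
      -- The linear function vanishes on the generators in `s` and is positive on the others. Some
      -- generator outside `s` has a positive coefficient, since otherwise `x` would lie in the cone
      -- over `s`.
      refine Finset.sum_pos' (fun r hr => ?_) ?_
      · rw [map_smul, smul_eq_mul]
        refine mul_nonneg (hc r hr) ?_
        by_cases h : r ∈ s
        · exact (hrs r h).ge
        · exact (hrq r hr h).le
      · by_contra! hno
        refine hxs ?_
        rw [hxc]
        refine Submodule.sum_mem _ fun r hr => ?_
        by_cases h : r ∈ s
        · exact PointedCone.smul_mem _ (hc r hr) (mem_cone_of_mem h)
        · have h3 := hno r hr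
          rw [map_smul, smul_eq_mul] at h3
          have h4 : c r = 0 := le_antisymm
            (by_contra fun h5 => (mul_pos (not_le.1 h5) (hrq r hr h)).not_ge h3) (hc r hr)
          rw [h4, zero_smul]
          exact Submodule.zero_mem _

theorem conv_congr (hC : C.IsGood) {e e' : R → ℝ} (h : ∀ r, C.face {r} → e r = e' r)
    (he : e ∈ C.conv ∅) : e' ∈ C.conv ∅ := by
  intro s hs hf
  obtain ⟨φ, hφ, h1, h2⟩ := he s hs hf
  refine ⟨φ, hφ, fun r hr => ?_, fun r hr hrs => ?_⟩
  · rw [← h r (face_singleton hC hf hr), h1 r hr]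
  · rw [← h r (face_singleton hC hrs (Finset.mem_insert_self r s))]
    exact h2 r hr hrs

theorem isQuasiprojective_iff (hM : IsModel F C u) (hC : C.IsGood) :
    F.IsQuasiprojective ↔ (C.conv ∅).Nonempty := by
  constructor
  · rintro ⟨D, hD⟩
    obtain ⟨φ, rfl⟩ := Submodule.Quotient.mk_surjective _ D
    exact ⟨_, (hM.isStrictlyConvex_iff hC φ).1 hD⟩
  · rintro ⟨e, he⟩
    obtain ⟨φ, hφ⟩ := hM.exists_evalPL_eq hC e
    exact ⟨Submodule.Quotient.mk φ, (hM.isStrictlyConvex_iff hC φ).2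
      (conv_congr hC (fun r hr => (hφ r hr).symm) he)⟩

theorem finiteDimensional_div [Fintype R] (hM : IsModel F C u) (hC : C.IsGood) :
    FiniteDimensional ℝ F.Div :=
  have : FiniteDimensional ℝ F.PL := Module.Finite.of_injective _ (hM.evalPL_injective hC)
  inferInstance

end IsModel

end Translation

end LorentzianFans

end

noncomputable section

namespace LorentzianFans

open scoped Classical

open MvPolynomial

/-! ### The degree map and the mixed degree forms in terms of a model. -/

section ChowTranslation

variable {V : Type*} [AddCommGroup V] [Module ℝ V] {R : Type*} [DecidableEq R]
  {F : FanData V} {C : WeightedComplex R} {u : R → V}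

/-- Replace an element by the ray that it spans, and the elements that lie in no face by zero. -/
def toRayPoly (F : FanData V) (C : WeightedComplex R) (u : R → V) :
    MvPolynomial R ℝ →ₐ[ℝ] MvPolynomial F.Ray ℝ :=
  aeval fun r => if h : cone u {r} ∈ F.conesOfDim 1 ∧ C.face {r} then X ⟨cone u {r}, h.1⟩ else 0

theorem toRayPoly_X_of_not_face {r : R} (hr : ¬ C.face {r}) : toRayPoly F C u (X r) = 0 := by
  rw [toRayPoly, aeval_X, dif_neg fun h => hr h.2]

namespace IsModel

/-- The ray spanned by an element. -/
def ray (hM : IsModel F C u) (hC : C.IsGood) {r : R} (hr : C.face {r}) : F.Ray :=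
  ⟨cone u {r}, (hM.mem_rays hC).2 ⟨r, hr, rfl⟩⟩

theorem ray_inj (hM : IsModel F C u) (hC : C.IsGood) {r r' : R} (hr : C.face {r})
    (hr' : C.face {r'}) (h : hM.ray hC hr = hM.ray hC hr') : r = r' := by
  have := (hM.cone_inj hC hr hr').1 (congrArg Subtype.val h)
  rwa [Finset.singleton_inj] at this

theorem toRayPoly_X (hM : IsModel F C u) (hC : C.IsGood) {r : R} (hr : C.face {r}) :
    toRayPoly F C u (X r) = X (hM.ray hC hr) := by
  rw [toRayPoly, aeval_X]
  exact dif_pos ⟨(hM.ray hC hr).2, hr⟩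

theorem exists_eq_ray (hM : IsModel F C u) (hC : C.IsGood) (ρ : F.Ray) :
    ∃ r, ∃ hr : C.face {r}, hM.ray hC hr = ρ := by
  obtain ⟨r, hr, h⟩ := (hM.mem_rays hC).1 ρ.2
  exact ⟨r, hr, Subtype.ext h⟩

theorem markPoint_ray (hM : IsModel F C u) (hC : C.IsGood) {r : R} (hr : C.face {r}) :
    F.markPoint (hM.ray hC hr) = ⟨u r, hM.mem_support_of_face hr⟩ :=
  Subtype.ext (hM.mark_eq r hr)

/-- The element that spans a ray. -/
def ofRay (hM : IsModel F C u) (hC : C.IsGood) (ρ : F.Ray) : R := (hM.exists_eq_ray hC ρ).choose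

theorem face_ofRay (hM : IsModel F C u) (hC : C.IsGood) (ρ : F.Ray) :
    C.face {hM.ofRay hC ρ} :=
  (hM.exists_eq_ray hC ρ).choose_spec.choose

theorem ray_ofRay (hM : IsModel F C u) (hC : C.IsGood) (ρ : F.Ray) :
    hM.ray hC (hM.face_ofRay hC ρ) = ρ :=
  (hM.exists_eq_ray hC ρ).choose_spec.choose_spec

theorem ofRay_injective (hM : IsModel F C u) (hC : C.IsGood) :
    Function.Injective (hM.ofRay hC) := by
  intro ρ ρ' h
  rw [← hM.ray_ofRay hC ρ, ← hM.ray_ofRay hC ρ']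
  simp only [h]

theorem ofRay_ray (hM : IsModel F C u) (hC : C.IsGood) {r : R} (hr : C.face {r}) :
    hM.ofRay hC (hM.ray hC hr) = r :=
  hM.ray_inj hC _ hr (hM.ray_ofRay hC _)

theorem cone_ofRay (hM : IsModel F C u) (hC : C.IsGood) (ρ : F.Ray) :
    cone u {hM.ofRay hC ρ} = ρ.1 :=
  congrArg Subtype.val (hM.ray_ofRay hC ρ)

theorem mark_ray (hM : IsModel F C u) (hC : C.IsGood) (ρ : F.Ray) :
    F.mark ρ.1 = u (hM.ofRay hC ρ) := by
  rw [← hM.mark_eq _ (hM.face_ofRay hC ρ), hM.cone_ofRay hC]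

theorem toRayPoly_X_ofRay (hM : IsModel F C u) (hC : C.IsGood) (ρ : F.Ray) :
    toRayPoly F C u (X (hM.ofRay hC ρ)) = X ρ := by
  rw [hM.toRayPoly_X hC (hM.face_ofRay hC ρ), hM.ray_ofRay]

theorem coneMonomial_cone (hM : IsModel F C u) (hC : C.IsGood) {s : Finset R} (hs : C.face s) :
    F.coneMonomial (cone u s) =
      Ideal.Quotient.mk F.chowIdeal (toRayPoly F C u (setMonomial s)) := by
  rw [FanData.coneMonomial, setMonomial, map_prod, map_prod]
  refine Finset.prod_bij' (fun ρ _ => hM.ofRay hC ρ)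
    (fun r hr => hM.ray hC (face_singleton hC hs hr))
    ?_ ?_ ?_ ?_ ?_
  · intro ρ hρ
    have h := (Finset.mem_filter.1 hρ).2
    rwa [← hM.cone_ofRay hC, hM.isFaceOf_iff hC (hM.face_ofRay hC ρ) hs,
      Finset.singleton_subset_iff] at h
  · intro r hr
    refine Finset.mem_filter.2 ⟨Finset.mem_univ _, ?_⟩
    exact (hM.isFaceOf_iff hC (face_singleton hC hs hr) hs).2 (Finset.singleton_subset_iff.2 hr)
  · exact fun ρ _ => hM.ray_ofRay hC ρ
  · exact fun r hr => hM.ofRay_ray hC _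
  · intro ρ _
    rw [hM.toRayPoly_X_ofRay]
    rfl

variable [Fintype R]

theorem toRayPoly_linForm (hM : IsModel F C u) (hC : C.IsGood) (w : R → ℝ) :
    toRayPoly F C u (linForm w) = ∑ ρ, w (hM.ofRay hC ρ) • X ρ := by
  rw [linForm_apply, map_sum]
  refine (Fintype.sum_of_injective _ (hM.ofRay_injective hC) _ _ (fun r hr => ?_)
    fun ρ => ?_).symm
  · rw [map_smul, toRayPoly_X_of_not_face, smul_zero]
    exact fun h => hr ⟨_, hM.ofRay_ray hC h⟩
  · rw [map_smul, hM.toRayPoly_X_ofRay]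

theorem plToChow_eq (hM : IsModel F C u) (hC : C.IsGood) (φ : F.PL) : F.plToChow φ =
    Ideal.Quotient.mkₐ ℝ F.chowIdeal (toRayPoly F C u (linForm (evalPL F C u φ))) := by
  rw [hM.toRayPoly_linForm hC, map_sum]
  refine Finset.sum_congr rfl fun ρ _ => ?_
  rw [map_smul, evalPL_apply (hM.face_ofRay hC ρ) φ
    (hM.mem_support_of_face (hM.face_ofRay hC ρ)),
    ← hM.markPoint_ray hC (hM.face_ofRay hC ρ), hM.ray_ofRay]
  rfl

/-- Either some element spans no ray and its variable goes to zero, or all do and the corresponding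
rays lie in no common cone. -/
theorem mem_chowIdeal_of_not_face (hM : IsModel F C u) (hC : C.IsGood) {s : Finset R}
    (hs : ¬ C.face s) : toRayPoly F C u (setMonomial s) ∈ F.chowIdeal := by
  by_cases h : ∃ r ∈ s, ¬ C.face {r}
  · obtain ⟨r, hr, hr'⟩ := h
    rw [setMonomial, map_prod, Finset.prod_eq_zero hr (toRayPoly_X_of_not_face hr')]
    exact zero_mem _
  · push Not at h
    refine (le_sup_left : _ ≤ F.chowIdeal) (Ideal.subset_span
      ⟨s.preimage (hM.ofRay hC) (hM.ofRay_injective hC).injOn, ?_, ?_⟩)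
    · rintro ⟨σ, hσ, hsσ⟩
      obtain ⟨t, ht, rfl⟩ := (hM.mem_cones σ).1 hσ
      refine hs (hC.mono ht fun r hr => ?_)
      have := hsσ (hM.ray hC (h r hr)) (Finset.mem_preimage.2 (by rwa [hM.ofRay_ray]))
      exact Finset.singleton_subset_iff.1 ((hM.cone_le_iff hC (h r hr) ht).1 this)
    · rw [setMonomial, map_prod, ← Finset.prod_preimage (hM.ofRay hC) s
        (hM.ofRay_injective hC).injOn]
      · exact Finset.prod_congr rfl fun ρ _ => hM.toRayPoly_X_ofRay hC ρ
      · exact fun r hr hr' => absurd ⟨_, hM.ofRay_ray hC (h r hr)⟩ hr'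

/-- A degree map on the Chow ring induces a degree functional. -/
theorem isDegree_of_isDegreeMap (hM : IsModel F C u) (hC : C.IsGood) {f : F.Chow →ₗ[ℝ] ℝ}
    (hf : F.IsDegreeMap f) : C.IsDegree (f ∘ₗ (Ideal.Quotient.mkₐ ℝ F.chowIdeal).toLinearMap ∘ₗ
      (toRayPoly F C u).toLinearMap) where
  nonface s hs p := by
    have h : toRayPoly F C u (setMonomial s * p) ∈ F.chowIdeal := by
      rw [map_mul]
      exact Ideal.mul_mem_right _ _ (hM.mem_chowIdeal_of_not_face hC hs)
    change f (Ideal.Quotient.mk F.chowIdeal (toRayPoly F C u (setMonomial s * p))) = 0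
    rw [Ideal.Quotient.eq_zero_iff_mem.2 h, map_zero]
  lin φ hφ p := by
    have h : toRayPoly F C u (linForm φ * p) ∈ F.chowIdeal := by
      rw [map_mul]
      refine Ideal.mul_mem_right _ _ ((le_sup_right : _ ≤ F.chowIdeal) (Ideal.subset_span ?_))
      obtain ⟨l, hl⟩ := (hM.lin_iff φ).1 hφ
      refine ⟨l, ?_⟩
      rw [hM.toRayPoly_linForm hC]
      exact Finset.sum_congr rfl fun ρ _ => by rw [hl, hM.mark_ray hC]
    change f (Ideal.Quotient.mk F.chowIdeal (toRayPoly F C u (linForm φ * p))) = 0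
    rw [Ideal.Quotient.eq_zero_iff_mem.2 h, map_zero]
  face s hs := by
    change f (Ideal.Quotient.mk F.chowIdeal (toRayPoly F C u (setMonomial s))) = _
    rw [← hM.coneMonomial_cone hC hs, hf _ ((hM.mem_cones _).2 ⟨s, hs, rfl⟩), hM.coneDim hC hs,
      hM.dim_eq]
    exact if_ctx_congr Iff.rfl (fun h => hM.weight_eq s hs h) fun _ => rfl

/-- Variables of elements in no face are themselves nonface monomials, so `L` ignores their
coefficients. This makes up for `evalPL` prescribing only the values on rays. -/
theorem linForm_congr_of_face {L : MvPolynomial R ℝ →ₗ[ℝ] ℝ} (hL : C.IsDegree L) {a b : R → ℝ}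
    (h : ∀ r, C.face {r} → a r = b r) (p : MvPolynomial R ℝ) :
    L (linForm a * p) = L (linForm b * p) := by
  simp only [linForm_apply, Finset.sum_mul, map_sum, smul_mul_assoc, map_smul]
  refine Finset.sum_congr rfl fun r _ => ?_
  by_cases hr : C.face {r}
  · rw [h r hr]
  · have := hL.nonface {r} hr p
    rw [setMonomial, Finset.prod_singleton] at this
    rw [this, smul_zero, smul_zero]

theorem rename_toRayPoly_setMonomial (hM : IsModel F C u) (hC : C.IsGood) {s : Finset R}
    (hs : C.face s) : rename (hM.ofRay hC) (toRayPoly F C u (setMonomial s)) = setMonomial s := by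
  rw [setMonomial, map_prod, map_prod]
  refine Finset.prod_congr rfl fun r hr => ?_
  rw [hM.toRayPoly_X hC (face_singleton hC hs hr), rename_X, hM.ofRay_ray]

theorem apply_rename_of_mem_chowIdeal (hM : IsModel F C u) (hC : C.IsGood)
    {L : MvPolynomial R ℝ →ₗ[ℝ] ℝ} (hL : C.IsDegree L) {p : MvPolynomial F.Ray ℝ}
    (hp : p ∈ F.chowIdeal) : L (rename (hM.ofRay hC) p) = 0 := by
  -- The largest ideal in the kernel of the renamed functional; it suffices that it contains the
  -- generators of the Chow ideal.
  let J : Ideal (MvPolynomial F.Ray ℝ) :=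
    { carrier := {p | ∀ q, L (rename (hM.ofRay hC) (p * q)) = 0}
      zero_mem' := fun q => by simp
      add_mem' := fun ha hb q => by rw [add_mul, map_add, map_add, ha, hb, add_zero]
      smul_mem' := fun c p hp q => by
        rw [smul_eq_mul, mul_comm c, mul_assoc]
        exact hp _ }
  have hJ : F.chowIdeal ≤ J := by
    refine sup_le (Ideal.span_le.2 ?_) (Ideal.span_le.2 ?_)
    · rintro _ ⟨s, hs, rfl⟩ q
      have h1 : rename (hM.ofRay hC) (∏ ρ ∈ s, X ρ : MvPolynomial F.Ray ℝ) =
          setMonomial (s.map ⟨_, hM.ofRay_injective hC⟩) := by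
        rw [map_prod, setMonomial, Finset.prod_map]
        exact Finset.prod_congr rfl fun ρ _ => rename_X _ _
      rw [map_mul, h1]
      refine hL.nonface _ (fun hf => hs ⟨_, (hM.mem_cones _).2 ⟨_, hf, rfl⟩, fun ρ hρ => ?_⟩) _
      rw [← hM.cone_ofRay hC]
      exact cone_mono (Finset.singleton_subset_iff.2 (Finset.mem_map_of_mem _ hρ))
    · rintro _ ⟨l, rfl⟩ q
      have h1 : rename (hM.ofRay hC) (∑ ρ : F.Ray, l (F.mark ρ.1) • X ρ : MvPolynomial F.Ray ℝ) =
          linForm fun r => if C.face {r} then l (u r) else 0 := by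
        rw [map_sum, linForm_apply]
        refine Fintype.sum_of_injective _ (hM.ofRay_injective hC) _ _ (fun r hr => ?_)
          fun ρ => ?_
        · rw [if_neg fun h => hr ⟨_, hM.ofRay_ray hC h⟩, zero_smul]
        · rw [map_smul, rename_X, if_pos (hM.face_ofRay hC ρ), hM.mark_ray hC]
      rw [map_mul, h1, linForm_congr_of_face (b := fun r => l (u r)) hL fun r hr => if_pos hr]
      exact hL.lin _ ((hM.lin_iff _).2 ⟨l, fun _ => rfl⟩) _
  have := hJ hp 1
  rwa [mul_one] at this

/-- A degree functional descends to a degree map on the Chow ring. -/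
theorem exists_isDegreeMap (hM : IsModel F C u) (hC : C.IsGood) {L : MvPolynomial R ℝ →ₗ[ℝ] ℝ}
    (hL : C.IsDegree L) : ∃ f, F.IsDegreeMap f := by
  -- A linear section of the quotient map; its choice does not matter because the renamed functional
  -- kills the ideal.
  obtain ⟨g, hg⟩ :=
    (Ideal.Quotient.mkₐ ℝ F.chowIdeal).toLinearMap.exists_rightInverse_of_surjective
    (LinearMap.range_eq_top.2 (Ideal.Quotient.mkₐ_surjective ℝ F.chowIdeal))
  refine ⟨L ∘ₗ (rename (hM.ofRay hC)).toLinearMap ∘ₗ g, fun σ hσ => ?_⟩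
  obtain ⟨s, hs, rfl⟩ := (hM.mem_cones σ).1 hσ
  set p := toRayPoly F C u (setMonomial s) with hp
  have h1 : g (Ideal.Quotient.mk F.chowIdeal p) - p ∈ F.chowIdeal := by
    rw [← Ideal.Quotient.eq_zero_iff_mem, map_sub, sub_eq_zero]
    exact LinearMap.congr_fun hg (Ideal.Quotient.mk F.chowIdeal p)
  have h2 := hM.apply_rename_of_mem_chowIdeal hC hL h1
  rw [map_sub, map_sub, sub_eq_zero, hp, hM.rename_toRayPoly_setMonomial hC hs, hL.face s hs] at h2
  rw [hM.coneMonomial_cone hC hs, hM.coneDim hC hs, hM.dim_eq]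
  refine h2.trans ?_
  exact if_ctx_congr Iff.rfl (fun h => (hM.weight_eq s hs h).symm) fun _ => rfl

/-- The functional in `degreeMap` comes from a choice, but its pullback is a degree functional and
therefore equals `L`. -/
theorem degreeMap_toRayPoly (hM : IsModel F C u) (hC : C.IsGood) {L : MvPolynomial R ℝ →ₗ[ℝ] ℝ}
    (hL : C.IsDegree L) (p : MvPolynomial R ℝ) :
    F.degreeMap (Ideal.Quotient.mkₐ ℝ F.chowIdeal (toRayPoly F C u p)) = L p := by
  have hex := hM.exists_isDegreeMap hC hL
  have h : F.IsDegreeMap F.degreeMap := by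
    rw [FanData.degreeMap, dif_pos hex]
    exact hex.choose_spec
  rw [hL.unique hC (hM.isDegree_of_isDegreeMap hC h)]
  rfl

theorem mixedDegreeForm_mk (hM : IsModel F C u) (hC : C.IsGood) {L : MvPolynomial R ℝ →ₗ[ℝ] ℝ}
    (hL : C.IsDegree L) {k : ℕ} (φ : Fin k → F.PL) (a b : F.PL) :
    F.mixedDegreeForm (fun i => Submodule.Quotient.mk (φ i)) (Submodule.Quotient.mk a)
      (Submodule.Quotient.mk b) =
    degForm L (∏ i, linForm (evalPL F C u (φ i))) (evalPL F C u a) (evalPL F C u b) := by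
  rw [degForm_apply, ← hM.degreeMap_toRayPoly hC hL]
  simp only [map_mul, map_prod, ← hM.plToChow_eq hC]
  rw [mul_comm (∏ i, _)]
  rfl

/-- Both forms are compared with their common pullback to piecewise linear functions, which map onto
the divisors, and onto the functions on `R` modulo the radical. -/
theorem sigPos_mixedDegreeForm (hM : IsModel F C u) (hC : C.IsGood)
    {L : MvPolynomial R ℝ →ₗ[ℝ] ℝ} (hL : C.IsDegree L) {k : ℕ} (φ : Fin k → F.PL) :
    sigPos (F.mixedDegreeForm fun i => Submodule.Quotient.mk (φ i)).toQuadraticMap = 1 ↔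
      HasOnePos (degForm L (∏ i, linForm (evalPL F C u (φ i)))) := by
  have := hM.finiteDimensional_div hC
  set B := F.mixedDegreeForm fun i => Submodule.Quotient.mk (φ i) with hB
  have hsymm : ∀ x y, B x y = B y x := by
    intro x y
    obtain ⟨a, rfl⟩ := Submodule.Quotient.mk_surjective _ x
    obtain ⟨b, rfl⟩ := Submodule.Quotient.mk_surjective _ y
    rw [hB, hM.mixedDegreeForm_mk hC hL, hM.mixedDegreeForm_mk hC hL, degForm_symm]
  rw [sigPos_eq_one_iff hsymm, ← hasOnePos_comp_iff (B' := B.comp F.linearPL.mkQ F.linearPL.mkQ)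
    F.linearPL.mkQ one_pos (fun _ _ => (one_mul _).symm) fun v => ?_]
  · refine hasOnePos_comp_iff (evalPL F C u) one_pos (fun a b => ?_) fun v => ?_
    · rw [one_mul]
      exact hM.mixedDegreeForm_mk hC hL φ a b
    · obtain ⟨ψ, hψ⟩ := hM.exists_evalPL_eq hC v
      have h : ∀ x, degForm L (∏ i, linForm (evalPL F C u (φ i))) v x =
          degForm L (∏ i, linForm (evalPL F C u (φ i))) (evalPL F C u ψ) x := fun x => by
        rw [degForm_apply, degForm_apply, mul_left_comm, mul_left_comm _ (linForm (evalPL F C u ψ))]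
        exact linForm_congr_of_face hL (fun r hr => (hψ r hr).symm) _
      exact ⟨ψ, h, fun x => by rw [degForm_symm, h, degForm_symm]⟩
  · obtain ⟨ψ, rfl⟩ := Submodule.Quotient.mk_surjective _ v
    exact ⟨ψ, fun _ => rfl, fun _ => rfl⟩

/-- The signature condition for a fan in terms of its model. -/
theorem forall_sigPos_iff (hM : IsModel F C u) (hC : C.IsGood) {L : MvPolynomial R ℝ →ₗ[ℝ] ℝ}
    (hL : C.IsDegree L) (hd : 2 ≤ F.dim) :
    (∀ E : Fin (F.dim - 2) → F.Div, (∀ i, F.IsStrictlyConvex (E i)) →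
      sigPos (F.mixedDegreeForm E).toQuadraticMap = 1) ↔ C.HodgeAt L ∅ := by
  constructor
  · intro h E hcard hE
    choose g hg using hM.exists_evalPL_eq hC
    rw [Finset.card_empty, ← hM.dim_eq] at hcard
    have hlen : F.dim - 2 = E.length := by omega
    rw [hlen] at h
    have h1 := h (fun i => Submodule.Quotient.mk (g (E.get i))) fun i =>
      (hM.isStrictlyConvex_iff hC _).2 (conv_congr hC (fun r hr => (hg _ r hr).symm)
        (hE _ (List.get_mem E i)))
    rw [hM.sigPos_mixedDegreeForm hC hL] at h1
    convert h1 using 1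
    have h2 : ∏ i, linForm (evalPL F C u (g (E.get i))) =
        ((E.map fun e => evalPL F C u (g e)).map linForm).prod := by
      rw [← List.prod_ofFn, List.map_map]
      congr 1
      exact List.ofFn_getElem_eq_map E (fun e => linForm (evalPL F C u (g e)))
    refine LinearMap.ext₂ fun v w => ?_
    rw [degForm_apply, degForm_apply, setMonomial_empty, one_mul, h2]
    exact WeightedComplex.prod_linForm_congr _ E
      (fun e _ p => linForm_congr_of_face hL (fun r hr => (hg e r hr).symm) p) _
  · intro h E hE
    choose φ hφ using fun i => Submodule.Quotient.mk_surjective _ (E i)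
    obtain rfl : (fun i => Submodule.Quotient.mk (φ i)) = E := funext hφ
    rw [hM.sigPos_mixedDegreeForm hC hL]
    have h1 := h (List.ofFn fun i => evalPL F C u (φ i))
      (by rw [List.length_ofFn, Finset.card_empty, ← hM.dim_eq]; omega) (by
        intro e he
        obtain ⟨i, rfl⟩ := List.mem_ofFn.1 he
        exact (hM.isStrictlyConvex_iff hC _).1 (hE i))
    rwa [setMonomial_empty, one_mul, List.map_ofFn, List.prod_ofFn] at h1

/-- The signature condition for one family of divisors forces the degree map to exist. -/
theorem exists_isDegree_of_sigPos (hM : IsModel F C u) (hC : C.IsGood)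
    {k : ℕ} {E : Fin k → F.Div} (h : sigPos (F.mixedDegreeForm E).toQuadraticMap = 1) :
    ∃ L, C.IsDegree L := by
  by_cases hex : ∃ f, F.IsDegreeMap f
  · obtain ⟨f, hf⟩ := hex
    exact ⟨_, hM.isDegree_of_isDegreeMap hC hf⟩
  -- Without a degree map `degreeMap` is zero by convention, and the zero form has no positive
  -- eigenvalue.
  · have := hM.finiteDimensional_div hC
    have h0 : F.mixedDegreeForm E = 0 := by
      refine LinearMap.ext₂ fun v w => ?_
      change F.degreeMap _ = 0
      rw [FanData.degreeMap, dif_neg hex, LinearMap.zero_apply]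
    rw [h0, sigPos_eq_one_iff fun _ _ => rfl] at h
    obtain ⟨v, hv⟩ := h.exists_pos
    exact absurd hv (lt_irrefl _)

end IsModel

end ChowTranslation

end LorentzianFans

end

noncomputable section

namespace LorentzianFans

open scoped Classical

/-! ### The Lorentzian property of a fan and of its complex. -/

section Main

variable {V : Type*} [AddCommGroup V] [Module ℝ V] {R : Type*} [DecidableEq R] [Fintype R]
  {F : FanData V} {C : WeightedComplex R} {u : R → V}

/-- The Lorentzian property of a tropical fan in terms of its model. -/
theorem IsModel.isMarkedLorentzian_iff (hM : IsModel F C u) (hC : C.IsGood) (hF : F.IsTropical) :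
    F.IsMarkedLorentzian ↔ C.IsLorentzian := by
  have hdim : ∀ {t}, C.face t → (F.starFan (cone u t)).dim = C.dim - t.card := fun ht =>
    (hM.star hC ht).dim_eq
  constructor
  · intro h
    have hne := (hM.isQuasiprojective_iff hC).1 h.isQuasiprojective
    refine ⟨hne, fun hd => ?_⟩
    -- The signature condition at the zero cone, whose star has the same complex, forces a degree
    -- functional to exist.
    obtain ⟨L, hL⟩ : ∃ L, C.IsDegree L := by
      have hC' := hC.star hC.empty_face
      have hM' := hM.star hC hC.empty_face
      obtain ⟨D, hD⟩ := (hM'.isQuasiprojective_iff hC').2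
        (by rwa [WeightedComplex.star_empty])
      have h1 := h.sigPos_eq_one _ ((hM.mem_cones _).2 ⟨∅, hC.empty_face, rfl⟩)
        (by rw [hdim hC.empty_face]; simpa using hd) (fun _ => D) fun _ => hD
      rw [← WeightedComplex.star_empty (C := C)]
      exact hM'.exists_isDegree_of_sigPos hC' h1
    refine ⟨L, hL, fun t ht htc => ?_⟩
    rw [← hL.hodgeAt_starFunctional_iff hC ht]
    have hd' : 2 ≤ (F.starFan (cone u t)).dim := by
      rw [hdim ht]
      omega
    exact ((hM.star hC ht).forall_sigPos_iff (hC.star ht) (hL.starFunctional hC ht) hd').1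
      (h.sigPos_eq_one _ ((hM.mem_cones _).2 ⟨t, ht, rfl⟩) hd')
  · intro h
    refine ⟨hF, (hM.isQuasiprojective_iff hC).2 h.nonempty_conv, fun τ hτ hd => ?_⟩
    obtain ⟨t, ht, rfl⟩ := (hM.mem_cones τ).1 hτ
    have hd' := hd
    rw [hdim ht] at hd'
    obtain ⟨L, hL, hL'⟩ := h.exists_hodgeAt (by omega)
    refine ((hM.star hC ht).forall_sigPos_iff (hC.star ht) (hL.starFunctional hC ht) hd).2 ?_
    rw [hL.hodgeAt_starFunctional_iff hC ht]
    exact hL' t ht (by omega)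

theorem FanData.Equivalent.refl (F : FanData V) : F.Equivalent F :=
  ⟨rfl, rfl, fun _ => 1, fun _ _ => ⟨one_pos, (one_smul _ _).symm⟩, fun _ _ => by simp⟩

/-- The complex of a fan with a Lorentzian representative is Lorentzian. -/
theorem IsModel.isLorentzian (hM : IsModel F C u) (hC : C.IsGood) (h : F.IsLorentzian) :
    C.IsLorentzian := by
  obtain ⟨G, hFG, hG⟩ := h
  obtain ⟨C', u', c, hC', hM', hresc⟩ := hM.exists_rescale hC hFG
  exact hresc.isLorentzian ((hM'.isMarkedLorentzian_iff hC' hG.isTropical).1 hG)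

theorem IsModel.isLorentzian_of_isTropical (hM : IsModel F C u) (hC : C.IsGood)
    (hF : F.IsTropical) (h : C.IsLorentzian) : F.IsLorentzian :=
  ⟨F, .refl F, (hM.isMarkedLorentzian_iff hC hF).2 h⟩

/-- The Lorentzian property yields the functional only from dimension two on; below that balancing
does. -/
theorem IsModel.exists_isDegree (hM : IsModel F C u) (hC : C.IsGood) (hF : F.IsTropical)
    (h : C.IsLorentzian) : ∃ L, C.IsDegree L := by
  by_cases hd : 2 ≤ C.dim
  · obtain ⟨L, hL, -⟩ := h.exists_hodgeAt hd
    exact ⟨L, hL⟩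
  · exact hM.exists_isDegree_of_dim_le_one hC hF.isBalanced (by omega)

end Main

end LorentzianFans

theorem mainTheorem6
    {V₁ : Type*} [AddCommGroup V₁] [Module ℝ V₁] [FiniteDimensional ℝ V₁]
    {V₂ : Type*} [AddCommGroup V₂] [Module ℝ V₂] [FiniteDimensional ℝ V₂]
    (S₁ : LorentzianFans.FanData V₁) (S₂ : LorentzianFans.FanData V₂)
    (h₁ : S₁.IsTropical) (h₂ : S₂.IsTropical) :
    (S₁.prod S₂).IsLorentzian ↔ S₁.IsLorentzian ∧ S₂.IsLorentzian := by
  have hC₁ := h₁.isGood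
  have hC₂ := h₂.isGood
  have hM₁ := h₁.isModel
  have hM₂ := h₂.isModel
  have hM := hM₁.prod hC₁ hC₂ hM₂
  have hC := hC₁.prod hC₂
  constructor
  · intro h
    have hL := hM.isLorentzian hC h
    exact ⟨hM₁.isLorentzian_of_isTropical hC₁ h₁ (hL.of_prod_left hC₂),
      hM₂.isLorentzian_of_isTropical hC₂ h₂ (hL.of_prod_right hC₁)⟩
  · rintro ⟨hS₁, hS₂⟩
    have hK₁ := hM₁.isLorentzian hC₁ hS₁
    have hK₂ := hM₂.isLorentzian hC₂ hS₂
    obtain ⟨L₁, hL₁⟩ := hM₁.exists_isDegree hC₁ h₁ hK₁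
    obtain ⟨L₂, hL₂⟩ := hM₂.exists_isDegree hC₂ h₂ hK₂
    -- A Lorentzian fan has to be tropical, and the tensor functional provides the balancing of the
    -- product.
    obtain ⟨L, hL⟩ := LorentzianFans.exists_tensor L₁ L₂
    exact hM.isLorentzian_of_isTropical hC
      (hM.isTropical hC (hL₁.prod hC₁ hC₂ hL₂ hL)) (hK₁.prod hC₁ hC₂ hL₁ hL₂ hK₂)
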